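/- Let $k$ be an infinite field, $S=k[X_1,\dots,X_v]$ the polynomial ring with its standard grading ($\deg X_i=1$), $I\subseteq S$ a graded ideal, and $A=S/I$ with homogeneous maximal ideal $\mathfrak M=(X_1,\dots,X_v)A$. Assume that $d=\dim A\ge 1$, that $c=\operatorname{codim}A=\dim_k A_1-\dim A\ge 1$, and that $I\neq 0$ has initial degree $q\ge 2$, i.e. $q$ is the smallest degree of a nonzero form in $I$. Let $\beta_{i,j}(A)$ be the graded Betti numbers of $A$ over $S$, defined by a graded minimal free resolution with $F_i=\bigoplus_j S(-j)^{\beta_{i,j}(A)}$; put $\operatorname{indeg}A=\min\{j:\beta_{1,j}(A)\ne0\}$ and $\operatorname{reg}A=\max\{j-i:\beta_{i,j}(A)\neq 0\}$, and say that $A$ has $q$-linear resolution if $\operatorname{indeg}A=q$ and $\operatorname{reg}A=q-1$. Let $a(A)=\max\{n\in\mathbb Z:[H^d_{\mathfrak M}(A)]_n\ne 0\}$, and let $e(A)=\lim_{n\to\infty} d!\,\ell_A(A/\mathfrak M^n)/n^d$ be the multiplicity of $A$. Suppose that $A$ is Cohen–Macaulay (that is, the local ring $A_{\mathfrak M}$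 is Cohen–Macaulay). Then: 1. $e(A)\ge\binom{c+q-1}{q-1}$. 2. $a(A)=\operatorname{reg}A-d\ge q-d-1$. 3. The following conditions are equivalent: (a) $e(A)=\binom{c+q-1}{q-1}$; (b) $a(A)=q-d-1$; (c) $A$ has $q$-linear resolution. When the conditions in 3 hold, for every ideal $Q=(a_1,\dots,a_d)A$ generated by a linear system of parameters (that is, $a_1,\dots,a_d\in A_1$ and $\sqrt Q=\mathfrak M$), there is an isomorphism of graded $k$-algebras $A/Q\cong k[Y_1,\dots,Y_c]/(Y_1,\dots,Y_c)^q$, where $k[Y_1,\dots,Y_c]$ is a polynomial ring in $c$ variables of degree one. -/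

import Mathlib

open MvPolynomial

noncomputable section

namespace HomogeneousAlgebra

/-! ### Homogeneous algebras `A = S / I`, where `S = k[X_1, …, X_v]` has the standard grading -/

section Basic

variable {k : Type*} [Field k] {v : ℕ}

attribute [local instance] MvPolynomial.gradedAlgebra in
/-- `I` is a graded ideal of `S` for the standard grading `deg X_i = 1`. -/
def IsGradedIdeal (I : Ideal (MvPolynomial (Fin v) k)) : Prop :=
  I.IsHomogeneous (homogeneousSubmodule (Fin v) k)

/-- The graded piece `A_n` of `A = S / I`: the image of the forms of degree `n`. -/
def piece (I : Ideal (MvPolynomial (Fin v) k)) (n : ℕ) :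
    Submodule k (MvPolynomial (Fin v) k ⧸ I) :=
  (homogeneousSubmodule (Fin v) k n).map (Ideal.Quotient.mkₐ k I).toLinearMap

/-- The homogeneous maximal ideal `𝔐 = (X_1, …, X_v) A`. -/
def irrelevant (I : Ideal (MvPolynomial (Fin v) k)) : Ideal (MvPolynomial (Fin v) k ⧸ I) :=
  (idealOfVars (Fin v) k).map (Ideal.Quotient.mk I)

/-- `c = codim A`: the embedding dimension `dim_k A_1` minus the Krull dimension of `A`. -/
def IsCodim (I : Ideal (MvPolynomial (Fin v) k)) (c : ℕ) : Prop :=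
  ∃ d : ℕ, ringKrullDim (MvPolynomial (Fin v) k ⧸ I) = d ∧
    Module.finrank k (piece I 1) = d + c

/-- `q = indeg I`: the smallest degree of a nonzero form in `I`. -/
def IsIndegIdeal (I : Ideal (MvPolynomial (Fin v) k)) (q : ℕ) : Prop :=
  IsLeast {n : ℕ | ∃ f ∈ I, f ≠ 0 ∧ f.IsHomogeneous n} q

/-- `Q` is a parameter ideal of `A` generated by a linear system of parameters `a_1, …, a_d`,
where `d = dim A`: the `a_i` are of degree one and `Q` is `𝔐`-primary. -/
def IsLinearParameterIdeal (I : Ideal (MvPolynomial (Fin v) k)) (d : ℕ)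
    (Q : Ideal (MvPolynomial (Fin v) k ⧸ I)) : Prop :=
  ringKrullDim (MvPolynomial (Fin v) k ⧸ I) = d ∧
  ∃ a : Fin d → MvPolynomial (Fin v) k ⧸ I,
    (∀ i, a i ∈ piece I 1) ∧ Q = Ideal.span (Set.range a) ∧ Q.radical = irrelevant I

/-- `A / Q ≅ k[Y_1, …, Y_c] / (Y_1, …, Y_c)^q` as graded `k`-algebras. -/
def IsoTruncatedPolynomial (I : Ideal (MvPolynomial (Fin v) k))
    (Q : Ideal (MvPolynomial (Fin v) k ⧸ I)) (c q : ℕ) : Prop :=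
  ∃ φ : ((MvPolynomial (Fin v) k ⧸ I) ⧸ Q) ≃ₐ[k]
      (MvPolynomial (Fin c) k ⧸ (idealOfVars (Fin c) k) ^ q),
    ∀ n : ℕ, ((piece I n).map (Ideal.Quotient.mkₐ k Q).toLinearMap).map
      φ.toAlgHom.toLinearMap = piece ((idealOfVars (Fin c) k) ^ q) n

end Basic

/-! ### Multiplicity and the Cohen–Macaulay property -/

section General

/-- A Noetherian local ring is Cohen–Macaulay if its depth equals its dimension: the maximal ideal
contains a regular sequence of length the Krull dimension. -/
def IsCohenMacaulayLocal (R : Type*) [CommRing R] [IsLocalRing R] : Prop :=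
  IsNoetherianRing R ∧ ∃ rs : List R, (∀ r ∈ rs, r ∈ IsLocalRing.maximalIdeal R) ∧
    RingTheory.Sequence.IsRegular R rs ∧ ringKrullDim R = (rs.length : ℕ)

/-- The homogeneous algebra `A` is Cohen–Macaulay: the local ring `A_𝔐` is. -/
def IsCohenMacaulay {k : Type*} [Field k] {v : ℕ} (I : Ideal (MvPolynomial (Fin v) k)) : Prop :=
  ∃ _ : (irrelevant I).IsPrime, IsCohenMacaulayLocal (Localization.AtPrime (irrelevant I))

/-- `e` is the (Hilbert–Samuel) multiplicity of the ring `R` with respect to the ideal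
`J`, where `d = dim R` and the `R / J ^ n` have finite length: `e = lim d! · length (R / J ^ n) / n ^ d`. -/
def IsMultiplicity {R : Type*} [CommRing R] (J : Ideal R) (e : ℕ) : Prop :=
  ∃ d : ℕ, ringKrullDim R = d ∧ (∀ n : ℕ, IsFiniteLength R (R ⧸ J ^ n)) ∧
    Filter.Tendsto
      (fun n : ℕ => (d.factorial : ℝ) * ((Module.length R (R ⧸ J ^ n)).toNat : ℝ) / (n : ℝ) ^ d)
      Filter.atTop (nhds (e : ℝ))

end General

/-! ### Graded minimal free resolutions, Betti numbers, regularity -/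

section Resolution

variable {k : Type*} [Field k] {v : ℕ}

/-- A graded minimal free resolution
`⋯ → F_2 → F_1 → F_0 = S → S / I → 0` over `S`, with `F_i = ⨁_m S(-(deg i m))`;
`diff i` is the matrix of `F_{i+1} → F_i`. -/
structure MinimalGradedFreeResolution (I : Ideal (MvPolynomial (Fin v) k)) where
  rank : ℕ → ℕ
  deg : ∀ i, Fin (rank i) → ℤ
  diff : ∀ i, Matrix (Fin (rank i)) (Fin (rank (i + 1))) (MvPolynomial (Fin v) k)
  /-- the maps are homogeneous of degree zero -/
  homogeneous : ∀ i l m, diff i l m = 0 ∨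
    ∃ n : ℕ, (diff i l m).IsHomogeneous n ∧ deg (i + 1) m = deg i l + n
  /-- minimality: the entries lie in `(X_1, …, X_v)` -/
  minimal : ∀ i l m, diff i l m ∈ idealOfVars (Fin v) k
  rank_zero : rank 0 = 1
  deg_zero : ∀ l, deg 0 l = 0
  /-- the image of `F_1 → F_0 = S` is `I` -/
  exact_zero : ∀ f : Fin (rank 0) → MvPolynomial (Fin v) k,
    f ∈ LinearMap.range (diff 0).mulVecLin ↔ ∀ l, f l ∈ I
  exact : ∀ i, LinearMap.ker (diff i).mulVecLin = LinearMap.range (diff (i + 1)).mulVecLin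

open Classical in
/-- The graded Betti number `β_{i,j}(S / I)`: the number of summands `S(-j)` of `F_i` in a graded
minimal free resolution (which is unique up to isomorphism, so that any one may be chosen). -/
def gradedBetti (I : Ideal (MvPolynomial (Fin v) k)) (i : ℕ) (j : ℤ) : ℕ :=
  if h : Nonempty (MinimalGradedFreeResolution I) then
    Fintype.card {m : Fin (h.some.rank i) // h.some.deg i m = j}
  else 0

/-- `q = indeg A = min {j | β_{1,j}(A) ≠ 0}`. -/
def IsIndeg (I : Ideal (MvPolynomial (Fin v) k)) (q : ℤ) : Prop :=
  IsLeast {j : ℤ | gradedBetti I 1 j ≠ 0} q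

/-- `r = reg A = max {j - i | β_{i,j}(A) ≠ 0}`. -/
def IsReg (I : Ideal (MvPolynomial (Fin v) k)) (r : ℤ) : Prop :=
  IsGreatest {t : ℤ | ∃ (i : ℕ) (j : ℤ), gradedBetti I i j ≠ 0 ∧ t = j - i} r

/-- `A` has `q`-linear resolution: `indeg A = q` and `reg A = indeg A - 1`. -/
def HasLinearResolution (I : Ideal (MvPolynomial (Fin v) k)) (q : ℕ) : Prop :=
  IsIndeg I q ∧ IsReg I ((q : ℤ) - 1)

end Resolution

/-! ### Graded local cohomology `H^p_𝔐(A)` through the Čech complex on `X_1, …, X_v` -/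

section LocalCohomology

variable {k : Type*} [Field k] {v : ℕ}

/-- The element `x_s = ∏_{i ∈ s} X_i` of `A`. -/
def varProd (I : Ideal (MvPolynomial (Fin v) k)) (s : Finset (Fin v)) :
    MvPolynomial (Fin v) k ⧸ I :=
  ∏ i ∈ s, Ideal.Quotient.mk I (X i)

/-- The localization `A_{x_s}`. -/
abbrev Loc (I : Ideal (MvPolynomial (Fin v) k)) (s : Finset (Fin v)) : Type _ :=
  Localization.Away (varProd I s)

theorem varProd_dvd (I : Ideal (MvPolynomial (Fin v) k)) {s t : Finset (Fin v)} (h : s ⊆ t) :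
    varProd I s ∣ varProd I t :=
  Finset.prod_dvd_prod_of_subset _ _ _ h

/-- The canonical map `A_{x_s} → A_{x_t}` for `s ⊆ t`. -/
def locMap (I : Ideal (MvPolynomial (Fin v) k)) {s t : Finset (Fin v)} (h : s ⊆ t) :
    Loc I s →ₐ[k] Loc I t :=
  IsLocalization.Away.liftAlgHom (varProd I s)
    (f := IsScalarTower.toAlgHom k (MvPolynomial (Fin v) k ⧸ I) (Loc I t))
    (IsLocalization.Away.isUnit_of_dvd (varProd I t) (varProd_dvd I h))

/-- The homogeneous elements of degree `n : ℤ` of `A_{x_s}`: the fractions `a / x_s ^ m` with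
`a ∈ A_e`, where `e - m · #s = n`. -/
def locPiece (I : Ideal (MvPolynomial (Fin v) k)) (s : Finset (Fin v)) (n : ℤ) :
    Submodule k (Loc I s) :=
  Submodule.span k {y | ∃ (m e : ℕ), ∃ a ∈ piece I e, (e : ℤ) = n + m * s.card ∧
    y * algebraMap (MvPolynomial (Fin v) k ⧸ I) (Loc I s) (varProd I s ^ m) =
      algebraMap (MvPolynomial (Fin v) k ⧸ I) (Loc I s) a}

/-- The differential of the Čech complex `⨁_s A_{x_s}`:
`(d c)_t = ∑_{j ∈ t} (-1)^{#{i ∈ t | i < j}} c_{t \ {j}}`. -/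
def cechD (I : Ideal (MvPolynomial (Fin v) k)) :
    (∀ s : Finset (Fin v), Loc I s) →ₗ[k] (∀ s : Finset (Fin v), Loc I s) :=
  LinearMap.pi fun t => ∑ j ∈ t, ((-1 : k) ^ (t.filter (· < j)).card) •
    ((locMap I (Finset.erase_subset j t)).toLinearMap ∘ₗ LinearMap.proj (t.erase j))

/-- The degree `n` part of the module of `p`-cochains `⨁_{#s = p} A_{x_s}`. -/
def cechCochains (I : Ideal (MvPolynomial (Fin v) k)) (p : ℕ) (n : ℤ) :
    Submodule k (∀ s : Finset (Fin v), Loc I s) :=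
  Submodule.pi Set.univ fun s => if s.card = p then locPiece I s n else ⊥

/-- The `p`-cocycles of degree `n`. -/
def cechCocycles (I : Ideal (MvPolynomial (Fin v) k)) (p : ℕ) (n : ℤ) :
    Submodule k (∀ s : Finset (Fin v), Loc I s) :=
  cechCochains I p n ⊓ LinearMap.ker (cechD I)

/-- The `p`-coboundaries of degree `n`; there are none but `0` for `p = 0`. -/
def cechCoboundaries (I : Ideal (MvPolynomial (Fin v) k)) (p : ℕ) (n : ℤ) :
    Submodule k (∀ s : Finset (Fin v), Loc I s) :=
  match p with
  | 0 => ⊥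
  | p + 1 => (cechCochains I p n).map (cechD I)

/-- The graded piece `[H^p_𝔐(A)]_n` of local cohomology. -/
abbrev LocalCohomologyPiece (I : Ideal (MvPolynomial (Fin v) k)) (p : ℕ) (n : ℤ) : Type _ :=
  cechCocycles I p n ⧸ (cechCoboundaries I p n).comap (cechCocycles I p n).subtype

/-- `a = a(A) = max {n | [H^d_𝔐(A)]_n ≠ 0}`, where `d = dim A`. -/
def IsAInvariant (I : Ideal (MvPolynomial (Fin v) k)) (a : ℤ) : Prop :=
  ∃ d : ℕ, ringKrullDim (MvPolynomial (Fin v) k ⧸ I) = d ∧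
    IsGreatest {n : ℤ | Nontrivial (LocalCohomologyPiece I d n)} a

end LocalCohomology

end HomogeneousAlgebra

end

/-!
Let `A = S / I` be Cohen–Macaulay of dimension `d`. Since `k` is infinite there is a regular sequence
`l` of `d` linear forms on `A` (`DepthGE.exists_isLinearRegular`), and `J = I + (l)` contains all
forms of large degree (`IsLinearRegular.exists_forall_forms_le`). Let `s` be the top degree of the
Artinian ring `S / J`. Every invariant of the theorem can be read off from the Hilbert function `h`
of `S / J`:

* `reg A = s` (`isReg_of_isLinearRegular`): Betti numbers are Koszul cohomology groups, and passing
  to the quotient by a regular linear form `θ` preserves the largest total degree of nonvanishing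
  Koszul cohomology, because `θ` acts on Koszul cohomology as zero;
* `a(A) = s - d` (`IsLinearRegular.isAInvariant`): each `θ` lowers the top degree of local cohomology
  by one, because Čech cohomology is torsion with respect to linear forms;
* `e(A) = ∑ h(n)` (`IsLinearRegular.isMultiplicity`): the Hilbert function of `A` is the `d`-fold
  iterated sum of `h`;
* `h(n)` is the number of monomials of degree `n` in `c` variables for `n < q`
  (`IsLinearRegular.hilb_sup_ofList`), because `I` has no nonzero forms of degree less than `q`.

Hence `s ≥ q - 1` and `e(A) ≥ ∑_{n < q} h(n) = C(c + q - 1, q - 1)`, and the equality in either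
estimate means that `h` vanishes from degree `q` on (`length_artinian_reduction`). As the initial
degree of `A` is `q` in any case (`isIndeg_of_isIndegIdeal`), this is also the meaning of linear
resolution.

An ideal `Q` generated by a linear system of parameters is generated by a regular sequence of linear
forms as well, with generic linear combinations of the given parameters as entries
(`IsLinearParameterIdeal.exists_isLinearRegular`). So `A / Q` vanishes from degree `q` on, while below
degree `q` its relations are generated by linear forms; modulo these `S` becomes a polynomial ring
in `c` variables (`isoTruncatedPolynomial`).

Koszul and Čech complexes are both treated as complexes of families indexed by the subsets of the set
of variables (`cubeD`), and long exact cohomology sequences are replaced by diagram chases in short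
exact sequences of complexes (`IsShortExact`).
-/

noncomputable section

namespace HomogeneousAlgebra

/-! ### Exactness in short exact sequences of complexes -/

section Complexes

variable {T' T T'' : Type*} [AddCommGroup T'] [AddCommGroup T] [AddCommGroup T'']

/-- Exactness at the spot `p` of the complex `⋯ → C (p - 1) → C p → ⋯`, whose terms are subgroups
of one group `T` and whose differential is the restriction of `D : T → T`. -/
def ExactAt (D : T →+ T) (C : ℤ → AddSubgroup T) (p : ℤ) : Prop :=
  ∀ c ∈ C p, D c = 0 → ∃ b ∈ C (p - 1), D b = c

/-- A short exact sequence `0 → C' → C → C'' → 0` of complexes in the sense of `ExactAt`. -/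
structure IsShortExact (D' : T' →+ T') (C' : ℤ → AddSubgroup T') (D : T →+ T)
    (C : ℤ → AddSubgroup T) (D'' : T'' →+ T'') (C'' : ℤ → AddSubgroup T'')
    (α : T' →+ T) (β : T →+ T'') : Prop where
  comm_left : ∀ x, α (D' x) = D (α x)
  comm_right : ∀ y, β (D y) = D'' (β y)
  d_d : ∀ y, D (D y) = 0
  d_mem : ∀ p, ∀ y ∈ C p, D y ∈ C (p + 1)
  left_mem : ∀ p, ∀ x ∈ C' p, α x ∈ C p
  right_mem : ∀ p, ∀ y ∈ C p, β y ∈ C'' p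
  injective : Function.Injective α
  right_left : ∀ x, β (α x) = 0
  exact : ∀ p, ∀ y ∈ C p, β y = 0 → ∃ x ∈ C' p, α x = y
  surjective : ∀ p, ∀ z ∈ C'' p, ∃ y ∈ C p, β y = z

namespace IsShortExact

variable {D' : T' →+ T'} {C' : ℤ → AddSubgroup T'} {D : T →+ T} {C : ℤ → AddSubgroup T}
  {D'' : T'' →+ T''} {C'' : ℤ → AddSubgroup T''} {α : T' →+ T} {β : T →+ T''}

theorem exactAt_right (h : IsShortExact D' C' D C D'' C'' α β) {p : ℤ} (hC : ExactAt D C p)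
    (hC' : ExactAt D' C' (p + 1)) : ExactAt D'' C'' p := by
  intro z hz hDz
  obtain ⟨y, hy, rfl⟩ := h.surjective p z hz
  obtain ⟨x, hx, hxy⟩ := h.exact (p + 1) (D y) (h.d_mem p y hy) (by rw [h.comm_right, hDz])
  have hDx : D' x = 0 := h.injective (by rw [h.comm_left, hxy, h.d_d, map_zero])
  obtain ⟨w, hw, rfl⟩ := hC' x hx hDx
  rw [add_sub_cancel_right] at hw
  obtain ⟨u, hu, hDu⟩ := hC (y - α w) (sub_mem hy (h.left_mem p w hw))
    (by rw [map_sub, ← hxy, ← h.comm_left, sub_self])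
  refine ⟨β u, h.right_mem _ u hu, ?_⟩
  rw [← h.comm_right, hDu, map_sub, h.right_left, sub_zero]

/-- The map on cohomology induced by `α` is injective where the third complex is exact one step
before. -/
theorem exists_of_exists_left (h : IsShortExact D' C' D C D'' C'' α β) {p : ℤ}
    (hC'' : ExactAt D'' C'' (p - 1)) {x : T'}
    (hb : ∃ b ∈ C (p - 1), D b = α x) : ∃ b ∈ C' (p - 1), D' b = x := by
  obtain ⟨b, hb, hDb⟩ := hb
  obtain ⟨e, he, hDe⟩ := hC'' (β b) (h.right_mem _ b hb)
    (by rw [← h.comm_right, hDb, h.right_left])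
  obtain ⟨g, hg, rfl⟩ := h.surjective _ e he
  have hDg : D g ∈ C (p - 1) := by simpa using h.d_mem _ g hg
  obtain ⟨f, hf, hfb⟩ := h.exact (p - 1) (b - D g) (sub_mem hb hDg)
    (by rw [map_sub, h.comm_right, hDe, sub_self])
  refine ⟨f, hf, h.injective ?_⟩
  rw [h.comm_left, hfb, map_sub, h.d_d, sub_zero, hDb]

/-- If `α` induces zero on cohomology at `p`, then the cohomology of the second complex embeds
into that of the third. -/
theorem exactAt_middle (h : IsShortExact D' C' D C D'' C'' α β) {p : ℤ}
    (hC'' : ExactAt D'' C'' p)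
    (hα : ∀ x ∈ C' p, D' x = 0 → ∃ b ∈ C (p - 1), D b = α x) : ExactAt D C p := by
  intro c hc hDc
  obtain ⟨e, he, hDe⟩ := hC'' (β c) (h.right_mem _ c hc) (by rw [← h.comm_right, hDc, map_zero])
  obtain ⟨g, hg, rfl⟩ := h.surjective _ e he
  have hDg : D g ∈ C p := by simpa using h.d_mem _ g hg
  obtain ⟨f, hf, hfc⟩ := h.exact p (c - D g) (sub_mem hc hDg)
    (by rw [map_sub, h.comm_right, hDe, sub_self])
  obtain ⟨b, hb, hDb⟩ := hα f hf (h.injective (by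
    rw [h.comm_left, hfc, map_sub, h.d_d, hDc, sub_zero, map_zero]))
  exact ⟨b + g, add_mem hb hg, by rw [map_add, hDb, hfc, sub_add_cancel]⟩

end IsShortExact

end Complexes

/-! ### Complexes indexed by the subsets of the set of variables -/

section Cube

variable {v : ℕ}

/-- The sign `(-1) ^ #{i ∈ t | i < j}`. -/
def cubeSign (t : Finset (Fin v)) (j : Fin v) : ℤ := (-1) ^ (t.filter (· < j)).card

theorem cubeSign_mul_self (t : Finset (Fin v)) (j : Fin v) : cubeSign t j * cubeSign t j = 1 := by
  rw [cubeSign, ← mul_pow]; simp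

theorem cubeSign_erase_of_lt {t : Finset (Fin v)} {i j : Fin v} (h : i < j) :
    cubeSign (t.erase j) i = cubeSign t i := by
  unfold cubeSign
  congr 2
  ext l
  simp only [Finset.mem_filter, Finset.mem_erase]
  constructor
  · rintro ⟨⟨-, h1⟩, h2⟩; exact ⟨h1, h2⟩
  · rintro ⟨h1, h2⟩; exact ⟨⟨(h2.trans h).ne, h1⟩, h2⟩

theorem cubeSign_erase_of_gt {t : Finset (Fin v)} {i j : Fin v} (h : i < j) (hi : i ∈ t) :
    cubeSign (t.erase i) j = - cubeSign t j := by
  unfold cubeSign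
  have : t.filter (· < j) = insert i ((t.erase i).filter (· < j)) := by
    ext l
    simp only [Finset.mem_filter, Finset.mem_erase, Finset.mem_insert]
    by_cases hl : l = i
    · subst hl; simp [hi, h]
    · simp [hl]
  rw [this, Finset.card_insert_of_notMem (by simp), pow_succ]
  ring

theorem cubeSign_swap {t : Finset (Fin v)} {i j : Fin v} (hi : i ∈ t) (hj : j ∈ t) (h : i ≠ j) :
    cubeSign t j * cubeSign (t.erase j) i = - (cubeSign t i * cubeSign (t.erase i) j) := by
  rcases lt_or_gt_of_ne h with h | h
  · rw [cubeSign_erase_of_lt h, cubeSign_erase_of_gt h hi]; ring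
  · rw [cubeSign_erase_of_lt h, cubeSign_erase_of_gt h hj]; ring

variable {N' N N'' : Finset (Fin v) → Type*} [∀ s, AddCommGroup (N' s)] [∀ s, AddCommGroup (N s)]
  [∀ s, AddCommGroup (N'' s)]

/-- The differential `(d c)_t = ∑_{j ∈ t} ± f (c_{t \ {j}})` on `∏_s N s`, for given maps
`f : N (t \ {j}) → N t`. -/
def cubeD (f : ∀ t j, N (t.erase j) →+ N t) : (∀ s, N s) →+ (∀ s, N s) where
  toFun c t := ∑ j ∈ t, cubeSign t j • f t j (c (t.erase j))
  map_zero' := by ext t; simp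
  map_add' a b := by ext t; simp [Finset.sum_add_distrib]

theorem cubeD_apply (f : ∀ t j, N (t.erase j) →+ N t) (c : ∀ s, N s) (t : Finset (Fin v)) :
    cubeD f c t = ∑ j ∈ t, cubeSign t j • f t j (c (t.erase j)) := rfl

theorem cubeD_cubeD (f : ∀ t j, N (t.erase j) →+ N t)
    (hf : ∀ (c : ∀ s, N s) (t : Finset (Fin v)) (i j : Fin v), i ∈ t → j ∈ t → i ≠ j →
      f t j (f (t.erase j) i (c ((t.erase j).erase i))) =
        f t i (f (t.erase i) j (c ((t.erase i).erase j)))) (c : ∀ s, N s) :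
    cubeD f (cubeD f c) = 0 := by
  ext t
  simp only [cubeD_apply, map_sum, map_zsmul, Finset.smul_sum, smul_smul, Pi.zero_apply]
  rw [Finset.sum_sigma']
  refine Finset.sum_involution (fun x _ => ⟨x.2, x.1⟩) ?_ ?_ ?_ ?_
  · rintro ⟨j, i⟩ h
    simp only [Finset.mem_sigma, Finset.mem_erase] at h
    obtain ⟨hj, hij, hi⟩ := h
    simp only
    rw [hf c t i j hi hj hij, cubeSign_swap hi hj hij, neg_smul, neg_add_cancel]
  · rintro ⟨j, i⟩ h _ he
    simp only [Finset.mem_sigma, Finset.mem_erase] at h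
    simp only [Sigma.mk.injEq] at he
    exact h.2.1 he.1
  · rintro ⟨j, i⟩ h
    simp only [Finset.mem_sigma, Finset.mem_erase] at h ⊢
    exact ⟨h.2.2, fun e => h.2.1 e.symm, h.1⟩
  · rintro ⟨j, i⟩ h
    rfl

/-- The cochains of degree `p`: the families `c` with `c_s ∈ P s` that live on the subsets with
`p` elements. -/
def cubeCochains (P : ∀ s, AddSubgroup (N s)) (p : ℤ) : AddSubgroup (∀ s, N s) where
  carrier := {c | ∀ s, c s ∈ P s ∧ ((s.card : ℤ) ≠ p → c s = 0)}
  zero_mem' s := ⟨zero_mem _, fun _ => rfl⟩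
  add_mem' ha hb s := ⟨add_mem (ha s).1 (hb s).1, fun h => by
    rw [Pi.add_apply, (ha s).2 h, (hb s).2 h, add_zero]⟩
  neg_mem' ha s := ⟨neg_mem (ha s).1, fun h => by rw [Pi.neg_apply, (ha s).2 h, neg_zero]⟩

theorem mem_cubeCochains {P : ∀ s, AddSubgroup (N s)} {p : ℤ} {c : ∀ s, N s} :
    c ∈ cubeCochains P p ↔ ∀ s, c s ∈ P s ∧ ((s.card : ℤ) ≠ p → c s = 0) := Iff.rfl

theorem mem_cubeCochains_of {P : ∀ s, AddSubgroup (N s)} {p : ℤ} {c : ∀ s, N s}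
    (h1 : ∀ s, (s.card : ℤ) = p → c s ∈ P s) (h2 : ∀ s, (s.card : ℤ) ≠ p → c s = 0) :
    c ∈ cubeCochains P p := by
  intro s
  refine ⟨?_, h2 s⟩
  by_cases h : (s.card : ℤ) = p
  · exact h1 s h
  · rw [h2 s h]; exact zero_mem _

theorem card_erase_cast {t : Finset (Fin v)} {j : Fin v} (hj : j ∈ t) :
    ((t.erase j).card : ℤ) = t.card - 1 := by
  have := Finset.card_erase_add_one hj
  omega

theorem card_insert_cast {t : Finset (Fin v)} {j : Fin v} (hj : j ∉ t) :
    ((insert j t).card : ℤ) = t.card + 1 := by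
  rw [Finset.card_insert_of_notMem hj]; simp

theorem cubeD_mem {f : ∀ t j, N (t.erase j) →+ N t} {P : ∀ s, AddSubgroup (N s)}
    (hP : ∀ t, ∀ j ∈ t, ∀ x : N (t.erase j), x ∈ P (t.erase j) → f t j x ∈ P t)
    {p : ℤ} {c : ∀ s, N s}
    (hc : c ∈ cubeCochains P p) : cubeD f c ∈ cubeCochains P (p + 1) := by
  intro t
  refine ⟨sum_mem fun j hj => zsmul_mem (hP t j hj _ (hc _).1) _, fun ht => ?_⟩
  refine Finset.sum_eq_zero fun j hj => ?_
  rw [(hc _).2, map_zero, smul_zero]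
  rw [card_erase_cast hj]
  omega

/-- The map of families `c ↦ (α s (c s))_s`. -/
def familyMap (α : ∀ s, N' s →+ N s) : (∀ s, N' s) →+ (∀ s, N s) where
  toFun c s := α s (c s)
  map_zero' := by ext s; simp
  map_add' a b := by ext s; simp

theorem familyMap_apply (α : ∀ s, N' s →+ N s) (c : ∀ s, N' s) (s : Finset (Fin v)) :
    familyMap α c s = α s (c s) := rfl

/-- A short exact sequence of cube complexes may be given one subset at a time. -/
theorem cube_isShortExact {f' : ∀ t j, N' (t.erase j) →+ N' t} {f : ∀ t j, N (t.erase j) →+ N t}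
    {f'' : ∀ t j, N'' (t.erase j) →+ N'' t}
    {P' : ∀ s, AddSubgroup (N' s)} {P : ∀ s, AddSubgroup (N s)} {P'' : ∀ s, AddSubgroup (N'' s)}
    (α : ∀ s, N' s →+ N s) (β : ∀ s, N s →+ N'' s)
    (hf : ∀ (c : ∀ s, N s) (t : Finset (Fin v)) (i j : Fin v), i ∈ t → j ∈ t → i ≠ j →
      f t j (f (t.erase j) i (c ((t.erase j).erase i))) =
        f t i (f (t.erase i) j (c ((t.erase i).erase j))))
    (hP : ∀ t, ∀ j ∈ t, ∀ x : N (t.erase j), x ∈ P (t.erase j) → f t j x ∈ P t)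
    (comm_left : ∀ t j x, α t (f' t j x) = f t j (α _ x))
    (comm_right : ∀ t j x, β t (f t j x) = f'' t j (β _ x))
    (left_mem : ∀ s, ∀ x ∈ P' s, α s x ∈ P s)
    (right_mem : ∀ s, ∀ x ∈ P s, β s x ∈ P'' s)
    (injective : ∀ s, Function.Injective (α s))
    (right_left : ∀ s x, β s (α s x) = 0)
    (exact : ∀ s, ∀ y ∈ P s, β s y = 0 → ∃ x ∈ P' s, α s x = y)
    (surjective : ∀ s, ∀ z ∈ P'' s, ∃ y ∈ P s, β s y = z) :
    IsShortExact (cubeD f') (cubeCochains P') (cubeD f) (cubeCochains P)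
      (cubeD f'') (cubeCochains P'')
      (familyMap α) (familyMap β) where
  comm_left x := by ext t; simp [cubeD_apply, familyMap_apply, comm_left]
  comm_right x := by ext t; simp [cubeD_apply, familyMap_apply, comm_right]
  d_d := cubeD_cubeD f hf
  d_mem p y hy := cubeD_mem hP hy
  left_mem p x hx s := ⟨left_mem s _ (hx s).1, fun h => by simp [familyMap_apply, (hx s).2 h]⟩
  right_mem p x hx s := ⟨right_mem s _ (hx s).1, fun h => by simp [familyMap_apply, (hx s).2 h]⟩
  injective x y h := by
    ext s
    exact injective s (congrFun h s)
  right_left x := by ext s; simp [familyMap_apply, right_left]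
  exact p y hy h := by
    have : ∀ s, ∃ x ∈ P' s, α s x = y s := fun s => exact s _ (hy s).1 (congrFun h s)
    choose x hx hxy using this
    refine ⟨x, fun s => ⟨hx s, fun hs => injective s ?_⟩, ?_⟩
    · rw [hxy, (hy s).2 hs, map_zero]
    · ext s; simp [familyMap_apply, hxy]
  surjective p z hz := by
    classical
    have : ∀ s, ∃ y ∈ P s, β s y = z s := fun s => surjective s _ (hz s).1
    choose y hy hyz using this
    refine ⟨fun s => if (s.card : ℤ) = p then y s else 0,
      mem_cubeCochains_of (fun s hs => by simp [hs, hy]) (fun s hs => by simp [hs]), ?_⟩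
    ext s
    by_cases hs : (s.card : ℤ) = p
    · simp [familyMap_apply, hs, hyz]
    · simp [familyMap_apply, hs, (hz s).2 hs]

end Cube

/-! ### Koszul complexes -/

section Koszul

variable {v : ℕ} {R : Type*} [CommRing R] (x : Fin v → R)

/-- The differential of the Koszul (cochain) complex of the sequence `x` on the module `M`. -/
def koszulD (M : Type*) [AddCommGroup M] [Module R M] :
    (Finset (Fin v) → M) →+ (Finset (Fin v) → M) :=
  cubeD (N := fun _ => M) fun _ j => DistribSMul.toAddMonoidHom M (x j)

variable {M' M M'' : Type*} [AddCommGroup M'] [Module R M'] [AddCommGroup M] [Module R M]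
  [AddCommGroup M''] [Module R M'']

theorem koszulD_apply (c : Finset (Fin v) → M) (t : Finset (Fin v)) :
    koszulD x M c t = ∑ j ∈ t, cubeSign t j • x j • c (t.erase j) := rfl

/-- Exactness of the Koszul complex on the graded module `(M, P)` at the spot `p`: for a cochain
`c` of degree `n`, the entry `c_s` lies in `P (n + #s)`. -/
def KoszulExact (P : ℤ → AddSubgroup M) (p n : ℤ) : Prop :=
  ExactAt (koszulD x M) (cubeCochains (N := fun _ => M) fun s => P (n + s.card)) p

/-- The multiplication by each `x j` raises degrees by one. -/
def IsGradedBy (P : ℤ → AddSubgroup M) : Prop := ∀ n j, ∀ m ∈ P n, x j • m ∈ P (n + 1)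

/-- A short exact sequence `0 → M' → M → M'' → 0` of graded modules. -/
structure GradedShortExact (P' : ℤ → AddSubgroup M') (P : ℤ → AddSubgroup M)
    (P'' : ℤ → AddSubgroup M'') (α : M' →ₗ[R] M) (β : M →ₗ[R] M'') : Prop where
  graded : IsGradedBy x P
  left_mem : ∀ n, ∀ m ∈ P' n, α m ∈ P n
  right_mem : ∀ n, ∀ m ∈ P n, β m ∈ P'' n
  injective : Function.Injective α
  right_left : ∀ m, β (α m) = 0
  exact : ∀ n, ∀ y ∈ P n, β y = 0 → ∃ m ∈ P' n, α m = y
  surjective : ∀ n, ∀ z ∈ P'' n, ∃ y ∈ P n, β y = z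

variable {x}

theorem GradedShortExact.isShortExact {P' : ℤ → AddSubgroup M'} {P : ℤ → AddSubgroup M}
    {P'' : ℤ → AddSubgroup M''} {α : M' →ₗ[R] M} {β : M →ₗ[R] M''}
    (h : GradedShortExact x P' P P'' α β) (n : ℤ) :
    IsShortExact (koszulD x M') (cubeCochains (N := fun _ => M') fun s => P' (n + s.card))
      (koszulD x M) (cubeCochains (N := fun _ => M) fun s => P (n + s.card))
      (koszulD x M'') (cubeCochains (N := fun _ => M'') fun s => P'' (n + s.card))
      (familyMap (N' := fun _ => M') (N := fun _ => M) fun _ => α.toAddMonoidHom)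
      (familyMap (N' := fun _ => M) (N := fun _ => M'') fun _ => β.toAddMonoidHom) := by
  refine cube_isShortExact (N' := fun _ => M') (N := fun _ => M) (N'' := fun _ => M'')
    (fun _ => α.toAddMonoidHom) (fun _ => β.toAddMonoidHom) ?_ ?_ ?_ ?_ ?_ ?_ ?_ ?_ ?_ ?_
  · intro c t i j hi hj hij
    simp only [DistribSMul.toAddMonoidHom_apply]
    rw [Finset.erase_right_comm, smul_comm]
  · intro t j hj m hm
    have := h.graded (n + (t.erase j).card) j m hm
    rw [card_erase_cast hj] at this
    change x j • m ∈ P (n + t.card)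
    convert this using 2
    ring
  · intro t j m; simp
  · intro t j m; simp
  · exact fun s => h.left_mem _
  · exact fun s => h.right_mem _
  · exact fun s => h.injective
  · exact fun s => h.right_left
  · exact fun s => h.exact _
  · exact fun s => h.surjective _

/-- The contraction with the `i`-th basis element. -/
def koszulContract (i : Fin v) (c : Finset (Fin v) → M) : Finset (Fin v) → M :=
  fun s => if i ∈ s then 0 else cubeSign (insert i s) i • c (insert i s)

/-- The contraction is a homotopy between the multiplication by `x i` and zero. -/
theorem koszul_homotopy (i : Fin v) (c : Finset (Fin v) → M) :
    koszulD x M (koszulContract i c) + koszulContract i (koszulD x M c) = x i • c := by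
  ext t
  rw [Pi.add_apply, Pi.smul_apply, koszulD_apply]
  by_cases hi : i ∈ t
  · rw [koszulContract, if_pos hi, add_zero, Finset.sum_eq_single i]
    · rw [koszulContract, if_neg (Finset.notMem_erase i t), Finset.insert_erase hi, smul_comm (x i),
        smul_smul, cubeSign_mul_self, one_smul]
    · intro j hj hji
      rw [koszulContract, if_pos (Finset.mem_erase.2 ⟨hji.symm, hi⟩), smul_zero, smul_zero]
    · exact fun h => absurd hi h
  · rw [koszulContract, if_neg hi, koszulD_apply, Finset.sum_insert hi, smul_add, smul_smul,
      cubeSign_mul_self, one_smul, Finset.erase_insert hi, Finset.smul_sum, add_left_comm,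
      ← Finset.sum_add_distrib, Finset.sum_eq_zero, add_zero]
    intro j hj
    have hji : i ≠ j := fun h => hi (h ▸ hj)
    have hi' : i ∉ t.erase j := fun h => hi (Finset.mem_of_mem_erase h)
    have hins : insert i (t.erase j) = (insert i t).erase j :=
      (Finset.erase_insert_of_ne hji).symm
    rw [koszulContract, if_neg hi', hins, smul_comm (x j), smul_smul, smul_smul, ← add_smul]
    have key := cubeSign_swap (Finset.mem_insert_self i t) (Finset.mem_insert_of_mem hj) hji
    rw [Finset.erase_insert hi] at key
    have h1 := cubeSign_mul_self ((insert i t).erase j) i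
    have h2 := cubeSign_mul_self (insert i t) i
    have : cubeSign t j * cubeSign ((insert i t).erase j) i +
        cubeSign (insert i t) i * cubeSign (insert i t) j = 0 := by
      linear_combination (cubeSign (insert i t) i * cubeSign ((insert i t).erase j) i) * key
        - (cubeSign (insert i t) i * cubeSign (insert i t) j) * h1
        - (cubeSign t j * cubeSign ((insert i t).erase j) i) * h2
    rw [this, zero_smul]

theorem koszulD_smul (r : R) (c : Finset (Fin v) → M) :
    koszulD x M (r • c) = r • koszulD x M c := by
  ext t
  simp only [koszulD_apply, Pi.smul_apply, Finset.smul_sum]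
  refine Finset.sum_congr rfl fun j _ => ?_
  rw [smul_comm r, smul_comm r]

theorem koszulContract_mem {P : ℤ → AddSubgroup M} {p n : ℤ} {c : Finset (Fin v) → M}
    (hc : c ∈ cubeCochains (N := fun _ => M) (fun s => P (n + s.card)) p) (i : Fin v) :
    koszulContract i c ∈
      cubeCochains (N := fun _ => M) (fun s => P (n + 1 + s.card)) (p - 1) := by
  intro s
  rw [koszulContract]
  split_ifs with hi
  · exact ⟨zero_mem _, fun _ => rfl⟩
  · have hcard := card_insert_cast hi
    refine ⟨zsmul_mem ?_ _, fun hs => ?_⟩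
    · have : c (insert i s) ∈ P (n + (insert i s).card) := (hc (insert i s)).1
      rw [hcard] at this
      change c (insert i s) ∈ P (n + 1 + s.card)
      convert this using 2
      ring
    · rw [(hc _).2, smul_zero]
      rw [hcard]; omega

/-- An element of the ideal generated by the sequence acts as zero on Koszul cohomology. -/
theorem koszul_smul_exists {P : ℤ → AddSubgroup M} {p n : ℤ} {c : Finset (Fin v) → M}
    (hc : c ∈ cubeCochains (N := fun _ => M) (fun s => P (n + s.card)) p)
    (hD : koszulD x M c = 0) (a : Fin v → R) (ha : ∀ i n, ∀ m ∈ P n, a i • m ∈ P n) :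
    ∃ b ∈ cubeCochains (N := fun _ => M) (fun s => P (n + 1 + s.card)) (p - 1),
      koszulD x M b = (∑ i, a i * x i) • c := by
  refine ⟨∑ i, a i • koszulContract i c, sum_mem fun i _ s => ?_, ?_⟩
  · have := koszulContract_mem hc i s
    exact ⟨ha i _ _ this.1, fun h => by rw [Pi.smul_apply, this.2 h, smul_zero]⟩
  · rw [map_sum, Finset.sum_smul]
    refine Finset.sum_congr rfl fun i _ => ?_
    have := koszul_homotopy (x := x) i c
    rw [hD] at this
    have h0 : koszulContract i (0 : Finset (Fin v) → M) = 0 := by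
      ext s; simp [koszulContract]
    rw [h0, add_zero] at this
    rw [koszulD_smul, this, smul_smul]

theorem koszulExact_of_neg {P : ℤ → AddSubgroup M} {p n : ℤ} (hp : p < 0) :
    KoszulExact x P p n := by
  intro c hc _
  refine ⟨0, zero_mem _, ?_⟩
  rw [map_zero]
  ext s
  rw [(hc s).2 (by omega)]; rfl

theorem koszulExact_of_gt {P : ℤ → AddSubgroup M} {p n : ℤ} (hp : (v : ℤ) < p) :
    KoszulExact x P p n := by
  intro c hc _
  refine ⟨0, zero_mem _, ?_⟩
  rw [map_zero]
  ext s
  have : s.card ≤ v := by simpa using Finset.card_le_univ s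
  rw [(hc s).2 (by omega)]; rfl

theorem koszulExact_of_eq_bot {P : ℤ → AddSubgroup M} {p n : ℤ} (h : P (n + p) = ⊥) :
    KoszulExact x P p n := by
  intro c hc _
  refine ⟨0, zero_mem _, ?_⟩
  rw [map_zero]
  ext s
  by_cases hs : (s.card : ℤ) = p
  · have : c s ∈ P (n + s.card) := (hc s).1
    rw [hs, h] at this
    exact this.symm
  · rw [(hc s).2 hs]; rfl

variable (x) in
/-- The data of a graded module `(M, P)` with a linear form `θ = ∑ a_i x_i` that is a nonzerodivisor
on `M`, and of the quotient `(M'', P'')` of `M` by `θ`. -/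
structure LinearQuotient (P : ℤ → AddSubgroup M) (P'' : ℤ → AddSubgroup M'') (a : Fin v → R)
    (β : M →ₗ[R] M'') : Prop where
  shortExact : GradedShortExact x (fun n => P (n - 1)) P P''
    (LinearMap.lsmul R M (∑ i, a i * x i)) β
  smul_mem : ∀ i n, ∀ m ∈ P n, a i • m ∈ P n

namespace LinearQuotient

variable {P : ℤ → AddSubgroup M} {P'' : ℤ → AddSubgroup M''} {a : Fin v → R} {β : M →ₗ[R] M''}

theorem shift_cochains (n : ℤ) :
    (cubeCochains (N := fun _ : Finset (Fin v) => M) fun s => P (n + s.card - 1)) =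
      cubeCochains (N := fun _ => M) fun s => P (n - 1 + s.card) := by
  have : ∀ s : Finset (Fin v), n + (s.card : ℤ) - 1 = n - 1 + s.card := fun s => by ring
  simp only [this]

theorem koszul_isZero (h : LinearQuotient x P P'' a β) {p n : ℤ} {c : Finset (Fin v) → M}
    (hc : c ∈ cubeCochains (N := fun _ => M) (fun s => P (n + s.card - 1)) p)
    (hD : koszulD x M c = 0) :
    ∃ b ∈ cubeCochains (N := fun _ => M) (fun s => P (n + s.card)) (p - 1),
      koszulD x M b = familyMap (N' := fun _ => M) (N := fun _ => M) (fun _ =>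
        (LinearMap.lsmul R M (∑ i, a i * x i)).toAddMonoidHom) c := by
  rw [shift_cochains] at hc
  obtain ⟨b, hb, hDb⟩ := koszul_smul_exists hc hD a h.smul_mem
  rw [sub_add_cancel] at hb
  refine ⟨b, hb, ?_⟩
  rw [hDb]
  rfl

theorem koszulExact (h : LinearQuotient x P P'' a β) {p n : ℤ} (hE : KoszulExact x P'' p n) :
    KoszulExact x P p n :=
  (h.shortExact.isShortExact n).exactAt_middle hE fun _ hc hD => h.koszul_isZero hc hD

theorem koszulExact_pred (h : LinearQuotient x P P'' a β) {p n : ℤ}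
    (hE : KoszulExact x P'' (p - 1) n) : KoszulExact x P p (n - 1) := by
  intro c hc hD
  rw [← shift_cochains] at hc ⊢
  exact (h.shortExact.isShortExact n).exists_of_exists_left hE (h.koszul_isZero hc hD)

theorem koszulExact_quotient (h : LinearQuotient x P P'' a β) {p n : ℤ}
    (h1 : KoszulExact x P p n) (h2 : KoszulExact x P (p + 1) (n - 1)) :
    KoszulExact x P'' p n := by
  refine (h.shortExact.isShortExact n).exactAt_right h1 ?_
  rw [shift_cochains]
  exact h2

end LinearQuotient

end Koszul

/-! ### Forms, graded ideals and regular sequences of linear forms -/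

section Forms

variable {k : Type*} [Field k] {v : ℕ}

/-- The forms of degree `n : ℤ`; there are none but `0` if `n < 0`. -/
def forms (k : Type*) [Field k] (v : ℕ) (n : ℤ) : Submodule k (MvPolynomial (Fin v) k) where
  carrier := {f | ∀ m, coeff m f ≠ 0 → (m.degree : ℤ) = n}
  zero_mem' m h := absurd (coeff_zero m) h
  add_mem' {f g} hf hg m h := by
    by_contra hm
    have h1 : coeff m f = 0 := by by_contra h'; exact hm (hf m h')
    have h2 : coeff m g = 0 := by by_contra h'; exact hm (hg m h')
    rw [coeff_add, h1, h2, add_zero] at h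
    exact h rfl
  smul_mem' c f hf m h := hf m fun h' => h (by rw [coeff_smul, h', smul_zero])

theorem mem_forms {n : ℤ} {f : MvPolynomial (Fin v) k} :
    f ∈ forms k v n ↔ ∀ m, coeff m f ≠ 0 → (m.degree : ℤ) = n := Iff.rfl

theorem mem_forms_natCast {n : ℕ} {f : MvPolynomial (Fin v) k} :
    f ∈ forms k v n ↔ f.IsHomogeneous n := by
  rw [mem_forms]
  constructor
  · intro h m hm
    have := DFunLike.congr_fun (Finsupp.degree_eq_weight_one (R := ℕ) (σ := Fin v)) m
    exact this.symm.trans (by exact_mod_cast h m hm)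
  · intro h m hm
    by_contra hd
    exact hm (h.coeff_eq_zero (by exact_mod_cast hd))

theorem eq_zero_of_mem_forms_neg {n : ℤ} (hn : n < 0) {f : MvPolynomial (Fin v) k}
    (hf : f ∈ forms k v n) : f = 0 := by
  ext m
  by_contra h
  have := hf m (by simpa using h)
  omega

theorem C_mem_forms (a : k) : (C a : MvPolynomial (Fin v) k) ∈ forms k v 0 := by
  exact_mod_cast mem_forms_natCast.2 (isHomogeneous_C (Fin v) a)

theorem X_mem_forms (i : Fin v) : (X i : MvPolynomial (Fin v) k) ∈ forms k v 1 := by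
  exact_mod_cast mem_forms_natCast.2 (isHomogeneous_X k i)

theorem mul_mem_forms {m n : ℤ} {f g : MvPolynomial (Fin v) k} (hf : f ∈ forms k v m)
    (hg : g ∈ forms k v n) : f * g ∈ forms k v (m + n) := by
  classical
  intro d hd
  rw [coeff_mul] at hd
  obtain ⟨⟨a, b⟩, hab, h⟩ := Finset.exists_ne_zero_of_sum_ne_zero hd
  rw [Finset.HasAntidiagonal.mem_antidiagonal] at hab
  have h1 := hf a (left_ne_zero_of_mul h)
  have h2 := hg b (right_ne_zero_of_mul h)
  rw [← hab, map_add, Nat.cast_add, h1, h2]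

theorem pow_mem_forms {n : ℤ} {f : MvPolynomial (Fin v) k} (hf : f ∈ forms k v n) (m : ℕ) :
    f ^ m ∈ forms k v (m * n) := by
  induction m with
  | zero => simpa using C_mem_forms (v := v) (1 : k)
  | succ m ih =>
    rw [pow_succ]
    have := mul_mem_forms ih hf
    have h : (m : ℤ) * n + n = (m + 1 : ℕ) * n := by push_cast; ring
    rwa [h] at this

/-- The component of degree `n : ℤ` of a polynomial. -/
def component (n : ℤ) : MvPolynomial (Fin v) k →ₗ[k] MvPolynomial (Fin v) k :=
  if 0 ≤ n then homogeneousComponent n.toNat else 0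

theorem coeff_component (n : ℤ) (f : MvPolynomial (Fin v) k) (m : Fin v →₀ ℕ) :
    coeff m (component n f) = if (m.degree : ℤ) = n then coeff m f else 0 := by
  unfold component
  by_cases hn : 0 ≤ n
  · rw [if_pos hn, coeff_homogeneousComponent]
    congr 1
    apply propext; omega
  · rw [if_neg hn, if_neg (by omega)]
    simp

theorem component_mem (n : ℤ) (f : MvPolynomial (Fin v) k) : component n f ∈ forms k v n := by
  intro m hm
  rw [coeff_component] at hm
  by_contra h
  exact hm (if_neg h)

theorem component_of_mem {n : ℤ} {f : MvPolynomial (Fin v) k} (hf : f ∈ forms k v n) :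
    component n f = f := by
  ext m
  rw [coeff_component]
  split_ifs with h
  · rfl
  · by_contra h'
    exact h (hf m fun e => h' e.symm)

theorem component_mul {a : ℤ} (n : ℤ) {f : MvPolynomial (Fin v) k} (hf : f ∈ forms k v a)
    (g : MvPolynomial (Fin v) k) : component n (f * g) = f * component (n - a) g := by
  classical
  ext d
  rw [coeff_component, coeff_mul, coeff_mul]
  have key : ∀ x ∈ Finset.HasAntidiagonal.antidiagonal d,
      coeff x.1 f * coeff x.2 (component (n - a) g) =
      if (d.degree : ℤ) = n then coeff x.1 f * coeff x.2 g else 0 := by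
    intro x hx
    rw [Finset.HasAntidiagonal.mem_antidiagonal] at hx
    by_cases h : coeff x.1 f = 0
    · simp [h]
    · have h1 := hf _ h
      have h2 : (d.degree : ℤ) = x.1.degree + x.2.degree := by rw [← hx, map_add, Nat.cast_add]
      rw [coeff_component, h2, h1]
      by_cases h3 : (x.2.degree : ℤ) = n - a
      · rw [if_pos h3, if_pos (by omega)]
      · rw [if_neg h3, if_neg (by omega), mul_zero]
  rw [Finset.sum_congr rfl key]
  split_ifs with h
  · rfl
  · simp

theorem exists_sum_component (f : MvPolynomial (Fin v) k) :
    f = ∑ i ∈ Finset.range (f.totalDegree + 1), component (i : ℤ) f := by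
  conv_lhs => rw [← sum_homogeneousComponent f]
  refine Finset.sum_congr rfl fun i _ => ?_
  simp [component]

theorem mem_idealOfVars_iff {f : MvPolynomial (Fin v) k} :
    f ∈ idealOfVars (Fin v) k ↔ coeff 0 f = 0 := by
  have := mem_pow_idealOfVars_iff' 1 f
  rw [pow_one] at this
  rw [this]
  constructor
  · exact fun h => h 0 (by simp)
  · intro h m hm
    have : m = 0 := by
      rw [← Finsupp.degree_eq_zero_iff]; omega
    rw [this, h]

theorem forms_le_pow_idealOfVars {n : ℕ} {m : ℤ} (h : (n : ℤ) ≤ m) {f : MvPolynomial (Fin v) k}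
    (hf : f ∈ forms k v m) : f ∈ idealOfVars (Fin v) k ^ n := by
  rw [mem_pow_idealOfVars_iff']
  intro d hd
  by_contra h'
  have := hf d h'
  omega

/-- A form of nonzero degree is a combination of the variables, with forms as coefficients. -/
theorem exists_eq_sum_X_mul {n : ℤ} (hn : n ≠ 0) {f : MvPolynomial (Fin v) k}
    (hf : f ∈ forms k v n) :
    ∃ g : Fin v → MvPolynomial (Fin v) k, (∀ j, g j ∈ forms k v (n - 1)) ∧
      f = ∑ j, X j * g j := by
  have hmem : f ∈ idealOfVars (Fin v) k := by
    rw [mem_idealOfVars_iff]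
    by_contra h
    have := hf 0 h
    simp at this
    omega
  rw [Ideal.mem_span_range_iff_exists_fun] at hmem
  obtain ⟨g, hg⟩ := hmem
  refine ⟨fun j => component (n - 1) (g j), fun j => component_mem _ _, ?_⟩
  conv_lhs => rw [← component_of_mem hf, ← hg, map_sum]
  refine Finset.sum_congr rfl fun j _ => ?_
  rw [mul_comm, component_mul n (X_mem_forms j)]

/-- The linear form with coefficients `a`. -/
def linForm (a : Fin v → k) : MvPolynomial (Fin v) k := ∑ i, C (a i) * X i

theorem linForm_mem (a : Fin v → k) : linForm a ∈ forms k v 1 :=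
  sum_mem fun i _ => by simpa using mul_mem_forms (C_mem_forms (a i)) (X_mem_forms i)

theorem linForm_add (a b : Fin v → k) : linForm (a + b) = linForm a + linForm b := by
  simp [linForm, add_mul, Finset.sum_add_distrib]

theorem linForm_smul (r : k) (a : Fin v → k) : linForm (r • a) = C r * linForm a := by
  simp [linForm, Finset.mul_sum, mul_assoc]

theorem linForm_single (i : Fin v) : linForm (Pi.single i (1 : k)) = X i := by
  classical
  rw [linForm, Finset.sum_eq_single i] <;> simp +contextual

theorem exists_linForm {f : MvPolynomial (Fin v) k} (hf : f ∈ forms k v 1) :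
    ∃ a, f = linForm a := by
  obtain ⟨g, hg, rfl⟩ := exists_eq_sum_X_mul one_ne_zero hf
  refine ⟨fun j => coeff 0 (g j), Finset.sum_congr rfl fun j _ => ?_⟩
  have : g j = C (coeff 0 (g j)) := by
    ext m
    rw [coeff_C]
    split_ifs with h
    · rw [h]
    · by_contra h'
      have := hg j m h'
      rw [sub_self, Nat.cast_eq_zero, Finsupp.degree_eq_zero_iff] at this
      exact h this.symm
  rw [← this, mul_comm]

/-- An ideal that contains the homogeneous components of its elements. -/
def IsGraded (I : Ideal (MvPolynomial (Fin v) k)) : Prop := ∀ f ∈ I, ∀ n : ℤ, component n f ∈ I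

theorem IsGradedIdeal.isGraded {I : Ideal (MvPolynomial (Fin v) k)} (hI : IsGradedIdeal I) :
    IsGraded I := by
  intro f hf n
  unfold component
  split_ifs
  · exact homogeneousComponent_mem_of_mem hI hf _
  · exact zero_mem _

attribute [local instance] MvPolynomial.gradedAlgebra in
theorem IsGraded.isGradedIdeal {I : Ideal (MvPolynomial (Fin v) k)} (hI : IsGraded I) :
    I.IsHomogeneous (homogeneousSubmodule (Fin v) k) := by
  intro n f hf
  have := hI f hf n
  simp only [component, Int.natCast_nonneg, if_true, Int.toNat_natCast] at this
  rw [← decomposition.decompose'_apply] at this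
  exact this

theorem isGraded_bot : IsGraded (⊥ : Ideal (MvPolynomial (Fin v) k)) := by
  intro f hf n
  rw [Ideal.mem_bot] at hf
  simp [hf]

theorem IsGraded.sup {I J : Ideal (MvPolynomial (Fin v) k)} (hI : IsGraded I) (hJ : IsGraded J) :
    IsGraded (I ⊔ J) := by
  intro f hf n
  obtain ⟨a, ha, b, hb, rfl⟩ := Submodule.mem_sup.1 hf
  rw [map_add]
  exact Submodule.add_mem_sup (hI a ha n) (hJ b hb n)

theorem isGraded_span_singleton {n : ℤ} {θ : MvPolynomial (Fin v) k} (hθ : θ ∈ forms k v n) :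
    IsGraded (Ideal.span {θ}) := by
  intro f hf m
  obtain ⟨g, rfl⟩ := Ideal.mem_span_singleton'.1 hf
  rw [mul_comm, component_mul m hθ]
  exact Ideal.mul_mem_right _ _ (Ideal.mem_span_singleton_self θ)

theorem exists_of_mem_sup_span {I : Ideal (MvPolynomial (Fin v) k)} (hI : IsGraded I) {e n : ℤ}
    {θ f : MvPolynomial (Fin v) k} (hθ : θ ∈ forms k v e) (hf : f ∈ forms k v n)
    (h : f ∈ I ⊔ Ideal.span {θ}) : ∃ g ∈ forms k v (n - e), f - θ * g ∈ I := by
  obtain ⟨a, ha, b, hb, rfl⟩ := Submodule.mem_sup.1 h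
  obtain ⟨g, rfl⟩ := Ideal.mem_span_singleton'.1 hb
  refine ⟨component (n - e) g, component_mem _ _, ?_⟩
  rw [← component_mul n hθ, ← component_of_mem hf, ← map_sub]
  refine hI _ ?_ n
  rwa [mul_comm θ, add_sub_cancel_right]

/-- `θ` is a nonzerodivisor on `S / I`. -/
def IsRegularMod (I : Ideal (MvPolynomial (Fin v) k)) (θ : MvPolynomial (Fin v) k) : Prop :=
  ∀ f, θ * f ∈ I → f ∈ I

/-- `l` is a (weakly) regular sequence of linear forms on `S / I`. -/
def IsLinearRegular : Ideal (MvPolynomial (Fin v) k) → List (MvPolynomial (Fin v) k) → Prop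
  | _, [] => True
  | I, θ :: l => θ ∈ forms k v 1 ∧ IsRegularMod I θ ∧ IsLinearRegular (I ⊔ Ideal.span {θ}) l

theorem sup_ofList_cons (I : Ideal (MvPolynomial (Fin v) k)) (θ : MvPolynomial (Fin v) k)
    (l : List (MvPolynomial (Fin v) k)) :
    I ⊔ Ideal.ofList (θ :: l) = (I ⊔ Ideal.span {θ}) ⊔ Ideal.ofList l := by
  rw [Ideal.ofList_cons, sup_assoc]

theorem sup_ofList_nil (I : Ideal (MvPolynomial (Fin v) k)) : I ⊔ Ideal.ofList [] = I := by
  rw [Ideal.ofList_nil, sup_bot_eq]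

theorem isGraded_sup_ofList {I : Ideal (MvPolynomial (Fin v) k)} (hI : IsGraded I)
    (l : List (MvPolynomial (Fin v) k)) (hl : ∀ θ ∈ l, θ ∈ forms k v 1) :
    IsGraded (I ⊔ Ideal.ofList l) := by
  induction l generalizing I with
  | nil => rwa [sup_ofList_nil]
  | cons θ l ih =>
    rw [sup_ofList_cons]
    exact ih (hI.sup (isGraded_span_singleton (hl θ (by simp)))) fun η hη => hl η (by simp [hη])

theorem IsLinearRegular.mem_forms {I : Ideal (MvPolynomial (Fin v) k)}
    {l : List (MvPolynomial (Fin v) k)} (h : IsLinearRegular I l) : ∀ θ ∈ l, θ ∈ forms k v 1 := by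
  induction l generalizing I with
  | nil => simp
  | cons θ l ih =>
    intro η hη
    rcases List.mem_cons.1 hη with rfl | hη
    · exact h.1
    · exact ih h.2.2 η hη

/-- The piece `A_n`, `n : ℤ`, of `A = S / I`. -/
def pieceZ (I : Ideal (MvPolynomial (Fin v) k)) (n : ℤ) :
    AddSubgroup (MvPolynomial (Fin v) k ⧸ I) :=
  (forms k v n).toAddSubgroup.map (Ideal.Quotient.mk I).toAddMonoidHom

theorem mem_pieceZ {I : Ideal (MvPolynomial (Fin v) k)} {n : ℤ} {y : MvPolynomial (Fin v) k ⧸ I} :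
    y ∈ pieceZ I n ↔ ∃ f ∈ forms k v n, Ideal.Quotient.mk I f = y := Iff.rfl

theorem smul_mk (I : Ideal (MvPolynomial (Fin v) k)) (f g : MvPolynomial (Fin v) k) :
    f • Ideal.Quotient.mk I g = Ideal.Quotient.mk I (f * g) := rfl

theorem pieceZ_eq_bot_iff {I : Ideal (MvPolynomial (Fin v) k)} {n : ℤ} :
    pieceZ I n = ⊥ ↔ ∀ f ∈ forms k v n, f ∈ I := by
  rw [eq_bot_iff]
  constructor
  · intro h f hf
    exact Ideal.Quotient.eq_zero_iff_mem.1 (h (mem_pieceZ.2 ⟨f, hf, rfl⟩))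
  · rintro h _ ⟨f, hf, rfl⟩
    exact Ideal.Quotient.eq_zero_iff_mem.2 (h f hf)

theorem isGradedBy_pieceZ (I : Ideal (MvPolynomial (Fin v) k)) :
    IsGradedBy (fun i => (X i : MvPolynomial (Fin v) k)) (pieceZ I) := by
  rintro n j _ ⟨f, hf, rfl⟩
  refine ⟨X j * f, ?_, rfl⟩
  rw [add_comm]
  exact mul_mem_forms (X_mem_forms j) hf

/-- The quotient map `S / I → S / I'` for `I ≤ I'`, as a map of `S`-modules. -/
abbrev quotientMap {I I' : Ideal (MvPolynomial (Fin v) k)} (h : I ≤ I') :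
    (MvPolynomial (Fin v) k ⧸ I) →ₗ[MvPolynomial (Fin v) k] (MvPolynomial (Fin v) k ⧸ I') :=
  Submodule.mapQ I I' LinearMap.id h

theorem smul_injective_of_isRegularMod {I : Ideal (MvPolynomial (Fin v) k)}
    {θ : MvPolynomial (Fin v) k} (h : IsRegularMod I θ) :
    Function.Injective fun y : MvPolynomial (Fin v) k ⧸ I => θ • y := by
  intro y z hyz
  obtain ⟨f, rfl⟩ := Ideal.Quotient.mk_surjective y
  obtain ⟨g, rfl⟩ := Ideal.Quotient.mk_surjective z
  simp only [smul_mk] at hyz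
  rw [Ideal.Quotient.eq] at hyz ⊢
  exact h _ (by rwa [mul_sub])

theorem linearQuotient_pieceZ {I : Ideal (MvPolynomial (Fin v) k)} (hI : IsGraded I)
    {a : Fin v → k} (h : IsRegularMod I (linForm a)) :
    LinearQuotient (fun i => (X i : MvPolynomial (Fin v) k)) (pieceZ I)
      (pieceZ (I ⊔ Ideal.span {linForm a})) (fun i => C (a i)) (quotientMap le_sup_left) where
  shortExact :=
    { graded := isGradedBy_pieceZ I
      left_mem := by
        rintro n _ ⟨f, hf, rfl⟩
        refine ⟨linForm a * f, ?_, rfl⟩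
        have := mul_mem_forms (linForm_mem a) hf
        rwa [add_sub_cancel] at this
      right_mem := by
        rintro n _ ⟨f, hf, rfl⟩
        exact ⟨f, hf, rfl⟩
      injective := smul_injective_of_isRegularMod h
      right_left := by
        intro y
        obtain ⟨f, rfl⟩ := Ideal.Quotient.mk_surjective y
        change Ideal.Quotient.mk (I ⊔ Ideal.span {linForm a}) (linForm a * f) = 0
        rw [Ideal.Quotient.eq_zero_iff_mem]
        exact Ideal.mul_mem_right _ _ (Ideal.mem_sup_right (Ideal.mem_span_singleton_self _))
      exact := by
        rintro n _ ⟨f, hf, rfl⟩ h0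
        have h0 : f ∈ I ⊔ Ideal.span {linForm a} := Ideal.Quotient.eq_zero_iff_mem.1 h0
        obtain ⟨g, hg, hfg⟩ := exists_of_mem_sup_span hI (linForm_mem a) hf h0
        refine ⟨_, ⟨g, hg, rfl⟩, ?_⟩
        exact (Ideal.Quotient.eq.2 hfg).symm
      surjective := by
        rintro n _ ⟨f, hf, rfl⟩
        exact ⟨_, ⟨f, hf, rfl⟩, rfl⟩ }
  smul_mem := by
    rintro i n _ ⟨f, hf, rfl⟩
    exact ⟨C (a i) * f, by simpa using mul_mem_forms (C_mem_forms (a i)) hf, rfl⟩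

end Forms

/-! ### Koszul cohomology of graded quotients of the polynomial ring -/

section KoszulQuotient

variable {k : Type*} [Field k] {v : ℕ}

/-- The sequence of the variables. -/
abbrev vars (k : Type*) [Field k] (v : ℕ) : Fin v → MvPolynomial (Fin v) k := X

/-- Exactness at the spot `p`, in degree `n`, of the Koszul complex of the variables on `S / I`. -/
abbrev KoszulExactQuot (I : Ideal (MvPolynomial (Fin v) k)) (p n : ℤ) : Prop :=
  KoszulExact (vars k v) (pieceZ I) p n

/-- Depth sensitivity of the Koszul complex: its cohomology vanishes below the length of a regular
sequence of linear forms. -/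
theorem IsLinearRegular.koszulExact_of_lt {I : Ideal (MvPolynomial (Fin v) k)} (hI : IsGraded I)
    {l : List (MvPolynomial (Fin v) k)} (hl : IsLinearRegular I l) {p : ℤ} (hp : p < l.length)
    (n : ℤ) : KoszulExactQuot I p n := by
  induction l generalizing I p n with
  | nil => exact koszulExact_of_neg (by simpa using hp)
  | cons θ l ih =>
    obtain ⟨h1, h2, h3⟩ := hl
    obtain ⟨a, rfl⟩ := exists_linForm h1
    have := (linearQuotient_pieceZ hI h2).koszulExact_pred (p := p) (n := n + 1)
      (ih (hI.sup (isGraded_span_singleton h1)) h3 (by simp at hp; omega) (n + 1))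
    rwa [add_sub_cancel_right] at this

theorem IsLinearRegular.koszulExact_of_forms_le {I : Ideal (MvPolynomial (Fin v) k)}
    (hI : IsGraded I) {l : List (MvPolynomial (Fin v) k)} (hl : IsLinearRegular I l) {p n : ℤ}
    (hJ : ∀ f ∈ forms k v (n + p), f ∈ I ⊔ Ideal.ofList l) : KoszulExactQuot I p n := by
  induction l generalizing I with
  | nil =>
    rw [sup_ofList_nil] at hJ
    exact koszulExact_of_eq_bot (pieceZ_eq_bot_iff.2 hJ)
  | cons θ l ih =>
    obtain ⟨h1, h2, h3⟩ := hl
    obtain ⟨a, rfl⟩ := exists_linForm h1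
    rw [sup_ofList_cons] at hJ
    exact (linearQuotient_pieceZ hI h2).koszulExact (ih (hI.sup (isGraded_span_singleton h1)) h3 hJ)

/-- The top degree `s` of `S / J`, where `J = I + (l)`, is visible in the Koszul cohomology of
`S / I`: the socle elements of degree `s` are Koszul cocycles for `S / J`, and nonvanishing lifts
along the regular sequence. -/
theorem IsLinearRegular.exists_not_koszulExact {I : Ideal (MvPolynomial (Fin v) k)}
    (hI : IsGraded I) {l : List (MvPolynomial (Fin v) k)} (hl : IsLinearRegular I l) {s : ℤ}
    (hs : ¬ ∀ f ∈ forms k v s, f ∈ I ⊔ Ideal.ofList l)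
    (hs' : ∀ f ∈ forms k v (s + 1), f ∈ I ⊔ Ideal.ofList l) :
    ∃ p, ¬ KoszulExactQuot I p (s - p) := by
  induction l generalizing I with
  | nil =>
    rw [sup_ofList_nil] at hs hs'
    refine ⟨0, fun hE => hs fun f hf => ?_⟩
    have hc : (fun t : Finset (Fin v) => if t = ∅ then Ideal.Quotient.mk I f else 0) ∈
        cubeCochains (N := fun _ => MvPolynomial (Fin v) k ⧸ I)
          (fun t => pieceZ I (s - 0 + t.card)) 0 := by
      refine mem_cubeCochains_of (fun t ht => ?_) (fun t ht => ?_)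
      · have : t = ∅ := by simpa using ht
        subst this
        refine ⟨f, ?_, by simp⟩
        simpa using hf
      · rw [if_neg]
        rintro rfl
        simp at ht
    obtain ⟨b, hb, hDb⟩ := hE _ hc (by
      ext t
      rw [koszulD_apply]
      refine Finset.sum_eq_zero fun j _ => ?_
      rw [smul_ite, smul_zero, smul_mk, Ideal.Quotient.eq_zero_iff_mem.2, ite_self, smul_zero]
      refine hs' _ ?_
      rw [add_comm]
      exact mul_mem_forms (X_mem_forms j) hf)
    have h0 := congrFun hDb ∅
    rw [koszulD_apply, Finset.sum_empty, if_pos rfl] at h0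
    exact Ideal.Quotient.eq_zero_iff_mem.1 h0.symm
  | cons θ l ih =>
    obtain ⟨h1, h2, h3⟩ := hl
    obtain ⟨a, rfl⟩ := exists_linForm h1
    rw [sup_ofList_cons] at hs hs'
    obtain ⟨p, hp⟩ := ih (hI.sup (isGraded_span_singleton h1)) h3 hs hs'
    by_contra! hcon
    refine hp ((linearQuotient_pieceZ hI h2).koszulExact_quotient (hcon p) ?_)
    have := hcon (p + 1)
    rwa [← sub_sub] at this

theorem isRegularMod_X {T : Set (Fin v)} {i : Fin v} (hi : i ∉ T) :
    IsRegularMod (Ideal.span (X '' T : Set (MvPolynomial (Fin v) k))) (X i) := by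
  intro f hf
  rw [mem_ideal_span_X_image] at hf ⊢
  intro m hm
  obtain ⟨j, hj, h⟩ := hf (Finsupp.single i 1 + m) (by
    rw [mem_support_iff, coeff_X_mul]
    exact mem_support_iff.1 hm)
  refine ⟨j, hj, ?_⟩
  have : j ≠ i := fun e => hi (e ▸ hj)
  rwa [Finsupp.add_apply, Finsupp.single_eq_of_ne this, zero_add] at h

theorem isLinearRegular_map_X (L : List (Fin v)) (T : Set (Fin v)) (hL : L.Nodup)
    (hT : ∀ i ∈ L, i ∉ T) :
    IsLinearRegular (Ideal.span (X '' T : Set (MvPolynomial (Fin v) k))) (L.map X) := by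
  induction L generalizing T with
  | nil => trivial
  | cons i L ih =>
    refine ⟨X_mem_forms i, isRegularMod_X (hT i (by simp)), ?_⟩
    have : (Ideal.span (X '' T) ⊔ Ideal.span {X i} : Ideal (MvPolynomial (Fin v) k)) =
        Ideal.span (X '' insert i T) := by
      rw [Set.image_insert_eq, Ideal.span_insert, sup_comm]
    rw [this]
    rw [List.nodup_cons] at hL
    refine ih _ hL.2 fun j hj => ?_
    rw [Set.mem_insert_iff, not_or]
    exact ⟨fun e => hL.1 (e ▸ hj), hT j (by simp [hj])⟩

/-- The variables form a regular sequence on `S`. -/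
theorem isLinearRegular_bot_X :
    IsLinearRegular (⊥ : Ideal (MvPolynomial (Fin v) k)) ((List.finRange v).map X) := by
  simpa using isLinearRegular_map_X (k := k) (List.finRange v) ∅ (List.nodup_finRange v) (by simp)

theorem bot_sup_ofList_X :
    (⊥ : Ideal (MvPolynomial (Fin v) k)) ⊔ Ideal.ofList ((List.finRange v).map X) =
      idealOfVars (Fin v) k := by
  rw [bot_sup_eq, Ideal.ofList]
  congr 1
  ext f
  simp

end KoszulQuotient

/-! ### Free modules and syzygies -/

section Syzygies

variable {k : Type*} [Field k] {v r : ℕ}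

/-- The piece of degree `n` of the graded free module `⨁_l S(-(deg l))`. -/
def freePiece (deg : Fin r → ℤ) (n : ℤ) : AddSubgroup (Fin r → MvPolynomial (Fin v) k) where
  carrier := {f | ∀ l, f l ∈ forms k v (n - deg l)}
  zero_mem' _ := zero_mem _
  add_mem' ha hb l := add_mem (ha l) (hb l)
  neg_mem' ha l := neg_mem (ha l)

theorem isGradedBy_freePiece (deg : Fin r → ℤ) :
    IsGradedBy (vars k v) (freePiece (k := k) (v := v) deg) := by
  intro n j f hf l
  have := mul_mem_forms (X_mem_forms j) (hf l)
  have e : 1 + (n - deg l) = n + 1 - deg l := by ring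
  rwa [e] at this

theorem koszulExact_freePiece (deg : Fin r → ℤ) {p : ℤ} (hp : p < v) (n : ℤ) :
    KoszulExact (vars k v) (freePiece (k := k) (v := v) deg) p n := by
  intro c hc hD
  have hE : ∀ l, KoszulExactQuot (⊥ : Ideal (MvPolynomial (Fin v) k)) p (n - deg l) := fun l =>
    isLinearRegular_bot_X.koszulExact_of_lt isGraded_bot (by simpa using hp) _
  have hb : ∀ l, ∃ b : Finset (Fin v) → MvPolynomial (Fin v) k,
      (∀ s, b s ∈ forms k v (n + s.card - deg l)) ∧ (∀ s, (s.card : ℤ) ≠ p - 1 → b s = 0) ∧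
      ∀ t, c t l = ∑ j ∈ t, cubeSign t j • (X j * b (t.erase j)) := by
    intro l
    obtain ⟨b, hb, hDb⟩ := hE l (fun s => Ideal.Quotient.mk ⊥ (c s l)) (by
        intro s
        refine ⟨⟨c s l, ?_, rfl⟩, fun hs => ?_⟩
        · have := (hc s).1 l
          have e : n + (s.card : ℤ) - deg l = n - deg l + s.card := by ring
          rwa [e] at this
        · have : c s = 0 := (hc s).2 hs
          simp [this]) (by
        ext t
        rw [koszulD_apply]
        have := congrFun (congrFun hD t) l
        rw [koszulD_apply, Finset.sum_apply] at this
        simp only [smul_mk, ← map_zsmul, ← map_sum]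
        simp only [Pi.smul_apply, smul_eq_mul, Pi.zero_apply] at this
        rw [this]; rfl)
    choose b' hb' hbb' using fun s => (hb s).1
    refine ⟨b', fun s => ?_, fun s hs => ?_, fun t => ?_⟩
    · have e : n + (s.card : ℤ) - deg l = n - deg l + s.card := by ring
      rw [e]
      exact hb' s
    · have := (hb s).2 hs
      rw [← hbb'] at this
      exact Ideal.Quotient.eq_zero_iff_mem.1 this
    · have := congrFun hDb t
      rw [koszulD_apply] at this
      simp only [← hbb'] at this
      have key : Ideal.Quotient.mk (⊥ : Ideal (MvPolynomial (Fin v) k))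
          (∑ j ∈ t, cubeSign t j • (X j * b' (t.erase j))) = Ideal.Quotient.mk ⊥ (c t l) := by
        rw [← this, map_sum]
        refine Finset.sum_congr rfl fun j _ => ?_
        rw [map_zsmul]; rfl
      rw [Ideal.Quotient.eq, Ideal.mem_bot, sub_eq_zero] at key
      exact key.symm
  choose b hb1 hb2 hb3 using hb
  refine ⟨fun s l => b l s, fun s => ⟨fun l => hb1 l s, fun hs => ?_⟩, ?_⟩
  · ext1 l
    exact hb2 l s hs
  · ext1 t
    ext1 l
    rw [hb3 l t, koszulD_apply, Finset.sum_apply]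
    rfl

variable {M' M'' : Type*} [AddCommGroup M'] [Module (MvPolynomial (Fin v) k) M']
  [AddCommGroup M''] [Module (MvPolynomial (Fin v) k) M'']

/-- The top Koszul cohomology of `M` is `M / (X_1, …, X_v) M`. -/
theorem exists_koszulD_eq_top_iff {P : ℤ → AddSubgroup M'} (hP : IsGradedBy (vars k v) P) {n : ℤ}
    {c : Finset (Fin v) → M'}
    (hc : c ∈ cubeCochains (N := fun _ => M') (fun s => P (n + s.card)) v) :
    (∃ b ∈ cubeCochains (N := fun _ => M') (fun s => P (n + s.card)) (v - 1),
      koszulD (vars k v) M' b = c) ↔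
    ∃ g : Fin v → M', (∀ j, g j ∈ P (n + v - 1)) ∧
      c Finset.univ = ∑ j, (X j : MvPolynomial (Fin v) k) • g j := by
  have hcard : ∀ j : Fin v, ((Finset.univ.erase j).card : ℤ) = v - 1 := fun j => by
    rw [card_erase_cast (Finset.mem_univ j)]; simp
  constructor
  · rintro ⟨b, hb, rfl⟩
    refine ⟨fun j => cubeSign Finset.univ j • b (Finset.univ.erase j), fun j => ?_, ?_⟩
    · refine zsmul_mem ?_ _
      have : b (Finset.univ.erase j) ∈ P (n + (Finset.univ.erase j).card) := (hb _).1
      rwa [hcard j, ← add_sub_assoc] at this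
    · rw [koszulD_apply]
      refine Finset.sum_congr rfl fun j _ => ?_
      rw [smul_comm]
  · rintro ⟨g, hg, hcg⟩
    let b : Finset (Fin v) → M' := fun s =>
      ∑ j, if s = Finset.univ.erase j then cubeSign Finset.univ j • g j else 0
    have hb : b ∈ cubeCochains (N := fun _ => M') (fun s => P (n + s.card)) (v - 1) := by
      refine mem_cubeCochains_of (fun s hs => ?_) (fun s hs => ?_)
      · rw [hs, ← add_sub_assoc]
        refine sum_mem fun j _ => ?_
        split_ifs
        · exact zsmul_mem (hg j) _
        · exact zero_mem _
      · refine Finset.sum_eq_zero fun j _ => ?_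
        rw [if_neg]
        rintro rfl
        exact hs (hcard j)
    refine ⟨b, hb, ?_⟩
    have hDb : koszulD (vars k v) M' b ∈
        cubeCochains (N := fun _ => M') (fun s => P (n + s.card)) (v - 1 + 1) := by
      refine cubeD_mem (N := fun _ => M') ?_ hb
      intro t j hj m hm
      have := hP (n + (t.erase j).card) j m hm
      rw [card_erase_cast hj] at this
      have e : n + ((t.card : ℤ) - 1) + 1 = n + t.card := by ring
      rw [e] at this
      exact this
    ext t
    by_cases ht : t = Finset.univ
    · subst ht
      rw [hcg, koszulD_apply]
      refine Finset.sum_congr rfl fun j _ => ?_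
      have : b (Finset.univ.erase j) = cubeSign Finset.univ j • g j := by
        refine (Finset.sum_eq_single j (fun i _ hij => ?_) (by simp)).trans (if_pos rfl)
        rw [if_neg]
        intro h
        have h1 : j ∉ Finset.univ.erase i := h ▸ Finset.notMem_erase j _
        exact h1 (Finset.mem_erase.2 ⟨hij.symm, Finset.mem_univ j⟩)
      rw [this, smul_comm _ (cubeSign _ _), smul_smul, cubeSign_mul_self, one_smul]
    · have ht' : (t.card : ℤ) ≠ v := by
        intro h
        apply ht
        rw [← Finset.card_eq_iff_eq_univ, Fintype.card_fin]
        exact_mod_cast h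
      rw [(hDb t).2 (by simpa using ht'), (hc t).2 ht']

/-- A minimal presentation `0 → M' → F → M'' → 0` of the graded module `M''` by the graded free
module `F = ⨁_l S(-(deg l))`: the kernel `M'` lies in `(X_1, …, X_v) F`. -/
structure SyzygyStep (deg : Fin r → ℤ) (P' : ℤ → AddSubgroup M') (P'' : ℤ → AddSubgroup M'')
    (α : M' →ₗ[MvPolynomial (Fin v) k] (Fin r → MvPolynomial (Fin v) k))
    (β : (Fin r → MvPolynomial (Fin v) k) →ₗ[MvPolynomial (Fin v) k] M'') : Prop where
  shortExact : GradedShortExact (vars k v) P' (freePiece deg) P'' α β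
  minimal : ∀ n, ∀ m ∈ P' n, ∀ l, α m l ∈ idealOfVars (Fin v) k

namespace SyzygyStep

variable {deg : Fin r → ℤ} {P' : ℤ → AddSubgroup M'} {P'' : ℤ → AddSubgroup M''}
    {α : M' →ₗ[MvPolynomial (Fin v) k] (Fin r → MvPolynomial (Fin v) k)}
    {β : (Fin r → MvPolynomial (Fin v) k) →ₗ[MvPolynomial (Fin v) k] M''}

/-- Dimension shift: a free module has Koszul cohomology only at the top spot `v`, where `α` induces
zero by minimality, so the cohomology of `M''` at `p` is that of its syzygy module at `p + 1`. -/
theorem koszulExact_iff (h : SyzygyStep deg P' P'' α β) {p : ℤ} (hp : p < v) (n : ℤ) :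
    KoszulExact (vars k v) P' (p + 1) n ↔ KoszulExact (vars k v) P'' p n := by
  have hF := koszulExact_freePiece (k := k) (v := v) deg hp n
  constructor
  · exact fun hE => (h.shortExact.isShortExact n).exactAt_right hF hE
  · intro hE c hc hD
    refine (h.shortExact.isShortExact n).exists_of_exists_left (p := p + 1)
      (by rw [add_sub_cancel_right]; exact hE) ?_
    have hαc := (h.shortExact.isShortExact n).left_mem _ c hc
    have hDα : koszulD (vars k v) _
        (familyMap (N' := fun _ => M') (N := fun _ => Fin r → MvPolynomial (Fin v) k)
          (fun _ => α.toAddMonoidHom) c) = 0 := by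
      rw [← (h.shortExact.isShortExact n).comm_left, hD, map_zero]
    rcases lt_or_eq_of_le (show p + 1 ≤ v by omega) with h1 | h1
    · exact koszulExact_freePiece (k := k) (v := v) deg h1 n _ hαc hDα
    · rw [h1] at hαc ⊢
      refine (exists_koszulD_eq_top_iff (isGradedBy_freePiece deg) hαc).2 ?_
      have hm : c Finset.univ ∈ P' (n + v) := by
        have : c Finset.univ ∈ P' (n + (Finset.univ : Finset (Fin v)).card) := (hc _).1
        simpa using this
      have hg : ∀ l, ∃ g : Fin v → MvPolynomial (Fin v) k,
          (∀ j, g j ∈ forms k v (n + v - deg l - 1)) ∧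
            α (c Finset.univ) l = ∑ j, X j * g j := by
        intro l
        have hf := h.shortExact.left_mem _ _ hm l
        by_cases h0 : n + v - deg l = 0
        · refine ⟨0, fun _ => zero_mem _, ?_⟩
          simp only [Pi.zero_apply, mul_zero, Finset.sum_const_zero]
          have h2 := mem_idealOfVars_iff.1 (h.minimal _ _ hm l)
          ext m
          by_contra h3
          have h4 := hf m (by simpa using h3)
          rw [h0, Nat.cast_eq_zero, Finsupp.degree_eq_zero_iff] at h4
          rw [h4, h2] at h3
          exact h3 rfl
        · exact exists_eq_sum_X_mul h0 hf
      choose g hg1 hg2 using hg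
      refine ⟨fun j l => g l j, fun j l => ?_, ?_⟩
      · have e : n + (v : ℤ) - 1 - deg l = n + v - deg l - 1 := by ring
        rw [e]
        exact hg1 l j
      · ext1 l
        rw [Finset.sum_apply]
        exact hg2 l

theorem isGradedBy (h : SyzygyStep deg P' P'' α β) : IsGradedBy (vars k v) P'' := by
  intro n j m hm
  obtain ⟨y, hy, rfl⟩ := h.shortExact.surjective n m hm
  rw [← map_smul]
  exact h.shortExact.right_mem _ _ (h.shortExact.graded n j y hy)

/-- The top Koszul cohomology of a module is the module modulo the variables, so by minimality it
records the degrees of the basis of `F`. -/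
theorem not_koszulExact_top_iff (h : SyzygyStep deg P' P'' α β) (n : ℤ) :
    ¬ KoszulExact (vars k v) P'' v n ↔ ∃ l, deg l = n + v := by
  classical
  constructor
  · intro hE
    by_contra! hdeg
    refine hE fun c hc hD => ?_
    refine (exists_koszulD_eq_top_iff h.isGradedBy hc).2 ?_
    have hm : c Finset.univ ∈ P'' (n + v) := by
      have : c Finset.univ ∈ P'' (n + (Finset.univ : Finset (Fin v)).card) := (hc _).1
      simpa using this
    obtain ⟨y, hy, hyc⟩ := h.shortExact.surjective _ _ hm
    have : ∀ l, ∃ g : Fin v → MvPolynomial (Fin v) k,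
          (∀ j, g j ∈ forms k v (n + v - deg l - 1)) ∧ y l = ∑ j, X j * g j := fun l =>
      exists_eq_sum_X_mul (fun e => hdeg l (by omega)) (hy l)
    choose g hg1 hg2 using this
    refine ⟨fun j => β (fun l => g l j), fun j => h.shortExact.right_mem _ _ fun l => ?_, ?_⟩
    · have e : n + (v : ℤ) - 1 - deg l = n + v - deg l - 1 := by ring
      rw [e]
      exact hg1 l j
    · rw [← hyc]
      simp only [← map_smul, ← map_sum]
      congr 1
      ext1 l
      rw [Finset.sum_apply]
      exact hg2 l
  · rintro ⟨l, hl⟩ hE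
    have he : (Pi.single l 1 : Fin r → MvPolynomial (Fin v) k) ∈ freePiece deg (n + v) := by
      intro i
      by_cases hi : i = l
      · subst hi
        rw [Pi.single_eq_same, hl, sub_self]
        simpa using C_mem_forms (v := v) (1 : k)
      · rw [Pi.single_eq_of_ne hi]; exact zero_mem _
    have hc : (fun s : Finset (Fin v) => if s = Finset.univ then β (Pi.single l 1) else 0) ∈
        cubeCochains (N := fun _ => M'') (fun s => P'' (n + s.card)) v := by
      refine mem_cubeCochains_of (fun s hs => ?_) (fun s hs => ?_)
      · have : s = Finset.univ := by
          rw [← Finset.card_eq_iff_eq_univ, Fintype.card_fin]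
          exact_mod_cast hs
        subst this
        simpa using h.shortExact.right_mem _ _ he
      · rw [if_neg]
        rintro rfl
        simp at hs
    obtain ⟨g, hg, hcg⟩ := (exists_koszulD_eq_top_iff h.isGradedBy hc).1 (hE _ hc (by
      ext t
      rw [koszulD_apply]
      refine Finset.sum_eq_zero fun j hj => ?_
      rw [if_neg, smul_zero, smul_zero]
      exact fun e => Finset.notMem_erase j t (e ▸ Finset.mem_univ j)))
    rw [if_pos rfl] at hcg
    choose f hf hfg using fun j => h.shortExact.surjective _ _ (hg j)
    have hmem : (Pi.single l 1 - ∑ j, (X j : MvPolynomial (Fin v) k) • f j :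
        Fin r → MvPolynomial (Fin v) k) ∈ freePiece deg (n + v) := by
      refine sub_mem he (sum_mem fun j _ => ?_)
      have := h.shortExact.graded _ j _ (hf j)
      rwa [sub_add_cancel] at this
    obtain ⟨m, hm, hme⟩ := h.shortExact.exact _ _ hmem (by
      rw [map_sub, map_sum, hcg, sub_eq_zero]
      refine Finset.sum_congr rfl fun j _ => ?_
      rw [map_smul, hfg])
    have h1 := h.minimal _ _ hm l
    rw [hme, mem_idealOfVars_iff, Pi.sub_apply, Pi.single_eq_same, Finset.sum_apply, coeff_sub,
      coeff_sum] at h1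
    have h2 : ∀ j, coeff 0 (((X j : MvPolynomial (Fin v) k) • f j) l) = 0 := fun j =>
      mem_idealOfVars_iff.1 (Ideal.mul_mem_right _ _ (Ideal.subset_span ⟨j, rfl⟩))
    rw [Finset.sum_eq_zero fun j _ => h2 j] at h1
    simp at h1

end SyzygyStep

end Syzygies

/-! ### Betti numbers and Koszul cohomology -/

section Betti

variable {k : Type*} [Field k] {v : ℕ} {I : Ideal (MvPolynomial (Fin v) k)}

namespace MinimalGradedFreeResolution

variable (F : MinimalGradedFreeResolution I)

/-- The image of `F_{i+1} → F_i`. -/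
abbrev Syzygy (i : ℕ) :
    Submodule (MvPolynomial (Fin v) k) (Fin (F.rank i) → MvPolynomial (Fin v) k) :=
  LinearMap.range (F.diff i).mulVecLin

/-- The piece of degree `n` of the image of `F_{i+1} → F_i`. -/
def syzygyPiece (i : ℕ) (n : ℤ) : AddSubgroup (F.Syzygy i) :=
  (freePiece (F.deg i) n).comap (F.Syzygy i).subtype.toAddMonoidHom

theorem diff_mem_forms (i : ℕ) (l m) : F.diff i l m ∈ forms k v (F.deg (i + 1) m - F.deg i l) := by
  rcases F.homogeneous i l m with h | ⟨n, hn, h⟩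
  · rw [h]; exact zero_mem _
  · rw [h, add_sub_cancel_left]
    exact mem_forms_natCast.2 hn

theorem mulVec_mem_freePiece (i : ℕ) {n : ℤ} {f : Fin (F.rank (i + 1)) → MvPolynomial (Fin v) k}
    (hf : f ∈ freePiece (F.deg (i + 1)) n) : (F.diff i).mulVecLin f ∈ freePiece (F.deg i) n := by
  intro l
  rw [Matrix.mulVecLin_apply, Matrix.mulVec, dotProduct]
  refine sum_mem fun m _ => ?_
  have := mul_mem_forms (F.diff_mem_forms i l m) (hf m)
  have e : F.deg (i + 1) m - F.deg i l + (n - F.deg (i + 1) m) = n - F.deg i l := by ring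
  rwa [e] at this

theorem mulVec_mem_idealOfVars (i : ℕ) (f : Fin (F.rank (i + 1)) → MvPolynomial (Fin v) k) (l) :
    (F.diff i).mulVecLin f l ∈ idealOfVars (Fin v) k := by
  rw [Matrix.mulVecLin_apply, Matrix.mulVec, dotProduct]
  exact sum_mem fun m _ => Ideal.mul_mem_right _ _ (F.minimal i l m)

theorem surjective_on_pieces (i : ℕ) {n : ℤ} {y : Fin (F.rank i) → MvPolynomial (Fin v) k}
    (hy : y ∈ F.Syzygy i) (hyn : y ∈ freePiece (F.deg i) n) :
    ∃ f ∈ freePiece (F.deg (i + 1)) n, (F.diff i).mulVecLin f = y := by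
  obtain ⟨f, hf⟩ := hy
  refine ⟨fun m => component (n - F.deg (i + 1) m) (f m), fun m => component_mem _ _, ?_⟩
  ext1 l
  rw [← component_of_mem (hyn l), ← hf]
  simp only [Matrix.mulVecLin_apply, Matrix.mulVec, dotProduct, map_sum]
  refine Finset.sum_congr rfl fun m _ => ?_
  rw [component_mul _ (F.diff_mem_forms i l m)]
  congr 3
  ring

/-- The augmentation `F_0 = S → S / I`. -/
def augmentation : (Fin (F.rank 0) → MvPolynomial (Fin v) k) →ₗ[MvPolynomial (Fin v) k]
    MvPolynomial (Fin v) k ⧸ I :=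
  (Submodule.mkQ I).comp (∑ l, LinearMap.proj l)

theorem syzygyStep_zero :
    SyzygyStep (F.deg 0) (F.syzygyPiece 0) (pieceZ I) (F.Syzygy 0).subtype F.augmentation := by
  have hu : ∃ l₀ : Fin (F.rank 0), ∀ l, l = l₀ := by
    have := F.rank_zero
    refine ⟨⟨0, by omega⟩, fun l => Fin.ext ?_⟩
    have := l.2
    simp only; omega
  obtain ⟨l₀, hl₀⟩ := hu
  have haug : ∀ f, F.augmentation f = Ideal.Quotient.mk I (f l₀) := by
    intro f
    change Ideal.Quotient.mk I ((∑ l, LinearMap.proj l :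
      (Fin (F.rank 0) → MvPolynomial (Fin v) k) →ₗ[MvPolynomial (Fin v) k] _) f) = _
    rw [LinearMap.sum_apply, Finset.sum_eq_single l₀]
    · rfl
    · exact fun l _ h => absurd (hl₀ l) h
    · simp
  have hker : ∀ f, F.augmentation f = 0 ↔ f ∈ F.Syzygy 0 := by
    intro f
    rw [haug, F.exact_zero, Ideal.Quotient.eq_zero_iff_mem]
    exact ⟨fun h l => (hl₀ l) ▸ h, fun h => h l₀⟩
  refine ⟨⟨isGradedBy_freePiece _, fun n m hm => hm, fun n m hm => ?_,
    Subtype.val_injective, fun m => (hker m).2 m.2, ?_, ?_⟩, ?_⟩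
  · rw [haug]
    have := hm l₀
    rw [F.deg_zero, sub_zero] at this
    exact ⟨_, this, rfl⟩
  · exact fun n y hy h0 => ⟨⟨y, (hker y).1 h0⟩, hy, rfl⟩
  · rintro n _ ⟨f, hf, rfl⟩
    refine ⟨fun _ => f, fun l => ?_, haug _⟩
    rw [F.deg_zero, sub_zero]
    exact hf
  · rintro n ⟨-, f, rfl⟩ - l
    exact F.mulVec_mem_idealOfVars 0 f l

theorem syzygyStep_succ (i : ℕ) :
    SyzygyStep (F.deg (i + 1)) (F.syzygyPiece (i + 1)) (F.syzygyPiece i)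
      (F.Syzygy (i + 1)).subtype (F.diff i).mulVecLin.rangeRestrict := by
  have hker : ∀ f, (F.diff i).mulVecLin.rangeRestrict f = 0 ↔ f ∈ F.Syzygy (i + 1) := by
    intro f
    rw [Syzygy, ← F.exact i, LinearMap.mem_ker, ← LinearMap.mem_ker, LinearMap.ker_rangeRestrict,
      LinearMap.mem_ker]
  refine ⟨⟨isGradedBy_freePiece _, fun n m hm => hm, fun n m hm => F.mulVec_mem_freePiece i hm,
    Subtype.val_injective, fun m => (hker m).2 m.2, ?_, ?_⟩, ?_⟩
  · exact fun n y hy h0 => ⟨⟨y, (hker y).1 h0⟩, hy, rfl⟩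
  · rintro n ⟨y, hy⟩ hyn
    obtain ⟨f, hf, hfy⟩ := F.surjective_on_pieces i hy hyn
    exact ⟨f, hf, Subtype.ext hfy⟩
  · rintro n ⟨-, f, rfl⟩ - l
    exact F.mulVec_mem_idealOfVars (i + 1) f l

theorem koszulExact_syzygy_iff (i : ℕ) {p : ℤ} (hp : p ≤ v) (n : ℤ) :
    KoszulExact (vars k v) (F.syzygyPiece i) p n ↔ KoszulExactQuot I (p - 1 - i) n := by
  induction i generalizing p with
  | zero =>
    have := F.syzygyStep_zero.koszulExact_iff (p := p - 1) (by omega) n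
    simpa using this
  | succ i ih =>
    have := (F.syzygyStep_succ i).koszulExact_iff (p := p - 1) (by omega) n
    rw [sub_add_cancel] at this
    rw [this, ih (by omega)]
    have e : p - 1 - 1 - (i : ℤ) = p - 1 - (i + 1 : ℕ) := by push_cast; ring
    rw [e]

/-- The degrees of the generators of `F_i` are those of the `i`-th Koszul homology of `S / I`: the
syzygies shift Koszul cohomology until it becomes visible as minimal generators. -/
theorem exists_deg_eq_iff (i : ℕ) (j : ℤ) :
    (∃ m, F.deg i m = j) ↔ ¬ KoszulExactQuot I (v - i) (j - v) := by
  cases i with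
  | zero =>
    have := F.syzygyStep_zero.not_koszulExact_top_iff (j - v)
    rw [sub_add_cancel] at this
    simp only [← this, Nat.cast_zero, sub_zero]
  | succ i =>
    have := (F.syzygyStep_succ i).not_koszulExact_top_iff (j - v)
    rw [sub_add_cancel] at this
    rw [← this, F.koszulExact_syzygy_iff i le_rfl]
    have e : (v : ℤ) - 1 - i = v - (i + 1 : ℕ) := by push_cast; ring
    rw [e]

end MinimalGradedFreeResolution

theorem gradedBetti_ne_zero_iff_exists (h : Nonempty (MinimalGradedFreeResolution I)) (i : ℕ)
    (j : ℤ) : gradedBetti I i j ≠ 0 ↔ ∃ m, h.some.deg i m = j := by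
  rw [gradedBetti, dif_pos h, ← Nat.pos_iff_ne_zero, Fintype.card_pos_iff, nonempty_subtype]

theorem gradedBetti_ne_zero_iff (h : Nonempty (MinimalGradedFreeResolution I)) (i : ℕ) (j : ℤ) :
    gradedBetti I i j ≠ 0 ↔ ¬ KoszulExactQuot I (v - i) (j - v) := by
  rw [gradedBetti_ne_zero_iff_exists h, h.some.exists_deg_eq_iff]

/-- The regularity is the top degree of the Artinian reduction. -/
theorem isReg_of_isLinearRegular (h : Nonempty (MinimalGradedFreeResolution I)) (hI : IsGraded I)
    {l : List (MvPolynomial (Fin v) k)} (hl : IsLinearRegular I l) {s : ℤ}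
    (hs : ¬ ∀ f ∈ forms k v s, f ∈ I ⊔ Ideal.ofList l)
    (hs' : ∀ n > s, ∀ f ∈ forms k v n, f ∈ I ⊔ Ideal.ofList l) : IsReg I s := by
  constructor
  · obtain ⟨p, hp⟩ := hl.exists_not_koszulExact hI hs (hs' _ (by omega))
    have h0 : 0 ≤ p := by
      by_contra h'
      exact hp (koszulExact_of_neg (by omega))
    have h1 : p ≤ v := by
      by_contra h'
      exact hp (koszulExact_of_gt (by omega))
    refine ⟨(v - p).toNat, s - p + v, ?_, ?_⟩
    · rw [gradedBetti_ne_zero_iff h]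
      have e1 : (v : ℤ) - ((v - p).toNat : ℤ) = p := by omega
      rw [e1, add_sub_cancel_right]
      exact hp
    · omega
  · rintro _ ⟨i, j, hij, rfl⟩
    by_contra hlt
    rw [gradedBetti_ne_zero_iff h] at hij
    refine hij (hl.koszulExact_of_forms_le hI (hs' _ ?_))
    omega

end Betti

/-! ### Existence of graded minimal free resolutions -/

section Existence

variable {k : Type*} [Field k] {v : ℕ}

theorem sum_component_eq (e : ℤ) (f : MvPolynomial (Fin v) k) (W : Finset ℤ)
    (hW : ∀ m, coeff m f ≠ 0 → (m.degree : ℤ) + e ∈ W) :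
    ∑ n ∈ W, component (n - e) f = f := by
  ext m
  rw [coeff_sum]
  simp only [coeff_component]
  by_cases h : coeff m f = 0
  · simp [h]
  · rw [Finset.sum_eq_single_of_mem _ (hW m h)]
    · rw [if_pos (by ring)]
    · intro n _ hn
      rw [if_neg (by omega)]

/-- A graded submodule of the graded free module `⨁_l S(-(deg l))`. -/
def IsGradedSubmodule {r : ℕ} (deg : Fin r → ℤ)
    (Z : Submodule (MvPolynomial (Fin v) k) (Fin r → MvPolynomial (Fin v) k)) : Prop :=
  ∀ f ∈ Z, ∀ n : ℤ, (fun l => component (n - deg l) (f l)) ∈ Z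

theorem exists_homogeneous_generators {r : ℕ} {deg : Fin r → ℤ}
    {Z : Submodule (MvPolynomial (Fin v) k) (Fin r → MvPolynomial (Fin v) k)}
    (hZ : IsGradedSubmodule deg Z) :
    ∃ (r' : ℕ) (deg' : Fin r' → ℤ) (g : Fin r' → Fin r → MvPolynomial (Fin v) k),
      (∀ m, g m ∈ freePiece deg (deg' m)) ∧
        Submodule.span (MvPolynomial (Fin v) k) (Set.range g) = Z := by
  classical
  have hspan : Submodule.span (MvPolynomial (Fin v) k)
      {f | f ∈ Z ∧ ∃ n, f ∈ freePiece deg n} = Z := by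
    apply le_antisymm
    · rw [Submodule.span_le]
      exact fun f hf => hf.1
    · intro f hf
      let W : Finset ℤ := Finset.univ.biUnion fun l =>
        (f l).support.image fun m => (m.degree : ℤ) + deg l
      have hfW : f = ∑ n ∈ W, fun l => component (n - deg l) (f l) := by
        ext1 l
        rw [Finset.sum_apply, sum_component_eq]
        intro m hm
        refine Finset.mem_biUnion.2 ⟨l, Finset.mem_univ l, Finset.mem_image.2 ⟨m, ?_, rfl⟩⟩
        exact mem_support_iff.2 hm
      rw [hfW]
      exact sum_mem fun n _ =>
        Submodule.subset_span ⟨hZ f hf n, n, fun l => component_mem _ _⟩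
  have hfg : (Submodule.span (MvPolynomial (Fin v) k)
      {f | f ∈ Z ∧ ∃ n, f ∈ freePiece deg n}).FG := IsNoetherian.noetherian _
  obtain ⟨T, hT, hTs⟩ := Submodule.fg_span_iff_fg_span_finset_subset _ |>.1 hfg
  rw [hspan] at hTs
  choose deg' hdeg' using fun f : T => (hT f.2).2
  refine ⟨T.card, fun m => deg' (T.equivFin.symm m), fun m => (T.equivFin.symm m : _),
    fun m => hdeg' _, ?_⟩
  rw [hTs]
  congr 1
  ext f
  constructor
  · rintro ⟨m, rfl⟩
    exact (T.equivFin.symm m).2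
  · exact fun hf => ⟨T.equivFin ⟨f, hf⟩, by simp⟩

/-- A generating set of homogeneous elements with as few elements as possible has all its relations
in `(X_1, …, X_v)`: otherwise one of the generators is redundant. -/
theorem exists_minimal_presentation {r : ℕ} {deg : Fin r → ℤ}
    {Z : Submodule (MvPolynomial (Fin v) k) (Fin r → MvPolynomial (Fin v) k)}
    (hZ : IsGradedSubmodule deg Z) :
    ∃ (r' : ℕ) (deg' : Fin r' → ℤ) (A : Matrix (Fin r) (Fin r') (MvPolynomial (Fin v) k)),
      (∀ l m, A l m ∈ forms k v (deg' m - deg l)) ∧ LinearMap.range A.mulVecLin = Z ∧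
      ∀ f, A.mulVecLin f = 0 → ∀ m, f m ∈ idealOfVars (Fin v) k := by
  classical
  have hex : ∃ r' : ℕ, ∃ (deg' : Fin r' → ℤ) (g : Fin r' → Fin r → MvPolynomial (Fin v) k),
      (∀ m, g m ∈ freePiece deg (deg' m)) ∧
        Submodule.span (MvPolynomial (Fin v) k) (Set.range g) = Z :=
    exists_homogeneous_generators hZ
  obtain ⟨deg', g, hg, hgZ⟩ := Nat.find_spec hex
  have hmin := fun {m : ℕ} => Nat.find_min (m := m) hex
  generalize Nat.find hex = r' at *
  have hA : ∀ f : Fin r' → MvPolynomial (Fin v) k,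
      (Matrix.of fun l m => g m l).mulVecLin f = ∑ m, f m • g m := by
    intro f
    ext1 l
    simp [Matrix.mulVec, dotProduct, mul_comm]
  refine ⟨r', deg', Matrix.of fun l m => g m l, fun l m => hg m l, ?_, ?_⟩
  · rw [← hgZ]
    ext y
    rw [Submodule.mem_span_range_iff_exists_fun]
    constructor
    · rintro ⟨f, rfl⟩
      exact ⟨f, (hA f).symm⟩
    · rintro ⟨f, rfl⟩
      exact ⟨f, hA f⟩
  · intro f hf m₀
    rw [mem_idealOfVars_iff]
    by_contra ha
    rw [hA] at hf
    -- the part of the relation in the degree of the generator `g m₀`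
    have hrel : ∑ m, component (deg' m₀ - deg' m) (f m) • g m = 0 := by
      ext1 l
      have h1 := congrArg (component (deg' m₀ - deg l)) (congrFun hf l)
      rw [Finset.sum_apply, map_sum, Pi.zero_apply, map_zero] at h1
      rw [Finset.sum_apply, Pi.zero_apply, ← h1]
      refine Finset.sum_congr rfl fun m _ => ?_
      rw [Pi.smul_apply, smul_eq_mul, Pi.smul_apply, smul_eq_mul, mul_comm (f m),
        component_mul _ (hg m l), mul_comm]
      congr 3
      ring
    obtain ⟨n, rfl⟩ : ∃ n, r' = n + 1 := ⟨r' - 1, by have := m₀.2; omega⟩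
    rw [Fin.sum_univ_succAbove _ m₀, sub_self] at hrel
    have hC : component 0 (f m₀) = C (coeff 0 (f m₀)) := by
      rw [component, if_pos le_rfl, Int.toNat_zero, homogeneousComponent_zero]
    rw [hC] at hrel
    have hg₀ : g m₀ ∈ Submodule.span (MvPolynomial (Fin v) k)
        (Set.range fun m => g (m₀.succAbove m)) := by
      have : g m₀ = (C (coeff 0 (f m₀))⁻¹ : MvPolynomial (Fin v) k) •
          ((C (coeff 0 (f m₀)) : MvPolynomial (Fin v) k) • g m₀) := by
        rw [smul_smul, ← C_mul, inv_mul_cancel₀ ha, C_1, one_smul]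
      rw [this, eq_neg_of_add_eq_zero_left hrel]
      refine Submodule.smul_mem _ _ (neg_mem (sum_mem fun m _ => Submodule.smul_mem _ _ ?_))
      exact Submodule.subset_span ⟨m, rfl⟩
    refine hmin (Nat.lt_succ_self n) ⟨fun m => deg' (m₀.succAbove m),
      fun m => g (m₀.succAbove m), fun m => hg _, ?_⟩
    rw [← hgZ]
    apply le_antisymm
    · refine Submodule.span_mono ?_
      rintro _ ⟨m, rfl⟩
      exact ⟨_, rfl⟩
    · rw [Submodule.span_le]
      rintro _ ⟨m, rfl⟩
      rcases Fin.eq_self_or_eq_succAbove m₀ m with rfl | ⟨j, rfl⟩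
      · exact hg₀
      · exact Submodule.subset_span ⟨j, rfl⟩

variable (k v) in
/-- A stage in the construction of a resolution: a graded free module, with a graded submodule of
`(X_1, …, X_v)` times that module which is to be resolved next. -/
structure ResolutionStage where
  rank : ℕ
  deg : Fin rank → ℤ
  sub : Submodule (MvPolynomial (Fin v) k) (Fin rank → MvPolynomial (Fin v) k)
  graded : IsGradedSubmodule deg sub
  minimal : ∀ f ∈ sub, ∀ l, f l ∈ idealOfVars (Fin v) k

namespace ResolutionStage

variable (Z : ResolutionStage k v)

/-- The number of minimal generators. -/
def nextRank : ℕ := (exists_minimal_presentation Z.graded).choose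

/-- The degrees of the minimal generators. -/
def nextDeg : Fin Z.nextRank → ℤ := (exists_minimal_presentation Z.graded).choose_spec.choose

/-- The matrix with the minimal generators as columns. -/
def matrix : Matrix (Fin Z.rank) (Fin Z.nextRank) (MvPolynomial (Fin v) k) :=
  (exists_minimal_presentation Z.graded).choose_spec.choose_spec.choose

theorem matrix_spec : (∀ l m, Z.matrix l m ∈ forms k v (Z.nextDeg m - Z.deg l)) ∧
    LinearMap.range Z.matrix.mulVecLin = Z.sub ∧
    ∀ f, Z.matrix.mulVecLin f = 0 → ∀ m, f m ∈ idealOfVars (Fin v) k :=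
  (exists_minimal_presentation Z.graded).choose_spec.choose_spec.choose_spec

/-- The next stage: the kernel of the map given by the minimal generators. -/
def next : ResolutionStage k v where
  rank := Z.nextRank
  deg := Z.nextDeg
  sub := LinearMap.ker Z.matrix.mulVecLin
  graded := by
    intro f hf n
    rw [LinearMap.mem_ker] at hf ⊢
    ext1 l
    have h1 := congrArg (component (n - Z.deg l)) (congrFun hf l)
    simp only [Matrix.mulVecLin_apply, Matrix.mulVec, dotProduct, map_sum, Pi.zero_apply,
      map_zero] at h1 ⊢
    rw [← h1]
    refine Finset.sum_congr rfl fun m _ => ?_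
    rw [component_mul _ (Z.matrix_spec.1 l m)]
    congr 3
    ring
  minimal f hf := Z.matrix_spec.2.2 f hf

/-- The sequence of stages that starts with `Z`. -/
def iter : ℕ → ResolutionStage k v
  | 0 => Z
  | i + 1 => (iter i).next

end ResolutionStage

theorem exists_minimalGradedFreeResolution {I : Ideal (MvPolynomial (Fin v) k)} (hI : IsGraded I)
    (hm : I ≤ idealOfVars (Fin v) k) : Nonempty (MinimalGradedFreeResolution I) := by
  let Z : ResolutionStage k v :=
    { rank := 1
      deg := fun _ => 0
      sub :=
        { carrier := {f | ∀ l, f l ∈ I}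
          zero_mem' := fun _ => zero_mem _
          add_mem' := fun ha hb l => add_mem (ha l) (hb l)
          smul_mem' := fun c f hf l => I.mul_mem_left c (hf l) }
      graded := fun f hf n l => hI _ (hf l) _
      minimal := fun f hf l => hm (hf l) }
  refine ⟨{
    rank := fun i => (Z.iter i).rank
    deg := fun i => (Z.iter i).deg
    diff := fun i => (Z.iter i).matrix
    homogeneous := ?_
    minimal := ?_
    rank_zero := rfl
    deg_zero := fun _ => rfl
    exact_zero := ?_
    exact := ?_ }⟩
  · intro i l m
    have h := (Z.iter i).matrix_spec.1 l m
    change _ ∨ ∃ n : ℕ, _ ∧ (Z.iter i).nextDeg m = _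
    rcases lt_or_ge ((Z.iter i).nextDeg m - (Z.iter i).deg l) 0 with h0 | h0
    · exact Or.inl (eq_zero_of_mem_forms_neg h0 h)
    · right
      refine ⟨((Z.iter i).nextDeg m - (Z.iter i).deg l).toNat, ?_, by omega⟩
      rw [← mem_forms_natCast, Int.toNat_of_nonneg h0]
      exact h
  · intro i l m
    classical
    refine (Z.iter i).minimal (fun l => (Z.iter i).matrix l m) ?_ l
    rw [← (Z.iter i).matrix_spec.2.1]
    refine ⟨Pi.single m 1, ?_⟩
    ext1 l
    rw [Matrix.mulVecLin_apply]
    exact congrFun (Matrix.mulVec_single_one (Z.iter i).matrix m) l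
  · intro f
    have := Z.matrix_spec.2.1
    change f ∈ LinearMap.range Z.matrix.mulVecLin ↔ _
    rw [this]
    rfl
  · intro i
    exact (Z.iter i).next.matrix_spec.2.1.symm

end Existence

/-! ### Čech cohomology -/

section Cech

variable {k : Type*} [Field k] {v : ℕ}

/-- The product of the variables in `s`. -/
def monom (k : Type*) [Field k] {v : ℕ} (s : Finset (Fin v)) : MvPolynomial (Fin v) k :=
  ∏ i ∈ s, X i

theorem monom_insert {s : Finset (Fin v)} {i : Fin v} (hi : i ∉ s) :
    monom k (insert i s) = X i * monom k s := Finset.prod_insert hi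

theorem monom_pow_mem (s : Finset (Fin v)) (m : ℕ) : monom k s ^ m ∈ forms k v (m * s.card) := by
  refine pow_mem_forms ?_ m
  have := IsHomogeneous.prod s (fun i => (X i : MvPolynomial (Fin v) k)) (fun _ => 1)
    (fun i _ => isHomogeneous_X k i)
  rw [Finset.sum_const, smul_eq_mul, mul_one] at this
  exact mem_forms_natCast.2 this

/-- The canonical map `S → A_{x_s}`. -/
def toLoc (I : Ideal (MvPolynomial (Fin v) k)) (s : Finset (Fin v)) :
    MvPolynomial (Fin v) k →+* Loc I s :=
  (algebraMap (MvPolynomial (Fin v) k ⧸ I) (Loc I s)).comp (Ideal.Quotient.mk I)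

variable {I : Ideal (MvPolynomial (Fin v) k)}

theorem mk_monom (s : Finset (Fin v)) : Ideal.Quotient.mk I (monom k s) = varProd I s := by
  rw [monom, map_prod]; rfl

theorem toLoc_monom_pow (s t : Finset (Fin v)) (m : ℕ) : toLoc I t (monom k s ^ m) =
    algebraMap (MvPolynomial (Fin v) k ⧸ I) (Loc I t) (varProd I s ^ m) := by
  simp only [toLoc, RingHom.comp_apply, map_pow, mk_monom]

theorem isUnit_toLoc_monom_pow {s t : Finset (Fin v)} (h : s ⊆ t) (m : ℕ) :
    IsUnit (toLoc I t (monom k s ^ m)) := by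
  rw [toLoc_monom_pow, map_pow]
  refine IsUnit.pow m ?_
  exact IsLocalization.Away.isUnit_of_dvd (varProd I t) (varProd_dvd I h)

theorem exists_toLoc (s : Finset (Fin v)) (y : Loc I s) :
    ∃ (m : ℕ) (f : MvPolynomial (Fin v) k), toLoc I s (monom k s ^ m) * y = toLoc I s f := by
  obtain ⟨⟨a, ⟨_, m, rfl⟩⟩, h⟩ := IsLocalization.surj (Submonoid.powers (varProd I s)) y
  obtain ⟨f, rfl⟩ := Ideal.Quotient.mk_surjective a
  refine ⟨m, f, ?_⟩
  rw [mul_comm, toLoc_monom_pow]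
  exact h

theorem toLoc_eq_zero_iff {s : Finset (Fin v)} {f : MvPolynomial (Fin v) k} :
    toLoc I s f = 0 ↔ ∃ m : ℕ, monom k s ^ m * f ∈ I := by
  change algebraMap _ (Loc I s) (Ideal.Quotient.mk I f) = 0 ↔ _
  rw [IsLocalization.map_eq_zero_iff (Submonoid.powers (varProd I s))]
  constructor
  · rintro ⟨⟨_, m, rfl⟩, h⟩
    refine ⟨m, Ideal.Quotient.eq_zero_iff_mem.1 ?_⟩
    rw [map_mul, map_pow, mk_monom]
    exact h
  · rintro ⟨m, h⟩
    refine ⟨⟨_, m, rfl⟩, ?_⟩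
    have := Ideal.Quotient.eq_zero_iff_mem.2 h
    rw [map_mul, map_pow, mk_monom] at this
    exact this

theorem toLoc_eq_zero_of_mem {s : Finset (Fin v)} {f : MvPolynomial (Fin v) k} (hf : f ∈ I) :
    toLoc I s f = 0 := by
  change algebraMap _ (Loc I s) (Ideal.Quotient.mk I f) = 0
  rw [Ideal.Quotient.eq_zero_iff_mem.2 hf, map_zero]

theorem exists_div (s : Finset (Fin v)) (m : ℕ) (z : Loc I s) :
    ∃ y : Loc I s, toLoc I s (monom k s ^ m) * y = z := by
  obtain ⟨u, hu⟩ := isUnit_toLoc_monom_pow (I := I) (Finset.Subset.refl s) m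
  exact ⟨↑u⁻¹ * z, by rw [← hu, ← mul_assoc, Units.mul_inv, one_mul]⟩

theorem cancel_monom {s t : Finset (Fin v)} (h : s ⊆ t) {m : ℕ} {y z : Loc I t}
    (hyz : toLoc I t (monom k s ^ m) * y = toLoc I t (monom k s ^ m) * z) : y = z :=
  (isUnit_toLoc_monom_pow h m).mul_left_cancel hyz

theorem locMap_toLoc {s t : Finset (Fin v)} (h : s ⊆ t) (f : MvPolynomial (Fin v) k) :
    locMap I h (toLoc I s f) = toLoc I t f :=
  IsLocalization.Away.lift_eq (varProd I s)
    (IsLocalization.Away.isUnit_of_dvd (varProd I t) (varProd_dvd I h)) (Ideal.Quotient.mk I f)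

theorem locMap_locMap {s t u : Finset (Fin v)} (h : s ⊆ t) (h' : t ⊆ u) (y : Loc I s) :
    locMap I h' (locMap I h y) = locMap I (h.trans h') y := by
  obtain ⟨m, f, hf⟩ := exists_toLoc s y
  refine cancel_monom (h.trans h') (m := m) ?_
  have h1 := congrArg (fun z => locMap I h' (locMap I h z)) hf
  have h2 := congrArg (locMap I (h.trans h')) hf
  simp only [map_mul, locMap_toLoc] at h1 h2
  rw [h1, h2]

theorem mem_locPiece_iff {s : Finset (Fin v)} {n : ℤ} {y : Loc I s} :
    y ∈ locPiece I s n ↔ ∃ m : ℕ, ∃ f ∈ forms k v (n + m * s.card),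
      toLoc I s (monom k s ^ m) * y = toLoc I s f := by
  constructor
  · intro hy
    refine Submodule.span_induction ?_ ?_ ?_ ?_ hy
    · rintro y ⟨m, e, a, ⟨f, hf, rfl⟩, he, h⟩
      refine ⟨m, f, ?_, ?_⟩
      · rw [← he]
        exact mem_forms_natCast.2 hf
      · rw [mul_comm, toLoc_monom_pow]
        exact h
    · exact ⟨0, 0, zero_mem _, by simp⟩
    · rintro y z - - ⟨m, f, hf, hy⟩ ⟨m', g, hg, hz⟩
      refine ⟨m + m', monom k s ^ m' * f + monom k s ^ m * g, add_mem ?_ ?_, ?_⟩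
      · have := mul_mem_forms (monom_pow_mem s m') hf
        have e : (m' : ℤ) * s.card + (n + m * s.card) = n + (m + m' : ℕ) * s.card := by
          push_cast; ring
        rwa [e] at this
      · have := mul_mem_forms (monom_pow_mem s m) hg
        have e : (m : ℤ) * s.card + (n + m' * s.card) = n + (m + m' : ℕ) * s.card := by
          push_cast; ring
        rwa [e] at this
      · rw [map_add, map_mul, map_mul, ← hy, ← hz, pow_add, map_mul]
        ring
    · rintro a y - ⟨m, f, hf, hy⟩
      refine ⟨m, a • f, Submodule.smul_mem _ _ hf, ?_⟩
      rw [mul_smul_comm, hy]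
      have : toLoc I s (a • f) = (algebraMap (MvPolynomial (Fin v) k ⧸ I) (Loc I s))
        (a • Ideal.Quotient.mk I f) := rfl
      rw [this, Algebra.algebraMap_eq_smul_one, smul_assoc, ← Algebra.algebraMap_eq_smul_one]
      rfl
  · rintro ⟨m, f, hf, h⟩
    rcases lt_or_ge (n + m * s.card) 0 with h0 | h0
    · rw [eq_zero_of_mem_forms_neg h0 hf, map_zero] at h
      have : y = 0 := cancel_monom (Finset.Subset.refl s) (m := m) (by rw [h, mul_zero])
      rw [this]; exact zero_mem _
    · refine Submodule.subset_span ⟨m, (n + m * s.card).toNat, Ideal.Quotient.mk I f,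
        ⟨f, ?_, rfl⟩, Int.toNat_of_nonneg h0, ?_⟩
      · refine mem_forms_natCast.1 ?_
        rwa [Int.toNat_of_nonneg h0]
      · rw [mul_comm, ← toLoc_monom_pow]
        exact h

theorem toLoc_mul_mem_locPiece {s : Finset (Fin v)} {n e : ℤ} {f : MvPolynomial (Fin v) k}
    (hf : f ∈ forms k v e) {y : Loc I s} (hy : y ∈ locPiece I s n) :
    toLoc I s f * y ∈ locPiece I s (n + e) := by
  rw [mem_locPiece_iff] at hy ⊢
  obtain ⟨m, g, hg, h⟩ := hy
  refine ⟨m, f * g, ?_, ?_⟩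
  · have := mul_mem_forms hf hg
    have e : e + (n + m * s.card) = n + e + m * s.card := by ring
    rwa [e] at this
  · rw [mul_left_comm, h, map_mul]

theorem locMap_mem_locPiece {t : Finset (Fin v)} {j : Fin v} (hj : j ∈ t) {n : ℤ}
    {y : Loc I (t.erase j)} (hy : y ∈ locPiece I (t.erase j) n) :
    locMap I (Finset.erase_subset j t) y ∈ locPiece I t n := by
  rw [mem_locPiece_iff] at hy ⊢
  obtain ⟨m, f, hf, h⟩ := hy
  refine ⟨m, X j ^ m * f, ?_, ?_⟩
  · have := mul_mem_forms (pow_mem_forms (X_mem_forms j) m) hf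
    have e : (m : ℤ) * 1 + (n + m * (t.erase j).card) = n + m * t.card := by
      rw [card_erase_cast hj]; ring
    rwa [e] at this
  · have h1 := congrArg (locMap I (Finset.erase_subset j t)) h
    rw [map_mul, locMap_toLoc, locMap_toLoc] at h1
    have h2 : monom k t = X j * monom k (t.erase j) := by
      rw [← monom_insert (Finset.notMem_erase j t), Finset.insert_erase hj]
    rw [h2, mul_pow, map_mul, map_mul, mul_assoc, h1]

/-- The structure map `A_{x_{t \ {j}}} → A_{x_t}` of the Čech complex. -/
def cechMap (I : Ideal (MvPolynomial (Fin v) k)) (t : Finset (Fin v)) (j : Fin v) :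
    Loc I (t.erase j) →+ Loc I t := (locMap I (Finset.erase_subset j t) : _ →+* _).toAddMonoidHom

theorem cechMap_apply (t : Finset (Fin v)) (j : Fin v) (y : Loc I (t.erase j)) :
    cechMap I t j y = locMap I (Finset.erase_subset j t) y := rfl

theorem cechD_eq (c : ∀ s, Loc I s) : cechD I c = cubeD (cechMap I) c := by
  ext t
  rw [cubeD_apply, cechD, LinearMap.pi_apply, LinearMap.sum_apply]
  refine Finset.sum_congr rfl fun j _ => ?_
  rw [LinearMap.smul_apply, cubeSign]
  change _ • locMap I (Finset.erase_subset j t) (c (t.erase j)) = _ • cechMap I t j (c (t.erase j))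
  rw [cechMap_apply]
  rcases neg_one_pow_eq_or ℤ (t.filter (· < j)).card with h | h
  · rcases Nat.even_or_odd (t.filter (· < j)).card with h' | h'
    · rw [h'.neg_one_pow, h'.neg_one_pow, one_smul, one_smul]
    · rw [h'.neg_one_pow] at h; norm_num at h
  · rcases Nat.even_or_odd (t.filter (· < j)).card with h' | h'
    · rw [h'.neg_one_pow] at h; norm_num at h
    · rw [h'.neg_one_pow, h'.neg_one_pow, neg_smul, neg_smul, one_smul, one_smul]

theorem cechMap_comm (c : ∀ s, Loc I s) (t : Finset (Fin v)) (i j : Fin v) :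
    cechMap I t j (cechMap I (t.erase j) i (c ((t.erase j).erase i))) =
      cechMap I t i (cechMap I (t.erase i) j (c ((t.erase i).erase j))) := by
  simp only [cechMap_apply, locMap_locMap]
  have key : ∀ s s' : Finset (Fin v), s = s' → ∀ (h : s ⊆ t) (h' : s' ⊆ t),
      locMap I h (c s) = locMap I h' (c s') := by
    rintro s _ rfl h h'
    rfl
  exact key _ _ Finset.erase_right_comm _ _

/-- The cochains of degree `n` of the Čech complex. -/
abbrev cechPieces (I : Ideal (MvPolynomial (Fin v) k)) (n : ℤ) (p : ℤ) :
    AddSubgroup (∀ s, Loc I s) :=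
  cubeCochains (fun s => (locPiece I s n).toAddSubgroup) p

/-- Exactness at the spot `p`, in degree `n`, of the Čech complex of `S / I`. -/
def CechExact (I : Ideal (MvPolynomial (Fin v) k)) (p n : ℤ) : Prop :=
  ExactAt (cubeD (cechMap I)) (cechPieces I n) p

/-- The action of a polynomial on the families of fractions. -/
def actLoc (I : Ideal (MvPolynomial (Fin v) k)) (f : MvPolynomial (Fin v) k) :
    (∀ s, Loc I s) →+ (∀ s, Loc I s) :=
  familyMap fun s => AddMonoidHom.mulLeft (toLoc I s f)

theorem actLoc_apply (f : MvPolynomial (Fin v) k) (c : ∀ s, Loc I s) (s : Finset (Fin v)) :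
    actLoc I f c s = toLoc I s f * c s := rfl

theorem actLoc_mul (f g : MvPolynomial (Fin v) k) (c : ∀ s, Loc I s) :
    actLoc I (f * g) c = actLoc I f (actLoc I g c) := by
  ext s
  simp only [actLoc_apply, map_mul, mul_assoc]

theorem actLoc_mem {e n p : ℤ} {f : MvPolynomial (Fin v) k} (hf : f ∈ forms k v e)
    {c : ∀ s, Loc I s} (hc : c ∈ cechPieces I n p) : actLoc I f c ∈ cechPieces I (n + e) p := by
  intro s
  exact ⟨toLoc_mul_mem_locPiece hf (hc s).1, fun h => by
    rw [actLoc_apply, (hc s).2 h, mul_zero]⟩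

theorem cubeD_actLoc (f : MvPolynomial (Fin v) k) (c : ∀ s, Loc I s) :
    cubeD (cechMap I) (actLoc I f c) = actLoc I f (cubeD (cechMap I) c) := by
  ext t
  rw [actLoc_apply, cubeD_apply, cubeD_apply, Finset.mul_sum]
  refine Finset.sum_congr rfl fun j _ => ?_
  rw [actLoc_apply, cechMap_apply, cechMap_apply, map_mul, locMap_toLoc, mul_smul_comm]

/-- The map `A_{x_s} → A'_{x_s}` for a quotient `A'` of `A`. -/
def locQuot {I I' : Ideal (MvPolynomial (Fin v) k)} (h : I ≤ I') (s : Finset (Fin v)) :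
    Loc I s →+* Loc I' s :=
  IsLocalization.Away.lift (varProd I s)
    (g := (algebraMap (MvPolynomial (Fin v) k ⧸ I') (Loc I' s)).comp (Ideal.Quotient.factor h))
    (by
      have h1 := isUnit_toLoc_monom_pow (I := I') (Finset.Subset.refl s) 1
      rw [toLoc_monom_pow, pow_one] at h1
      have h2 : Ideal.Quotient.factor h (varProd I s) = varProd I' s := by
        simp [varProd]
      rw [RingHom.comp_apply, h2]
      exact h1)

theorem locQuot_toLoc {I' : Ideal (MvPolynomial (Fin v) k)} (h : I ≤ I') (s : Finset (Fin v))
    (f : MvPolynomial (Fin v) k) : locQuot h s (toLoc I s f) = toLoc I' s f :=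
  IsLocalization.Away.lift_eq (varProd I s) _ (Ideal.Quotient.mk I f)

/-- The sequence of Čech complexes induced by `0 → S / I → S / I → S / (I + θ) → 0`, for a linear
form `θ` that is regular modulo `I`. -/
theorem cech_isShortExact (hI : IsGraded I) {θ : MvPolynomial (Fin v) k} (hθ : θ ∈ forms k v 1)
    (hreg : IsRegularMod I θ) (n : ℤ) :
    IsShortExact (cubeD (cechMap I)) (cechPieces I (n - 1)) (cubeD (cechMap I)) (cechPieces I n)
      (cubeD (cechMap (I ⊔ Ideal.span {θ}))) (cechPieces (I ⊔ Ideal.span {θ}) n)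
      (actLoc I θ)
      (familyMap fun s => (locQuot (le_sup_left (b := Ideal.span {θ})) s).toAddMonoidHom) := by
  have hinj : ∀ s, ∀ y : Loc I s, toLoc I s θ * y = 0 → y = 0 := by
    intro s y hy
    obtain ⟨m, f, hf⟩ := exists_toLoc s y
    have h1 : toLoc I s (θ * f) = 0 := by rw [map_mul, ← hf, mul_left_comm, hy, mul_zero]
    obtain ⟨r, hr⟩ := toLoc_eq_zero_iff.1 h1
    rw [mul_left_comm] at hr
    have h2 := toLoc_eq_zero_iff.2 ⟨r, hreg _ hr⟩
    rw [← hf] at h2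
    exact cancel_monom (Finset.Subset.refl s) (m := m) (by rw [h2, mul_zero])
  refine cube_isShortExact _ _ (fun c t i j _ _ _ => cechMap_comm c t i j)
    (fun t j hj y hy => locMap_mem_locPiece hj hy) ?_ ?_ ?_ ?_ ?_ ?_ ?_ ?_
  · intro t j y
    simp only [AddMonoidHom.coe_mulLeft, cechMap_apply, map_mul, locMap_toLoc]
  · intro t j y
    change locQuot _ t (locMap I (Finset.erase_subset j t) y) =
      locMap _ (Finset.erase_subset j t) (locQuot _ _ y)
    obtain ⟨m, f, hf⟩ := exists_toLoc _ y
    refine cancel_monom (Finset.erase_subset j t) (m := m) ?_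
    have h1 := congrArg (fun z => locQuot (le_sup_left (b := Ideal.span {θ})) t
      (locMap I (Finset.erase_subset j t) z)) hf
    have h2 := congrArg (fun z => locMap _ (Finset.erase_subset j t)
      (locQuot (le_sup_left (b := Ideal.span {θ})) _ z)) hf
    simp only [map_mul, locMap_toLoc, locQuot_toLoc] at h1 h2
    rw [h1, h2]
  · intro s y hy
    have := toLoc_mul_mem_locPiece (I := I) hθ hy
    rwa [sub_add_cancel] at this
  · intro s y hy
    obtain ⟨m, f, hf, h⟩ := mem_locPiece_iff.1 hy
    refine mem_locPiece_iff.2 ⟨m, f, hf, ?_⟩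
    change _ * locQuot _ s y = _
    rw [← locQuot_toLoc le_sup_left, ← map_mul, h, locQuot_toLoc]
  · intro s
    rw [injective_iff_map_eq_zero]
    exact hinj s
  · intro s y
    change locQuot _ s (toLoc I s θ * y) = 0
    rw [map_mul, locQuot_toLoc, toLoc_eq_zero_of_mem, zero_mul]
    exact Ideal.mem_sup_right (Ideal.mem_span_singleton_self θ)
  · intro s y hy h0
    obtain ⟨m, f, hf, h⟩ := mem_locPiece_iff.1 hy
    change locQuot _ s y = 0 at h0
    have h1 := congrArg (locQuot (le_sup_left (b := Ideal.span {θ})) s) h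
    rw [map_mul, h0, mul_zero, locQuot_toLoc] at h1
    obtain ⟨r, hr⟩ := toLoc_eq_zero_iff.1 h1.symm
    obtain ⟨g, hg, hfg⟩ := exists_of_mem_sup_span hI hθ (mul_mem_forms (monom_pow_mem s r) hf) hr
    obtain ⟨z, hz⟩ := exists_div (I := I) s (m + r) (toLoc I s g)
    refine ⟨z, mem_locPiece_iff.2 ⟨m + r, g, ?_, hz⟩, ?_⟩
    · have e : (r : ℤ) * s.card + (n + m * s.card) - 1 = n - 1 + (m + r : ℕ) * s.card := by
        push_cast; ring
      rwa [e] at hg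
    · refine cancel_monom (Finset.Subset.refl s) (m := m + r) ?_
      have h2 := toLoc_eq_zero_of_mem (s := s) hfg
      rw [map_sub, sub_eq_zero, map_mul, map_mul, ← h, ← hz, ← mul_assoc, ← map_mul,
        ← pow_add, add_comm r m] at h2
      change _ * (toLoc I s θ * z) = _
      rw [h2]
      ring
  · intro s z hz
    obtain ⟨m, f, hf, h⟩ := mem_locPiece_iff.1 hz
    obtain ⟨y, hy⟩ := exists_div (I := I) s m (toLoc I s f)
    refine ⟨y, mem_locPiece_iff.2 ⟨m, f, hf, hy⟩, ?_⟩
    refine cancel_monom (Finset.Subset.refl s) (m := m) ?_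
    change _ * locQuot _ s y = _
    rw [h, ← locQuot_toLoc le_sup_left, ← map_mul, hy, locQuot_toLoc]

end Cech

section CechTorsion

variable {k : Type*} [Field k] {v : ℕ} {I : Ideal (MvPolynomial (Fin v) k)}

/-- Inverting one more variable `x i` allows only powers of `x i` as new denominators. -/
theorem exists_lift_of_mem_locPiece {s t : Finset (Fin v)} {i : Fin v} (hi : i ∉ s)
    (ht : insert i s = t) (h : s ⊆ t) {n : ℤ} {y : Loc I t} (hy : y ∈ locPiece I t n) :
    ∃ N₀ : ℕ, ∀ N ≥ N₀, ∃ y' ∈ locPiece I s (n + N), locMap I h y' = toLoc I t (X i ^ N) * y := by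
  subst ht
  obtain ⟨m, f, hf, hmf⟩ := mem_locPiece_iff.1 hy
  refine ⟨m, fun N hN => ?_⟩
  obtain ⟨y', hy'⟩ := exists_div (I := I) s m (toLoc I s (X i ^ (N - m) * f))
  refine ⟨y', mem_locPiece_iff.2 ⟨m, _, ?_, hy'⟩, ?_⟩
  · have := mul_mem_forms (pow_mem_forms (X_mem_forms i) (N - m)) hf
    rw [card_insert_cast hi, Nat.cast_sub hN] at this
    have e : ((N : ℤ) - m) * 1 + (n + m * (s.card + 1)) = n + N + m * s.card := by ring
    rwa [e] at this
  · refine cancel_monom h (m := m) ?_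
    have h1 := congrArg (locMap I h) hy'
    rw [map_mul, locMap_toLoc, locMap_toLoc, map_mul, ← hmf, ← mul_assoc, ← map_mul,
      monom_insert hi] at h1
    rw [h1, ← mul_assoc, ← map_mul, mul_pow]
    congr 2
    rw [← mul_assoc, ← pow_add, Nat.sub_add_cancel hN, mul_comm]

theorem exists_pow_mul_eq_zero {s t : Finset (Fin v)} {i : Fin v} (hi : i ∉ s)
    (ht : insert i s = t) (h : s ⊆ t) {y : Loc I s} (hy : locMap I h y = 0) :
    ∃ N₀ : ℕ, ∀ N ≥ N₀, toLoc I s (X i ^ N) * y = 0 := by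
  subst ht
  obtain ⟨m, f, hf⟩ := exists_toLoc s y
  have h1 := congrArg (locMap I h) hf
  rw [map_mul, hy, mul_zero, locMap_toLoc] at h1
  obtain ⟨r, hr⟩ := toLoc_eq_zero_iff.1 h1.symm
  refine ⟨r, fun N hN => cancel_monom (Finset.Subset.refl s) (m := m) ?_⟩
  rw [mul_left_comm, hf, mul_zero, ← map_mul, toLoc_eq_zero_iff]
  refine ⟨r, ?_⟩
  obtain ⟨e, rfl⟩ := Nat.exists_eq_add_of_le hN
  have : monom k s ^ r * (X i ^ (r + e) * f) = X i ^ e * (monom k (insert i s) ^ r * f) := by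
    rw [monom_insert hi]; ring
  rw [this]
  exact Ideal.mul_mem_left _ _ hr

/-- Čech cohomology is torsion with respect to each variable: after multiplication by a power of
`X i`, the entries `c_{s ∪ {i}}` of a cocycle lift to `A_{x_s}` and form a cochain that bounds
the cocycle. -/
theorem exists_cech_torsion {p n : ℤ} {c : ∀ s, Loc I s} (hc : c ∈ cechPieces I n p)
    (hD : cubeD (cechMap I) c = 0) (i : Fin v) :
    ∃ N₀ : ℕ, ∀ N ≥ N₀, ∃ b ∈ cechPieces I (n + N) (p - 1),
      cubeD (cechMap I) b = actLoc I (X i ^ N) c := by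
  classical
  have h1 : ∀ s : Finset (Fin v), ∃ N₀ : ℕ, ∀ N ≥ N₀, i ∉ s → ∃ y' ∈ locPiece I s (n + N),
      ∀ t, ∀ h : s ⊆ t, insert i s = t → locMap I h y' = toLoc I t (X i ^ N) * c t := by
    intro s
    by_cases hi : i ∈ s
    · exact ⟨0, fun _ _ h => absurd hi h⟩
    · obtain ⟨N₀, hN₀⟩ := exists_lift_of_mem_locPiece hi rfl (Finset.subset_insert i s)
        (hc (insert i s)).1
      refine ⟨N₀, fun N hN _ => ?_⟩
      obtain ⟨y', hy', h⟩ := hN₀ N hN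
      refine ⟨y', hy', ?_⟩
      rintro t h' rfl
      exact h
  choose N₁ hN₁ using h1
  obtain ⟨M, hM⟩ : ∃ M, ∀ s, N₁ s ≤ M :=
    ⟨∑ s, N₁ s, fun s => Finset.single_le_sum (f := N₁) (fun _ _ => Nat.zero_le _)
      (Finset.mem_univ s)⟩
  choose y' hy' hy'c using fun s => hN₁ s M (hM s)
  let b : ∀ s, Loc I s := fun s => if h : i ∉ s ∧ (s.card : ℤ) = p - 1 then
    cubeSign (insert i s) i • y' s h.1 else 0
  have hb : b ∈ cechPieces I (n + M) (p - 1) := by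
    refine mem_cubeCochains_of (fun s hs => ?_) (fun s hs => dif_neg fun h => hs h.2)
    by_cases hi : i ∈ s
    · have : b s = 0 := dif_neg fun h => h.1 hi
      rw [this]; exact zero_mem _
    · have : b s = _ := dif_pos ⟨hi, hs⟩
      rw [this]
      exact zsmul_mem (hy' s hi) _
  have hDb : ∀ t, i ∈ t → cubeD (cechMap I) b t = actLoc I (X i ^ M) c t := by
    intro t hi
    rw [cubeD_apply, Finset.sum_eq_single_of_mem i hi]
    · by_cases ht : (t.card : ℤ) = p
      · have h2 : b (t.erase i) = _ :=
          dif_pos ⟨Finset.notMem_erase i t, by rw [card_erase_cast hi, ht]⟩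
        rw [h2, Finset.insert_erase hi, map_zsmul, ← mul_zsmul, cubeSign_mul_self, one_zsmul,
          cechMap_apply]
        exact hy'c _ _ t _ (Finset.insert_erase hi)
      · have h2 : b (t.erase i) = 0 := dif_neg fun h => ht (by
          have := h.2; rw [card_erase_cast hi] at this; omega)
        rw [h2, map_zero, zsmul_zero, actLoc_apply, (hc t).2 ht, mul_zero]
    · intro j _ hji
      have h2 : b (t.erase j) = 0 := dif_neg fun h => h.1 (Finset.mem_erase.2 ⟨hji.symm, hi⟩)
      rw [h2, map_zero, zsmul_zero]
  -- the difference `g` is a cocycle that lives on the subsets without `i`, so it is `X i`-torsion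
  let g := actLoc I (X i ^ M) c - cubeD (cechMap I) b
  have hg : ∀ t, i ∈ t → g t = 0 := fun t hi => by
    change actLoc I (X i ^ M) c t - cubeD (cechMap I) b t = 0
    rw [hDb t hi, sub_self]
  have hDg : cubeD (cechMap I) g = 0 := by
    rw [map_sub, cubeD_actLoc, hD, map_zero,
      cubeD_cubeD _ (fun c t i j _ _ _ => cechMap_comm c t i j), sub_zero]
  have h3 : ∀ t : Finset (Fin v), ∃ N₀ : ℕ, ∀ N ≥ N₀, toLoc I t (X i ^ N) * g t = 0 := by
    intro t
    by_cases hi : i ∈ t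
    · exact ⟨0, fun N _ => by rw [hg t hi, mul_zero]⟩
    · have h4 := congrFun hDg (insert i t)
      rw [cubeD_apply, Finset.sum_eq_single_of_mem i (Finset.mem_insert_self i t)] at h4
      · have h5 : cechMap I (insert i t) i (g ((insert i t).erase i)) = 0 := by
          have := congrArg (fun z => cubeSign (insert i t) i • z) h4
          simpa only [smul_smul, cubeSign_mul_self, one_smul, Pi.zero_apply, zsmul_zero] using this
        have h6 := exists_pow_mul_eq_zero (s := (insert i t).erase i) (Finset.notMem_erase i _)
          (Finset.insert_erase (Finset.mem_insert_self i t)) (Finset.erase_subset _ _) h5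
        exact Finset.erase_insert hi ▸ h6
      · intro j hj hji
        rw [hg, map_zero, zsmul_zero]
        exact Finset.mem_erase.2 ⟨hji.symm, Finset.mem_insert_self i t⟩
  choose N₂ hN₂ using h3
  obtain ⟨M', hM'⟩ : ∃ M, ∀ s, N₂ s ≤ M :=
    ⟨∑ s, N₂ s, fun s => Finset.single_le_sum (f := N₂) (fun _ _ => Nat.zero_le _)
      (Finset.mem_univ s)⟩
  refine ⟨M + M', fun N hN => ?_⟩
  obtain ⟨e, rfl⟩ := Nat.exists_eq_add_of_le hN
  refine ⟨actLoc I (X i ^ (M' + e)) b, ?_, ?_⟩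
  · have := actLoc_mem (pow_mem_forms (X_mem_forms (k := k) i) (M' + e)) hb
    have e' : n + (M : ℤ) + (M' + e : ℕ) * 1 = n + (M + M' + e : ℕ) := by push_cast; ring
    rwa [e'] at this
  · have h7 : actLoc I (X i ^ (M' + e)) g = 0 := by
      ext t
      exact hN₂ t _ ((hM' t).trans (Nat.le_add_right _ _))
    rw [map_sub, sub_eq_zero, ← actLoc_mul, ← pow_add] at h7
    rw [cubeD_actLoc, ← h7]
    congr 2
    ring

/-- Čech cohomology is torsion with respect to each linear form. -/
theorem exists_cech_torsion_linear {p n : ℤ} {c : ∀ s, Loc I s} (hc : c ∈ cechPieces I n p)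
    (hD : cubeD (cechMap I) c = 0) {θ : MvPolynomial (Fin v) k} (hθ : θ ∈ forms k v 1) :
    ∃ M : ℕ, ∃ b ∈ cechPieces I (n + M) (p - 1),
      cubeD (cechMap I) b = actLoc I (θ ^ M) c := by
  choose N₀ hN₀ using exists_cech_torsion hc hD
  obtain ⟨N, hN⟩ : ∃ N, ∀ i, N₀ i ≤ N :=
    ⟨∑ i, N₀ i, fun i => Finset.single_le_sum (f := N₀) (fun _ _ => Nat.zero_le _)
      (Finset.mem_univ i)⟩
  choose b hb hDb using fun i => hN₀ i N (hN i)
  have hrad : θ ∈ (Ideal.span (Set.range fun i : Fin v =>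
      (X i ^ N : MvPolynomial (Fin v) k))).radical := by
    obtain ⟨a, rfl⟩ := exists_linForm hθ
    refine sum_mem fun i _ => Ideal.mul_mem_left _ _ ?_
    exact ⟨N, Ideal.subset_span ⟨i, rfl⟩⟩
  obtain ⟨M, hM⟩ := hrad
  obtain ⟨h, hh⟩ := Ideal.mem_span_range_iff_exists_fun.1 hM
  have hθM := pow_mem_forms hθ M
  have hh' : θ ^ M = ∑ i, component (M - N) (h i) * X i ^ N := by
    rw [mul_one] at hθM
    conv_lhs => rw [← component_of_mem hθM, ← hh, map_sum]
    refine Finset.sum_congr rfl fun i _ => ?_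
    have := pow_mem_forms (X_mem_forms (k := k) i) N
    rw [mul_one] at this
    rw [mul_comm, component_mul _ this, mul_comm]
  refine ⟨M, ∑ i, actLoc I (component (M - N) (h i)) (b i), sum_mem fun i _ => ?_, ?_⟩
  · have := actLoc_mem (component_mem (M - N) (h i)) (hb i)
    rwa [add_assoc, add_sub_cancel] at this
  · rw [map_sum, hh']
    ext s
    rw [actLoc_apply, map_sum, Finset.sum_mul, Finset.sum_apply]
    refine Finset.sum_congr rfl fun i _ => ?_
    rw [cubeD_actLoc, hDb, ← actLoc_mul, actLoc_apply]

/-- If `S / (I + θ)` has no Čech cohomology at `p - 1` in degrees above `n`, then `θ` is injective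
on the cohomology of `S / I` at `p` in degrees from `n` on, so that the cohomology vanishes there,
being torsion. -/
theorem cechExact_of_quotient (hI : IsGraded I) {θ : MvPolynomial (Fin v) k}
    (hθ : θ ∈ forms k v 1) (hreg : IsRegularMod I θ) {p n : ℤ}
    (h : ∀ m > n, CechExact (I ⊔ Ideal.span {θ}) (p - 1) m) : CechExact I p n := by
  intro c hc hD
  obtain ⟨M, hM⟩ := exists_cech_torsion_linear hc hD hθ
  induction M with
  | zero => simpa [actLoc, familyMap] using hM
  | succ M ih =>
    refine ih ?_
    have := (cech_isShortExact hI hθ hreg (n + M + 1)).exists_of_exists_left (p := p)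
      (x := actLoc I (θ ^ M) c) (h _ (by omega))
    rw [add_sub_cancel_right] at this
    refine this ?_
    rw [← actLoc_mul, ← pow_succ']
    rwa [add_assoc n, ← Nat.cast_succ]

theorem subsingleton_loc {N : ℤ} (hJ : ∀ n > N, ∀ f ∈ forms k v n, f ∈ I) {s : Finset (Fin v)}
    (hs : s.Nonempty) : Subsingleton (Loc I s) := by
  obtain ⟨i, hi⟩ := hs
  have h1 : (X i : MvPolynomial (Fin v) k) ^ (N.toNat + 1) ∈ I := by
    refine hJ _ ?_ _ (pow_mem_forms (X_mem_forms i) _)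
    push_cast
    omega
  have h2 := toLoc_eq_zero_of_mem (s := s) h1
  have h3 : IsUnit (toLoc I s (X i ^ (N.toNat + 1))) := by
    have := isUnit_toLoc_monom_pow (I := I) (Finset.singleton_subset_iff.2 hi) (N.toNat + 1)
    simpa [monom] using this
  rw [h2] at h3
  exact subsingleton_of_zero_eq_one (isUnit_zero_iff.1 h3)

/-- Čech cohomology is concentrated at the length of `l`, and there in degrees at most
`s - l.length`, where `s` is the top degree of the Artinian reduction. -/
theorem IsLinearRegular.cechExact (hI : IsGraded I) {l : List (MvPolynomial (Fin v) k)}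
    (hl : IsLinearRegular I l) {s : ℤ}
    (hJ : ∀ n > s, ∀ f ∈ forms k v n, f ∈ I ⊔ Ideal.ofList l) {p n : ℤ}
    (hpn : p ≠ l.length ∨ s - l.length < n) : CechExact I p n := by
  induction l generalizing I p n with
  | nil =>
    rw [sup_ofList_nil] at hJ
    intro c hc _
    refine ⟨0, zero_mem _, ?_⟩
    rw [map_zero]
    ext t
    rcases t.eq_empty_or_nonempty with rfl | ht
    · by_cases hp : p = 0
      · obtain ⟨m, f, hf, h⟩ := mem_locPiece_iff.1 (hc ∅).1
        have h1 : f ∈ I := by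
          refine hJ _ ?_ f hf
          simp only [List.length_nil, Nat.cast_zero, sub_zero] at hpn
          simp only [Finset.card_empty, Nat.cast_zero, mul_zero, add_zero]
          tauto
        rw [toLoc_eq_zero_of_mem h1] at h
        exact (cancel_monom (Finset.Subset.refl _) (m := m) (by rw [h]; simp)).symm
      · exact ((hc ∅).2 (by simpa using Ne.symm hp)).symm
    · have := subsingleton_loc hJ ht
      exact Subsingleton.elim _ _
  | cons θ l ih =>
    obtain ⟨h1, h2, h3⟩ := hl
    rw [sup_ofList_cons] at hJ
    refine cechExact_of_quotient hI h1 h2 fun m hm => ?_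
    refine ih (hI.sup (isGraded_span_singleton h1)) h3 hJ ?_
    rw [List.length_cons, Nat.cast_succ] at hpn
    omega

theorem IsLinearRegular.not_cechExact (hI : IsGraded I) {l : List (MvPolynomial (Fin v) k)}
    (hl : IsLinearRegular I l) {s : ℤ}
    (hs : ¬ ∀ f ∈ forms k v s, f ∈ I ⊔ Ideal.ofList l)
    (hJ : ∀ n > s, ∀ f ∈ forms k v n, f ∈ I ⊔ Ideal.ofList l) :
    ¬ CechExact I l.length (s - l.length) := by
  induction l generalizing I with
  | nil =>
    rw [sup_ofList_nil] at hs hJ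
    refine fun hE => hs fun f hf => ?_
    have hc : Pi.single (∅ : Finset (Fin v)) (toLoc I ∅ f) ∈
        cechPieces I (s - ([] : List (MvPolynomial (Fin v) k)).length)
          ([] : List (MvPolynomial (Fin v) k)).length := by
      refine mem_cubeCochains_of (fun t ht => ?_) (fun t ht => ?_)
      · have : t = ∅ := by simpa using ht
        subst this
        rw [Pi.single_eq_same]
        exact mem_locPiece_iff.2 ⟨0, f, by simpa using hf, by simp⟩
      · rw [Pi.single_eq_of_ne]
        rintro rfl
        simp at ht
    obtain ⟨b, hb, hDb⟩ := hE _ hc (by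
      ext t
      rcases t.eq_empty_or_nonempty with rfl | ht
      · simp [cubeD_apply]
      · have := subsingleton_loc hJ ht
        exact Subsingleton.elim _ _)
    have h0 := congrFun hDb ∅
    rw [cubeD_apply, Finset.sum_empty, Pi.single_eq_same] at h0
    obtain ⟨m, hm⟩ := toLoc_eq_zero_iff.1 h0.symm
    simpa [monom] using hm
  | cons θ l ih =>
    obtain ⟨h1, h2, h3⟩ := hl
    rw [sup_ofList_cons] at hs hJ
    have hI' := hI.sup (isGraded_span_singleton h1)
    intro hE
    refine ih hI' h3 hs hJ ?_
    refine (cech_isShortExact hI h1 h2 (s - l.length)).exactAt_right ?_ ?_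
    · refine cechExact_of_quotient hI h1 h2 fun m _ => ?_
      exact h3.cechExact hI' hJ (Or.inl (by omega))
    · have e : s - ((θ :: l).length : ℤ) = s - l.length - 1 := by
        rw [List.length_cons]; push_cast; ring
      rw [e] at hE
      exact_mod_cast hE

theorem mem_cechCochains_iff {p : ℕ} {n : ℤ} {c : ∀ s, Loc I s} :
    c ∈ cechCochains I p n ↔ c ∈ cechPieces I n p := by
  rw [cechCochains, Submodule.mem_pi, mem_cubeCochains]
  refine forall_congr' fun s => ?_
  by_cases hs : s.card = p
  · simp [hs]
  · have : (s.card : ℤ) ≠ p := by exact_mod_cast hs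
    simp only [Set.mem_univ, true_imp_iff, if_neg hs, Submodule.mem_bot, ne_eq, this,
      not_false_eq_true]
    exact ⟨fun h => ⟨by rw [h]; exact zero_mem _, h⟩, fun h => h.2⟩

theorem nontrivial_localCohomologyPiece_iff (p : ℕ) (n : ℤ) :
    Nontrivial (LocalCohomologyPiece I (p + 1) n) ↔ ¬ CechExact I (p + 1 : ℕ) n := by
  rw [Submodule.Quotient.nontrivial_iff, not_iff_not, Submodule.comap_subtype_eq_top]
  constructor
  · intro h c hc hD
    obtain ⟨b, hb, hDb⟩ := h ⟨mem_cechCochains_iff.2 hc, LinearMap.mem_ker.2 (by rw [cechD_eq, hD])⟩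
    rw [SetLike.mem_coe, mem_cechCochains_iff] at hb
    exact ⟨b, by simpa using hb, by rw [← cechD_eq, hDb]⟩
  · rintro h c ⟨hc, hD⟩
    rw [SetLike.mem_coe, LinearMap.mem_ker, cechD_eq] at hD
    obtain ⟨b, hb, hDb⟩ := h c (mem_cechCochains_iff.1 hc) hD
    refine ⟨b, mem_cechCochains_iff.2 (by simpa using hb), by rw [cechD_eq, hDb]⟩

/-- The `a`-invariant is the top degree of the Artinian reduction, shifted by the dimension. -/
theorem IsLinearRegular.isAInvariant (hI : IsGraded I) {l : List (MvPolynomial (Fin v) k)}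
    (hl : IsLinearRegular I l) (hd : 1 ≤ l.length)
    (hdim : ringKrullDim (MvPolynomial (Fin v) k ⧸ I) = l.length) {s : ℤ}
    (hs : ¬ ∀ f ∈ forms k v s, f ∈ I ⊔ Ideal.ofList l)
    (hJ : ∀ n > s, ∀ f ∈ forms k v n, f ∈ I ⊔ Ideal.ofList l) :
    IsAInvariant I (s - l.length) := by
  obtain ⟨p, hp⟩ : ∃ p, l.length = p + 1 := ⟨l.length - 1, by omega⟩
  refine ⟨l.length, hdim, ?_, ?_⟩
  · have := hl.not_cechExact hI hs hJ
    rw [hp] at this ⊢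
    exact (nontrivial_localCohomologyPiece_iff p _).2 this
  · intro n hn
    by_contra hlt
    have := hl.cechExact hI hJ (p := l.length) (n := n) (Or.inr (by omega))
    rw [hp] at this hn
    exact (nontrivial_localCohomologyPiece_iff p _).1 hn this

end CechTorsion

/-! ### Hilbert functions and the multiplicity -/

section Hilbert

variable {k : Type*} [Field k] {v : ℕ}

/-- The Hilbert function of `S / I`. -/
def hilb (I : Ideal (MvPolynomial (Fin v) k)) (n : ℕ) : ℕ := Module.finrank k (piece I n)

theorem mem_piece {I : Ideal (MvPolynomial (Fin v) k)} {n : ℕ} {y : MvPolynomial (Fin v) k ⧸ I} :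
    y ∈ piece I n ↔ ∃ f ∈ forms k v n, Ideal.Quotient.mk I f = y := by
  simp only [mem_forms_natCast]
  exact Iff.rfl

instance (I : Ideal (MvPolynomial (Fin v) k)) (n : ℕ) : Module.Finite k (piece I n) :=
  Module.Finite.iff_fg.2 ((homogeneousSubmodule_fg (Fin v) k n).map _)

theorem hilb_zero {I : Ideal (MvPolynomial (Fin v) k)} (h1 : 1 ∉ I) : hilb I 0 = 1 := by
  have h : piece I 0 = Submodule.span k {1} := by
    ext y
    rw [mem_piece, Submodule.mem_span_singleton]
    constructor
    · rintro ⟨f, hf, rfl⟩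
      refine ⟨coeff 0 f, ?_⟩
      have : f = C (coeff 0 f) := by
        refine (totalDegree_eq_zero_iff_eq_C).1 ?_
        have := (mem_forms_natCast.1 hf).totalDegree_le
        omega
      conv_rhs => rw [this, ← mul_one (C _), ← smul_eq_C_mul]
      rfl
    · rintro ⟨a, rfl⟩
      exact ⟨C a, by simpa using C_mem_forms a, by rw [← mul_one (C a), ← smul_eq_C_mul]; rfl⟩
  rw [hilb, h]
  refine finrank_span_singleton fun h0 => h1 (Ideal.Quotient.eq_zero_iff_mem.1 ?_)
  rw [map_one, h0]

theorem hilb_eq_zero_iff {I : Ideal (MvPolynomial (Fin v) k)} {n : ℕ} :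
    hilb I n = 0 ↔ ∀ f ∈ forms k v n, f ∈ I := by
  rw [hilb, Submodule.finrank_eq_zero, eq_bot_iff]
  constructor
  · exact fun h f hf => Ideal.Quotient.eq_zero_iff_mem.1 (h (mem_piece.2 ⟨f, hf, rfl⟩))
  · rintro h y hy
    obtain ⟨f, hf, rfl⟩ := mem_piece.1 hy
    exact Ideal.Quotient.eq_zero_iff_mem.2 (h f hf)

theorem hilb_eq_hilb_bot {I : Ideal (MvPolynomial (Fin v) k)} {n : ℕ}
    (h : ∀ f ∈ forms k v n, f ∈ I → f = 0) :
    hilb I n = hilb (⊥ : Ideal (MvPolynomial (Fin v) k)) n := by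
  have key : ∀ I : Ideal (MvPolynomial (Fin v) k),
      (∀ f ∈ forms k v n, f ∈ I → f = 0) →
      hilb I n = Module.finrank k (homogeneousSubmodule (Fin v) k n) := by
    intro I h
    refine (LinearEquiv.finrank_eq (LinearEquiv.ofBijective
      ((Ideal.Quotient.mkₐ k I).toLinearMap.submoduleMap _)
      ⟨?_, LinearMap.submoduleMap_surjective _ _⟩)).symm
    rw [← LinearMap.ker_eq_bot, eq_bot_iff]
    intro f hf
    rw [LinearMap.mem_ker, Subtype.ext_iff] at hf
    exact Subtype.ext (h f (mem_forms_natCast.2 f.2) (Ideal.Quotient.eq_zero_iff_mem.1 hf))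
  rw [key I h, key ⊥ fun f _ h' => h']

theorem hilb_eq_add {I : Ideal (MvPolynomial (Fin v) k)} (hI : IsGraded I)
    {θ : MvPolynomial (Fin v) k} (hθ : θ ∈ forms k v 1) (h : IsRegularMod I θ) (n : ℕ) :
    hilb I (n + 1) = hilb I n + hilb (I ⊔ Ideal.span {θ}) (n + 1) := by
  let π : (MvPolynomial (Fin v) k ⧸ I) →ₗ[k] (MvPolynomial (Fin v) k ⧸ (I ⊔ Ideal.span {θ})) :=
    (Ideal.Quotient.factorₐ k le_sup_left).toLinearMap
  let μ : (MvPolynomial (Fin v) k ⧸ I) →ₗ[k] (MvPolynomial (Fin v) k ⧸ I) :=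
    LinearMap.mulLeft k (Ideal.Quotient.mk I θ)
  have hμ : Function.Injective μ := smul_injective_of_isRegularMod h
  have h1 : (piece I (n + 1)).map π = piece (I ⊔ Ideal.span {θ}) (n + 1) := by
    rw [piece, ← Submodule.map_comp]; rfl
  have h2 : LinearMap.ker (π.domRestrict (piece I (n + 1))) =
      ((piece I n).map μ).comap (piece I (n + 1)).subtype := by
    ext ⟨y, hy⟩
    rw [LinearMap.mem_ker, Submodule.mem_comap, LinearMap.domRestrict_apply, Submodule.subtype_apply]
    constructor
    · intro h0
      obtain ⟨f, hf, rfl⟩ := mem_piece.1 hy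
      obtain ⟨g, hg, hfg⟩ := exists_of_mem_sup_span hI hθ hf (Ideal.Quotient.eq_zero_iff_mem.1 h0)
      refine ⟨Ideal.Quotient.mk I g, mem_piece.2 ⟨g, by simpa using hg, rfl⟩, ?_⟩
      exact (Ideal.Quotient.eq.2 hfg).symm
    · rintro ⟨z, _, h⟩
      obtain ⟨g, rfl⟩ := Ideal.Quotient.mk_surjective z
      rw [← h]
      exact Ideal.Quotient.eq_zero_iff_mem.2
        (Ideal.mul_mem_right _ _ (Ideal.mem_sup_right (Ideal.mem_span_singleton_self _)))
  have h3 : (piece I n).map μ ≤ piece I (n + 1) := by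
    rintro _ ⟨z, hz, rfl⟩
    obtain ⟨g, hg, rfl⟩ := mem_piece.1 hz
    refine mem_piece.2 ⟨θ * g, ?_, rfl⟩
    have := mul_mem_forms hθ hg
    rwa [add_comm] at this
  have h4 := LinearMap.finrank_range_add_finrank_ker (π.domRestrict (piece I (n + 1)))
  rw [h2, LinearMap.range_domRestrict, h1,
    (Submodule.comapSubtypeEquivOfLe h3).finrank_eq,
    ← (Submodule.equivMapOfInjective μ hμ (piece I n)).finrank_eq] at h4
  rw [hilb, hilb, hilb, ← h4, add_comm]

theorem hilb_zero_eq {I : Ideal (MvPolynomial (Fin v) k)} {θ : MvPolynomial (Fin v) k}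
    (hI : IsGraded I) (hθ : θ ∈ forms k v 1) :
    hilb I 0 = hilb (I ⊔ Ideal.span {θ}) 0 := by
  have h1 : 1 ∈ I ⊔ Ideal.span {θ} → (1 : MvPolynomial (Fin v) k) ∈ I := by
    intro h
    obtain ⟨g, hg, h'⟩ := exists_of_mem_sup_span (n := 0) hI hθ (C_mem_forms 1) h
    rw [eq_zero_of_mem_forms_neg (by norm_num) hg, mul_zero, sub_zero] at h'
    exact h'
  by_cases h : 1 ∈ I
  · rw [Ideal.eq_top_of_isUnit_mem _ h isUnit_one, top_sup_eq]
  · rw [hilb_zero h, hilb_zero (mt h1 h)]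

/-- Passing from `S / I` to `S / (I + (l))` takes differences of Hilbert functions, so the Hilbert
functions of polynomial rings, up to a fixed degree, correspond to each other. -/
theorem IsLinearRegular.hilb_eq_multichoose_iff {I : Ideal (MvPolynomial (Fin v) k)}
    (hI : IsGraded I) {l : List (MvPolynomial (Fin v) k)} (hl : IsLinearRegular I l) (c q : ℕ) :
    (∀ n < q, hilb I n = Nat.multichoose (c + l.length) n) ↔
      ∀ n < q, hilb (I ⊔ Ideal.ofList l) n = Nat.multichoose c n := by
  induction l generalizing I with
  | nil => simp
  | cons θ l ih =>
    obtain ⟨h1, h2, h3⟩ := hl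
    rw [sup_ofList_cons, ← ih (hI.sup (isGraded_span_singleton h1)) h3, List.length_cons]
    constructor
    · intro h n hn
      cases n with
      | zero => rw [← hilb_zero_eq hI h1, h 0 hn, Nat.multichoose_zero_right,
          Nat.multichoose_zero_right]
      | succ n =>
        have e1 := h (n + 1) hn
        rw [hilb_eq_add hI h1 h2, h n (by omega), ← add_assoc, Nat.multichoose_succ_succ] at e1
        omega
    · intro h n hn
      induction n with
      | zero => rw [hilb_zero_eq hI h1, h 0 hn, Nat.multichoose_zero_right,
          Nat.multichoose_zero_right]
      | succ n ihn =>
        rw [hilb_eq_add hI h1 h2, h _ hn, ihn (by omega), ← add_assoc c,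
          Nat.multichoose_succ_succ, add_comm]

theorem hilb_bot (n : ℕ) : hilb (⊥ : Ideal (MvPolynomial (Fin v) k)) n = Nat.multichoose v n := by
  have h := (isLinearRegular_bot_X (k := k) (v := v)).hilb_eq_multichoose_iff isGraded_bot 0 (n + 1)
  rw [bot_sup_ofList_X, zero_add, List.length_map, List.length_finRange] at h
  refine h.2 (fun m _ => ?_) n (by omega)
  cases m with
  | zero => rw [Nat.multichoose_zero_right, hilb_zero (by rw [mem_idealOfVars_iff]; simp)]
  | succ m =>
    rw [Nat.multichoose_zero_succ, hilb_eq_zero_iff]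
    intro f hf
    have := forms_le_pow_idealOfVars (n := 1) (by push_cast; omega) hf
    rwa [pow_one] at this

/-- The Hilbert function of an Artinian reduction below the initial degree. -/
theorem IsLinearRegular.hilb_sup_ofList {I : Ideal (MvPolynomial (Fin v) k)}
    (hI : IsGraded I) {l : List (MvPolynomial (Fin v) k)} (hl : IsLinearRegular I l) {c q : ℕ}
    (hv : v = c + l.length) (hq : ∀ n < q, ∀ f ∈ forms k v (n : ℕ), f ∈ I → f = 0) {n : ℕ}
    (hn : n < q) : hilb (I ⊔ Ideal.ofList l) n = Nat.multichoose c n := by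
  refine (hl.hilb_eq_multichoose_iff hI c q).1 (fun m hm => ?_) n hn
  rw [hilb_eq_hilb_bot (hq m hm), hilb_bot, ← hv]

/-- The partial sums `∑_{m < n} h m` of `h`, summed `j` further times; the shift in the range of
summation matches Hilbert functions modulo linear nonzerodivisors. -/
def hilbSum (h : ℕ → ℕ) : ℕ → ℕ → ℕ
  | 0, n => ∑ m ∈ Finset.range n, h m
  | j + 1, n => ∑ m ∈ Finset.range (n + 1), hilbSum h j m

theorem hilbSum_zero_right (h : ℕ → ℕ) (j : ℕ) : hilbSum h j 0 = 0 := by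
  induction j with
  | zero => simp [hilbSum]
  | succ j ih => simp [hilbSum, ih]

theorem IsLinearRegular.sum_hilb {I : Ideal (MvPolynomial (Fin v) k)}
    (hI : IsGraded I) {l : List (MvPolynomial (Fin v) k)} (hl : IsLinearRegular I l) (n : ℕ) :
    ∑ m ∈ Finset.range n, hilb I m = hilbSum (hilb (I ⊔ Ideal.ofList l)) l.length n := by
  induction l generalizing I n with
  | nil => rw [sup_ofList_nil]; rfl
  | cons θ l ih =>
    obtain ⟨h1, h2, h3⟩ := hl
    rw [sup_ofList_cons, List.length_cons, hilbSum, Finset.sum_range_succ', hilbSum_zero_right,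
      add_zero]
    refine Finset.sum_congr rfl ?_
    rintro m -
    rw [← ih (hI.sup (isGraded_span_singleton h1)) h3, Finset.sum_range_succ']
    clear ih h3
    induction m with
    | zero => rw [Finset.sum_range_zero, zero_add, hilb_zero_eq hI h1]
    | succ m ihm => rw [hilb_eq_add hI h1 h2, ihm, Finset.sum_range_succ]; ring

theorem hilbSum_le {h : ℕ → ℕ} {e : ℕ} (he : ∀ n, ∑ m ∈ Finset.range n, h m ≤ e) (j n : ℕ) :
    hilbSum h j n ≤ e * (n + j).choose j := by
  induction j generalizing n with
  | zero => simpa [hilbSum] using he n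
  | succ j ih =>
    rw [hilbSum, ← add_assoc, ← Nat.sum_range_add_choose, Finset.mul_sum]
    exact Finset.sum_le_sum fun m _ => ih m

theorem le_hilbSum {h : ℕ → ℕ} {e s : ℕ} (he : ∀ n ≥ s, e ≤ ∑ m ∈ Finset.range n, h m) (j n : ℕ) :
    e * n.choose j ≤ hilbSum h j (n + s) := by
  induction j generalizing n with
  | zero => simpa [hilbSum] using he (n + s) (by omega)
  | succ j ih =>
    rw [hilbSum]
    have h1 : n.choose (j + 1) ≤ (n + 1).choose (j + 1) := Nat.choose_le_choose _ (by omega)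
    have h2 : (n + 1).choose (j + 1) = ∑ m ∈ Finset.range (n + 1), m.choose j := by
      rw [← Nat.sum_Icc_choose]
      refine Finset.sum_subset (fun m hm => ?_) fun m _ hm' => ?_
      · rw [Finset.mem_Icc] at hm; rw [Finset.mem_range]; omega
      · refine Nat.choose_eq_zero_of_lt ?_
        rw [Finset.mem_Icc] at hm'
        rename_i hm
        rw [Finset.mem_range] at hm
        omega
    have h3 : n + s + 1 = s + (n + 1) := by ring
    calc e * n.choose (j + 1) ≤ e * ∑ m ∈ Finset.range (n + 1), m.choose j :=
          Nat.mul_le_mul_left _ (h2 ▸ h1)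
      _ ≤ ∑ m ∈ Finset.range (n + 1), hilbSum h j (s + m) := by
          rw [Finset.mul_sum]
          exact Finset.sum_le_sum fun m _ => by rw [add_comm s]; exact ih m
      _ ≤ ∑ m ∈ Finset.range (n + s + 1), hilbSum h j m := by
          have := Finset.sum_range_add (hilbSum h j) s (n + 1)
          rw [h3, this]
          exact Nat.le_add_left _ _

open Filter Topology in
theorem tendsto_choose_div (a b d : ℕ) :
    Tendsto (fun n : ℕ => (d.factorial : ℝ) * ((n + a).choose d : ℝ) / ((n + b : ℕ) : ℝ) ^ d) atTop
      (𝓝 1) := by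
  have h1 : Tendsto (fun n : ℕ => (d.factorial : ℝ) * (n.choose d : ℝ) / (n : ℝ) ^ d) atTop
      (𝓝 1) := by
    have h := (Asymptotics.isEquivalent_iff_tendsto_one ?_).1 (isEquivalent_choose d)
    · refine h.congr fun n => ?_
      rw [Pi.div_apply, div_div_eq_mul_div, mul_comm]
    · filter_upwards [eventually_gt_atTop 0] with n hn
      have : (n : ℝ) ≠ 0 := by positivity
      positivity
  have h2 : Tendsto (fun n : ℕ => ((n + a : ℕ) : ℝ) / ((n + b : ℕ) : ℝ)) atTop (𝓝 1) := by
    have h3 : Tendsto (fun n : ℕ => 1 + ((a : ℝ) - b) / ((n + b : ℕ) : ℝ)) atTop (𝓝 (1 + 0)) := by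
      refine tendsto_const_nhds.add ((tendsto_const_div_atTop_nhds_zero_nat ((a : ℝ) - b)).comp
        (tendsto_add_atTop_nat b))
    rw [add_zero] at h3
    refine h3.congr' ?_
    filter_upwards [eventually_gt_atTop 0] with n hn
    have : ((n + b : ℕ) : ℝ) ≠ 0 := by positivity
    field_simp
    push_cast
    ring
  have h4 := (h1.comp (tendsto_add_atTop_nat a)).mul (h2.pow d)
  rw [one_pow, mul_one] at h4
  refine h4.congr' ?_
  filter_upwards [eventually_gt_atTop 0] with n hn
  have : ((n + a : ℕ) : ℝ) ≠ 0 := by positivity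
  rw [Function.comp_apply, div_pow, div_mul_div_cancel₀]
  positivity

open Filter Topology in
theorem tendsto_hilbSum {h : ℕ → ℕ} {e s : ℕ} (he : ∀ n, ∑ m ∈ Finset.range n, h m ≤ e)
    (he' : ∀ n ≥ s, e ≤ ∑ m ∈ Finset.range n, h m) (d : ℕ) :
    Tendsto (fun n : ℕ => (d.factorial : ℝ) * (hilbSum h d n : ℝ) / (n : ℝ) ^ d) atTop
      (𝓝 (e : ℝ)) := by
  rw [← tendsto_add_atTop_iff_nat s]
  have h1 := (tendsto_choose_div 0 s d).const_mul (e : ℝ)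
  have h2 := (tendsto_choose_div (s + d) s d).const_mul (e : ℝ)
  rw [mul_one] at h1 h2
  refine tendsto_of_tendsto_of_tendsto_of_le_of_le h1 h2 (fun n => ?_) fun n => ?_
  · have : ((e * n.choose d : ℕ) : ℝ) ≤ hilbSum h d (n + s) := by
      exact_mod_cast le_hilbSum he' d n
    rw [Nat.cast_mul] at this
    change (e : ℝ) * (_ / _) ≤ _
    rw [add_zero, ← mul_div_assoc, mul_left_comm]
    gcongr
  · have : (hilbSum h d (n + s) : ℝ) ≤ (e * (n + s + d).choose d : ℕ) := by
      exact_mod_cast hilbSum_le he d (n + s)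
    rw [Nat.cast_mul] at this
    change _ ≤ (e : ℝ) * (_ / _)
    rw [← add_assoc, ← mul_div_assoc, mul_left_comm]
    gcongr

end Hilbert

section Length

/-- If the scalars from the `k`-algebra `R` act on `M` like scalars from `k`, then the length over
`R` is the dimension over `k`. -/
theorem length_eq_finrank_of_forall_exists_smul {k R M : Type*} [Field k] [CommRing R] [Algebra k R]
    [AddCommGroup M] [Module k M] [Module R M] [IsScalarTower k R M] [Module.Finite k M]
    (h : ∀ (r : R) (m : M), ∃ c : k, r • m = c • m) :
    Module.length R M = Module.finrank k M := by
  rw [← Module.length_eq_finrank k M]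
  have e : Submodule R M ≃o Submodule k M :=
    { toFun := fun N => N.restrictScalars k
      invFun := fun N =>
        { N with
          smul_mem' := fun r m hm => by
            obtain ⟨c, hc⟩ := h r m
            rw [hc]
            exact N.smul_mem c hm }
      left_inv := fun N => rfl
      right_inv := fun N => rfl
      map_rel_iff' := Iff.rfl }
  apply WithBot.coe_injective
  rw [Module.coe_length, Module.coe_length, Order.krullDim_eq_of_orderIso e]

variable {k : Type*} [Field k] {v : ℕ}

theorem sub_component_mem_pow {n : ℕ} {f : MvPolynomial (Fin v) k}
    (hf : f ∈ idealOfVars (Fin v) k ^ n) :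
    f - component n f ∈ idealOfVars (Fin v) k ^ (n + 1) := by
  rw [mem_pow_idealOfVars_iff'] at hf ⊢
  intro m hm
  rw [coeff_sub, coeff_component]
  split_ifs with h
  · rw [sub_self]
  · rw [hf m (by omega), sub_zero]

theorem component_eq_zero_of_mem_pow {n : ℕ} {f : MvPolynomial (Fin v) k}
    (hf : f ∈ idealOfVars (Fin v) k ^ (n + 1)) : component (n : ℤ) f = 0 := by
  rw [mem_pow_idealOfVars_iff'] at hf
  ext m
  rw [coeff_component, coeff_zero]
  split_ifs with h
  · exact hf m (by omega)
  · rfl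

theorem mem_irrelevant_pow {I : Ideal (MvPolynomial (Fin v) k)} {n : ℕ}
    {f : MvPolynomial (Fin v) k} :
    Ideal.Quotient.mk I f ∈ irrelevant I ^ n ↔ ∃ g ∈ idealOfVars (Fin v) k ^ n, f - g ∈ I := by
  rw [irrelevant, ← Ideal.map_pow,
    Ideal.mem_map_iff_of_surjective _ Ideal.Quotient.mk_surjective]
  refine exists_congr fun g => and_congr_right fun _ => ?_
  rw [eq_comm, Ideal.Quotient.eq]

theorem length_quotient_irrelevant_pow {I : Ideal (MvPolynomial (Fin v) k)} (hI : IsGraded I)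
    (n : ℕ) :
    Module.length (MvPolynomial (Fin v) k ⧸ I) ((MvPolynomial (Fin v) k ⧸ I) ⧸ irrelevant I ^ n) =
      (∑ m ∈ Finset.range n, hilb I m : ℕ) := by
  induction n with
  | zero =>
    rw [Finset.sum_range_zero, Nat.cast_zero, Module.length_eq_zero_iff]
    exact Submodule.Quotient.subsingleton_iff.2 ((pow_zero (irrelevant I)).trans Ideal.one_eq_top)
  | succ n ih =>
    let A := MvPolynomial (Fin v) k ⧸ I
    have hle : irrelevant I ^ (n + 1) ≤ irrelevant I ^ n := Ideal.pow_le_pow_right (by omega)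
    let g : (A ⧸ irrelevant I ^ (n + 1)) →ₗ[A] (A ⧸ irrelevant I ^ n) :=
      Submodule.mapQ _ _ LinearMap.id hle
    have hg : Function.Surjective g := by
      intro y
      obtain ⟨a, rfl⟩ := Ideal.Quotient.mk_surjective y
      exact ⟨Ideal.Quotient.mk _ a, rfl⟩
    have hker : ∀ f : MvPolynomial (Fin v) k, Ideal.Quotient.mk (irrelevant I ^ (n + 1))
        (Ideal.Quotient.mk I f) ∈ LinearMap.ker g ↔ Ideal.Quotient.mk I f ∈ irrelevant I ^ n :=
      fun f => Ideal.Quotient.eq_zero_iff_mem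
    -- the map from `A_n` to `𝔐 ^ n / 𝔐 ^ (n + 1)`
    let φ : piece I n →ₗ[k] LinearMap.ker g :=
      LinearMap.codRestrict ((LinearMap.ker g).restrictScalars k)
        ((Ideal.Quotient.mkₐ k (irrelevant I ^ (n + 1))).toLinearMap.domRestrict (piece I n))
        (by
          rintro ⟨y, hy⟩
          obtain ⟨f, hf, rfl⟩ := mem_piece.1 hy
          exact (hker f).2
            (mem_irrelevant_pow.2 ⟨f, forms_le_pow_idealOfVars le_rfl hf, by simp⟩))
    have hφb : Function.Bijective φ := by
      constructor
      · rw [injective_iff_map_eq_zero]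
        rintro ⟨y, hy⟩ h0
        obtain ⟨f, hf, rfl⟩ := mem_piece.1 hy
        have h1 : Ideal.Quotient.mk I f ∈ irrelevant I ^ (n + 1) :=
          Ideal.Quotient.eq_zero_iff_mem.1 (congrArg Subtype.val h0)
        obtain ⟨g, hg, hfg⟩ := mem_irrelevant_pow.1 h1
        refine Subtype.ext (Ideal.Quotient.eq_zero_iff_mem.2 ?_)
        have := hI _ hfg n
        rwa [map_sub, component_of_mem hf, component_eq_zero_of_mem_pow hg, sub_zero] at this
      · rintro ⟨y, hy⟩
        obtain ⟨a, rfl⟩ := Ideal.Quotient.mk_surjective y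
        obtain ⟨f, rfl⟩ := Ideal.Quotient.mk_surjective a
        obtain ⟨h, hh, hfh⟩ := mem_irrelevant_pow.1 ((hker f).1 hy)
        refine ⟨⟨Ideal.Quotient.mk I (component n h), mem_piece.2 ⟨_, component_mem _ _, rfl⟩⟩,
          Subtype.ext ?_⟩
        refine (Ideal.Quotient.eq.2 ?_).symm
        change Ideal.Quotient.mk I (f - component n h) ∈ _
        refine mem_irrelevant_pow.2 ⟨_, sub_component_mem_pow hh, ?_⟩
        rwa [sub_sub_sub_cancel_right]
    have hlen : Module.length A (LinearMap.ker g) = hilb I n := by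
      let e := LinearEquiv.ofBijective φ hφb
      have := Module.Finite.equiv e
      rw [hilb, e.finrank_eq]
      refine length_eq_finrank_of_forall_exists_smul ?_
      rintro r ⟨y, hy⟩
      obtain ⟨f, rfl⟩ := Ideal.Quotient.mk_surjective r
      obtain ⟨a, rfl⟩ := Ideal.Quotient.mk_surjective y
      obtain ⟨h, rfl⟩ := Ideal.Quotient.mk_surjective a
      refine ⟨coeff 0 f, Subtype.ext ?_⟩
      change Ideal.Quotient.mk _ (Ideal.Quotient.mk I (f * h)) =
        Ideal.Quotient.mk _ (Ideal.Quotient.mk I (coeff 0 f • h))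
      rw [Ideal.Quotient.eq, ← map_sub, smul_eq_C_mul, ← sub_mul, map_mul]
      have hp : irrelevant I ^ (n + 1) = irrelevant I * irrelevant I ^ n := pow_succ' (irrelevant I) n
      rw [hp]
      refine Ideal.mul_mem_mul (Ideal.mem_map_of_mem _ ?_) ((hker h).1 hy)
      rw [mem_idealOfVars_iff, coeff_sub, coeff_zero_C, sub_self]
    rw [Module.length_eq_add_of_exact (LinearMap.ker g).subtype g (Submodule.subtype_injective _) hg
      (LinearMap.exact_subtype_ker_map g), ih, hlen, Finset.sum_range_succ, Nat.cast_add, add_comm]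

/-- The multiplicity is the length of an Artinian reduction by linear forms. -/
theorem IsLinearRegular.isMultiplicity {I : Ideal (MvPolynomial (Fin v) k)} (hI : IsGraded I)
    {l : List (MvPolynomial (Fin v) k)} (hl : IsLinearRegular I l)
    (hdim : ringKrullDim (MvPolynomial (Fin v) k ⧸ I) = l.length) {s : ℕ}
    (hJ : ∀ n : ℕ, s ≤ n → hilb (I ⊔ Ideal.ofList l) n = 0) :
    IsMultiplicity (irrelevant I) (∑ n ∈ Finset.range s, hilb (I ⊔ Ideal.ofList l) n) := by
  have he : ∀ n ≥ s, ∑ m ∈ Finset.range n, hilb (I ⊔ Ideal.ofList l) m =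
      ∑ m ∈ Finset.range s, hilb (I ⊔ Ideal.ofList l) m := by
    intro n hn
    refine (Finset.sum_subset (Finset.range_mono hn) fun m _ hm => hJ m ?_).symm
    simpa using hm
  refine ⟨l.length, hdim, fun n => ?_, ?_⟩
  · rw [← Module.length_ne_top_iff, length_quotient_irrelevant_pow hI]
    exact ENat.natCast_ne_top _
  · simp_rw [length_quotient_irrelevant_pow hI, ENat.toNat_natCast, hl.sum_hilb hI]
    refine tendsto_hilbSum (s := s) (fun n => ?_) (fun n hn => (he n hn).ge) _
    rcases le_total n s with h | h
    · exact Finset.sum_le_sum_of_subset (Finset.range_mono h)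
    · exact (he n h).le

end Length

/-! ### Depth and generic linear forms -/

section Depth

variable {v : ℕ}

/-- The ungraded situation: a nonzerodivisor in the ideal generated by `x`. -/
theorem linearQuotient_top {R M M'' : Type*} [CommRing R] [AddCommGroup M] [Module R M]
    [AddCommGroup M''] [Module R M''] {x a : Fin v → R} (β : M →ₗ[R] M'')
    (h : IsSMulRegular M (∑ i, a i * x i)) (hβ : Function.Surjective β)
    (hker : ∀ y, β y = 0 ↔ ∃ z, (∑ i, a i * x i) • z = y) :
    LinearQuotient x (fun _ => ⊤) (fun _ => ⊤) a β where
  shortExact :=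
    { graded := fun _ _ _ _ => AddSubgroup.mem_top _
      left_mem := fun _ _ _ => AddSubgroup.mem_top _
      right_mem := fun _ _ _ => AddSubgroup.mem_top _
      injective := h
      right_left := fun y => (hker _).2 ⟨y, rfl⟩
      exact := fun _ y _ h0 => by
        obtain ⟨z, hz⟩ := (hker y).1 h0
        exact ⟨z, AddSubgroup.mem_top _, hz⟩
      surjective := fun _ z _ => by
        obtain ⟨y, hy⟩ := hβ z
        exact ⟨y, AddSubgroup.mem_top _, hy⟩ }
  smul_mem := fun _ _ _ _ => AddSubgroup.mem_top _

open scoped Pointwise in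
/-- The Koszul complex is exact in the first spots if the ideal generated by `x` contains a weakly
regular sequence. -/
theorem koszulExact_of_isWeaklyRegular {R : Type*} [CommRing R] {x : Fin v → R} (rs : List R)
    (hx : ∀ r ∈ rs, r ∈ Ideal.span (Set.range x)) {M : Type*} [AddCommGroup M] [Module R M]
    (h : RingTheory.Sequence.IsWeaklyRegular M rs) {p : ℤ} (hp : p < rs.length) (n : ℤ) :
    KoszulExact x (fun _ => (⊤ : AddSubgroup M)) p n := by
  induction rs generalizing M p n with
  | nil => exact koszulExact_of_neg (by simpa using hp)
  | cons r rs ih =>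
    rw [RingTheory.Sequence.isWeaklyRegular_cons_iff] at h
    obtain ⟨a, rfl⟩ := Ideal.mem_span_range_iff_exists_fun.1 (hx r (by simp))
    have hq := linearQuotient_top (x := x) (Submodule.mkQ ((∑ i, a i * x i) • (⊤ : Submodule R M)))
      h.1 (Submodule.mkQ_surjective _) fun y => by
        rw [← LinearMap.mem_ker, Submodule.ker_mkQ, Submodule.mem_smul_pointwise_iff_exists]
        simp
    have := hq.koszulExact_pred (p := p) (n := n + 1) (ih (fun r hr => hx r (by simp [hr])) h.2
      (by rw [List.length_cons] at hp; push_cast at hp; omega) _)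
    rwa [add_sub_cancel_right] at this

variable {k : Type*} [Field k]

/-- The depth of `S / I` with respect to `(X_1, …, X_v)` is at least `m`, in terms of the Koszul
complex. -/
def DepthGE (I : Ideal (MvPolynomial (Fin v) k)) (m : ℕ) : Prop :=
  ∀ p < (m : ℤ), ∀ n, KoszulExact (vars k v)
    (fun _ => (⊤ : AddSubgroup (MvPolynomial (Fin v) k ⧸ I))) p n

theorem DepthGE.mono {I : Ideal (MvPolynomial (Fin v) k)} {m m' : ℕ} (h : DepthGE I m)
    (hm : m' ≤ m) : DepthGE I m' := fun p hp n => h p (by omega) n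

theorem DepthGE.quotient {I : Ideal (MvPolynomial (Fin v) k)} {m : ℕ} (h : DepthGE I (m + 1))
    {θ : MvPolynomial (Fin v) k} (hθ : θ ∈ forms k v 1) (hreg : IsRegularMod I θ) :
    DepthGE (I ⊔ Ideal.span {θ}) m := by
  obtain ⟨a, rfl⟩ := exists_linForm hθ
  intro p hp n
  have hq := linearQuotient_top (x := vars k v) (a := fun i => C (a i))
    (quotientMap (I' := I ⊔ Ideal.span {linForm a}) (le_sup_left : I ≤ _))
    (smul_injective_of_isRegularMod hreg) (fun z => by
      obtain ⟨f, rfl⟩ := Ideal.Quotient.mk_surjective z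
      exact ⟨Ideal.Quotient.mk I f, rfl⟩) fun y => by
      obtain ⟨f, rfl⟩ := Ideal.Quotient.mk_surjective y
      constructor
      · intro h0
        have h0 : f ∈ I ⊔ Ideal.span {linForm a} := Ideal.Quotient.eq_zero_iff_mem.1 h0
        obtain ⟨b, hb, c, hc, rfl⟩ := Submodule.mem_sup.1 h0
        obtain ⟨g, rfl⟩ := Ideal.mem_span_singleton'.1 hc
        refine ⟨Ideal.Quotient.mk I g, Ideal.Quotient.eq.2 ?_⟩
        have : linForm a * g - (b + g * linForm a) = -b := by ring
        change linForm a * g - (b + g * linForm a) ∈ I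
        rw [this]
        exact neg_mem hb
      · rintro ⟨z, hz⟩
        obtain ⟨g, rfl⟩ := Ideal.Quotient.mk_surjective z
        rw [← hz]
        change Ideal.Quotient.mk (I ⊔ Ideal.span {linForm a}) (linForm a * g) = 0
        rw [Ideal.Quotient.eq_zero_iff_mem]
        exact Ideal.mul_mem_right _ _ (Ideal.mem_sup_right (Ideal.mem_span_singleton_self _))
  exact hq.koszulExact_quotient (h p (by omega) n) (h (p + 1) (by push_cast; omega) (n - 1))

/-- In positive depth no nonzero element of `S / I` is annihilated by the variables. -/
theorem DepthGE.mem_of_forall_X_mul_mem {I : Ideal (MvPolynomial (Fin v) k)} {m : ℕ}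
    (h : DepthGE I (m + 1)) {f : MvPolynomial (Fin v) k} (hf : ∀ i, X i * f ∈ I) : f ∈ I := by
  classical
  let c : Finset (Fin v) → MvPolynomial (Fin v) k ⧸ I := Pi.single ∅ (Ideal.Quotient.mk I f)
  obtain ⟨b, hb, hDb⟩ := h 0 (by push_cast; omega) 0 c
    (mem_cubeCochains_of (fun _ _ => AddSubgroup.mem_top _) fun s hs =>
      Pi.single_eq_of_ne (by rintro rfl; simp at hs) _) (by
    ext t
    rw [koszulD_apply, Pi.zero_apply]
    refine Finset.sum_eq_zero fun j hj => ?_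
    by_cases ht : t.erase j = ∅
    · have : vars k v j • c (t.erase j) = 0 := by
        rw [ht]
        change X j • Pi.single (M := fun _ => MvPolynomial (Fin v) k ⧸ I) ∅ _ ∅ = _
        rw [Pi.single_eq_same, smul_mk]
        exact Ideal.Quotient.eq_zero_iff_mem.2 (hf j)
      rw [this, smul_zero]
    · have : c (t.erase j) = 0 := Pi.single_eq_of_ne ht _
      rw [this, smul_zero, smul_zero])
  have hb0 : b = 0 := by
    ext s
    exact (hb s).2 (by omega)
  rw [hb0, map_zero] at hDb
  have := congrFun hDb ∅
  rw [Pi.zero_apply] at this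
  change 0 = Pi.single (M := fun _ => MvPolynomial (Fin v) k ⧸ I) ∅ _ ∅ at this
  rw [Pi.single_eq_same] at this
  exact Ideal.Quotient.eq_zero_iff_mem.1 this.symm

/-- A generic linear form of a family `W` avoids finitely many primes that do not contain `W`. -/
theorem exists_linForm_notMem [Infinite k] (W : Submodule k (Fin v → k))
    {s : Set (Ideal (MvPolynomial (Fin v) k))} (hs : s.Finite)
    (h : ∀ P ∈ s, ∃ w ∈ W, linForm w ∉ P) : ∃ w ∈ W, ∀ P ∈ s, linForm w ∉ P := by
  let U : Ideal (MvPolynomial (Fin v) k) → Submodule k W := fun P =>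
    { carrier := {a | linForm a.1 ∈ P}
      zero_mem' := by simp [linForm]
      add_mem' := fun ha hb => by
        change linForm (_ + _) ∈ P
        rw [linForm_add]
        exact add_mem ha hb
      smul_mem' := fun r a ha => by
        change linForm (r • _) ∈ P
        rw [linForm_smul]
        exact Ideal.mul_mem_left _ _ ha }
  have hfin : (U '' s).Finite := hs.image U
  have := Subspace.biUnion_ne_univ_of_top_notMem (s := hfin.toFinset) (fun hU => by
    obtain ⟨P, hP, hPU⟩ := hfin.mem_toFinset.1 hU
    obtain ⟨w, hw, hwP⟩ := h P hP
    have h1 : (⟨w, hw⟩ : W) ∈ U P := hPU ▸ Submodule.mem_top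
    exact hwP h1)
  obtain ⟨a, ha⟩ := (Set.ne_univ_iff_exists_notMem _).1 this
  refine ⟨a, a.2, fun P hP hmem => ha ?_⟩
  exact Set.mem_biUnion (hfin.mem_toFinset.2 ⟨P, hP, rfl⟩) (show a ∈ U P from hmem)

/-- In positive depth a generic linear form is a nonzerodivisor; it can be taken from any family
that generates an ideal primary to `(X_1, …, X_v)` modulo `I`. -/
theorem DepthGE.exists_isRegularMod [Infinite k] {I : Ideal (MvPolynomial (Fin v) k)} {m : ℕ}
    (h : DepthGE I (m + 1)) (W : Submodule k (Fin v → k))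
    (hW : ∀ P : Ideal (MvPolynomial (Fin v) k), P.IsPrime → I ≤ P → (∀ w ∈ W, linForm w ∈ P) →
      ∀ i, X i ∈ P) : ∃ w ∈ W, IsRegularMod I (linForm w) := by
  obtain ⟨w, hw, hP⟩ := exists_linForm_notMem W
    (associatedPrimes.finite (MvPolynomial (Fin v) k) (MvPolynomial (Fin v) k ⧸ I)) fun P hP => by
      rw [AssociatedPrimes.mem_iff, isAssociatedPrime_iff] at hP
      obtain ⟨hprime, y, hy⟩ := hP
      obtain ⟨f, rfl⟩ := Ideal.Quotient.mk_surjective y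
      have hmem : ∀ g, g ∈ P ↔ g * f ∈ I := fun g => by
        rw [hy, Submodule.mem_colon_singleton, Submodule.mem_bot]
        exact Ideal.Quotient.eq_zero_iff_mem
      by_contra! hX
      have hX := hW P hprime (fun g hg => (hmem g).2 (Ideal.mul_mem_right _ _ hg)) hX
      refine hprime.ne_top ((Ideal.eq_top_iff_one P).2 ((hmem 1).2 ?_))
      rw [one_mul]
      exact h.mem_of_forall_X_mul_mem fun i => (hmem _).1 (hX i)
  refine ⟨w, hw, fun f hf => ?_⟩
  by_contra hfI
  have hz : linForm w ∈ { r : MvPolynomial (Fin v) k | ∃ x : MvPolynomial (Fin v) k ⧸ I,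
      x ≠ 0 ∧ r • x = 0 } :=
    ⟨Ideal.Quotient.mk I f, fun h0 => hfI (Ideal.Quotient.eq_zero_iff_mem.1 h0),
      Ideal.Quotient.eq_zero_iff_mem.2 hf⟩
  rw [← biUnion_associatedPrimes_eq_zero_divisors] at hz
  obtain ⟨P, hP', hθP⟩ := Set.mem_iUnion₂.1 hz
  exact hP P hP' hθP

theorem DepthGE.exists_isLinearRegular [Infinite k] {I : Ideal (MvPolynomial (Fin v) k)} {m : ℕ}
    (h : DepthGE I m) : ∃ l, l.length = m ∧ IsLinearRegular I l := by
  induction m generalizing I with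
  | zero => exact ⟨[], rfl, trivial⟩
  | succ m ih =>
    obtain ⟨w, -, hreg⟩ := h.exists_isRegularMod ⊤ fun P _ _ hP i => by
      rw [← linForm_single]
      exact hP _ Submodule.mem_top
    obtain ⟨l, hl, hlr⟩ := ih (h.quotient (linForm_mem w) hreg)
    exact ⟨linForm w :: l, by rw [List.length_cons, hl], linForm_mem w, hreg, hlr⟩

/-- The depth of the localization at the homogeneous maximal ideal is the homogeneous depth. -/
theorem depthGE_of_isWeaklyRegular {I : Ideal (MvPolynomial (Fin v) k)} [(irrelevant I).IsPrime]
    (rs : List (Localization.AtPrime (irrelevant I)))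
    (hmax : ∀ r ∈ rs, r ∈ IsLocalRing.maximalIdeal (Localization.AtPrime (irrelevant I)))
    (h : RingTheory.Sequence.IsWeaklyRegular (Localization.AtPrime (irrelevant I)) rs) :
    DepthGE I rs.length := by
  let L := Localization.AtPrime (irrelevant I)
  let A := MvPolynomial (Fin v) k ⧸ I
  let x : Fin v → L := fun i => algebraMap A L (Ideal.Quotient.mk I (X i))
  have hspan : IsLocalRing.maximalIdeal L = Ideal.span (Set.range x) := by
    rw [← Localization.AtPrime.map_eq_maximalIdeal]
    change Ideal.map _ (Ideal.map _ (Ideal.span _)) = _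
    rw [Ideal.map_span, Ideal.map_span, ← Set.range_comp, ← Set.range_comp]
    rfl
  have hexact := fun p (hp : p < (rs.length : ℤ)) => koszulExact_of_isWeaklyRegular (x := x) rs
    (fun r hr => hspan ▸ hmax r hr) h hp 0
  intro p hp n c hc hD
  have hφ : ∀ (b : Finset (Fin v) → A) (t : Finset (Fin v)),
      koszulD x L (fun s => algebraMap A L (b s)) t = algebraMap A L (koszulD (vars k v) A b t) := by
    intro b t
    rw [koszulD_apply, koszulD_apply, map_sum]
    refine Finset.sum_congr rfl fun j _ => ?_
    rw [map_zsmul]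
    congr 1
    exact (map_mul (algebraMap A L) _ _).symm
  obtain ⟨b, hb, hDb⟩ := hexact p hp (fun s => algebraMap A L (c s))
    (mem_cubeCochains_of (fun _ _ => AddSubgroup.mem_top _) fun s hs => by
      rw [(hc s).2 hs, map_zero]) (by
    ext t
    rw [hφ, hD, Pi.zero_apply, map_zero, Pi.zero_apply])
  -- clear the denominators of `b`
  obtain ⟨u, hu⟩ := IsLocalization.exist_integer_multiples_of_finite
    (irrelevant I).primeCompl b
  choose b' hb' using hu
  have h1 : ∀ t, ∃ w : (irrelevant I).primeCompl, (w : A) *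
      (koszulD (vars k v) A (fun s => if (s.card : ℤ) = p - 1 then b' s else 0) t -
        (u : A) * c t) = 0 := by
    intro t
    have h2 : algebraMap A L
        (koszulD (vars k v) A (fun s => if (s.card : ℤ) = p - 1 then b' s else 0) t) =
          algebraMap A L ((u : A) * c t) := by
      rw [← hφ, map_mul]
      have h3 : (fun s : Finset (Fin v) =>
          algebraMap A L (if (s.card : ℤ) = p - 1 then b' s else 0)) =
            algebraMap A L (u : A) • b := by
        ext s
        rw [Pi.smul_apply, smul_eq_mul]
        split_ifs with hs
        · rw [hb', Algebra.smul_def]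
        · rw [(hb s).2 hs, mul_zero, map_zero]
      rw [h3, koszulD_smul, hDb]
      rfl
    obtain ⟨w, hw⟩ := (IsLocalization.eq_iff_exists (irrelevant I).primeCompl L).1 h2
    exact ⟨w, by rw [mul_sub, hw, sub_self]⟩
  choose w hw using h1
  let z : (irrelevant I).primeCompl := (∏ t, w t) * u
  obtain ⟨g, hg⟩ := Ideal.Quotient.mk_surjective (z : A)
  obtain ⟨e, he⟩ := Ideal.Quotient.mk_surjective (∏ t, (w t : A))
  have hcob : koszulD (vars k v) A
      (e • fun s : Finset (Fin v) => if (s.card : ℤ) = p - 1 then b' s else 0) = g • c := by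
    rw [koszulD_smul]
    ext t
    have h4 : (∏ t, (w t : A)) *
        (koszulD (vars k v) A (fun s => if (s.card : ℤ) = p - 1 then b' s else 0) t -
          (u : A) * c t) = 0 := by
      obtain ⟨y, hy⟩ := Finset.dvd_prod_of_mem (fun t => (w t : A)) (Finset.mem_univ t)
      rw [hy, mul_right_comm, hw, zero_mul]
    rw [mul_sub, sub_eq_zero, ← mul_assoc] at h4
    have hz : (z : A) = (∏ t, (w t : A)) * u := by simp [z]
    rw [← hz, ← hg, ← he] at h4
    exact h4
  have hg0 : coeff 0 g ≠ 0 := by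
    intro h0
    refine z.2 ?_
    rw [← hg]
    exact Ideal.mem_map_of_mem _ (mem_idealOfVars_iff.2 h0)
  -- a polynomial with nonzero constant term acts invertibly on the Koszul cohomology
  obtain ⟨a, ha⟩ := Ideal.mem_span_range_iff_exists_fun.1
    (mem_idealOfVars_iff.2 (show coeff 0 (g - C (coeff 0 g)) = 0 by simp))
  obtain ⟨y, hy, hDy⟩ := koszul_smul_exists (n := n - 1) hc hD a
    (fun _ _ _ _ => AddSubgroup.mem_top _)
  refine ⟨(C (coeff 0 g)⁻¹ : MvPolynomial (Fin v) k) • ((e • fun s : Finset (Fin v) =>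
    if (s.card : ℤ) = p - 1 then b' s else 0) - y),
    mem_cubeCochains_of (fun _ _ => AddSubgroup.mem_top _) fun s hs => ?_, ?_⟩
  · rw [Pi.smul_apply, Pi.sub_apply, (hy s).2 hs, Pi.smul_apply, if_neg hs, smul_zero, sub_zero,
      smul_zero]
  · rw [koszulD_smul, map_sub, hcob, hDy, ha, ← sub_smul, sub_sub_cancel, smul_smul, ← C_mul,
      inv_mul_cancel₀ hg0, C_1, one_smul]

end Depth

/-! ### Dimension -/

section Dimension

/-- A ring that is generated, as a module over `R`, by a finite set `G` has dimension at most
that of `R`, by incomparability. -/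
theorem ringKrullDim_le_of_finite {R B : Type*} [CommRing R] [CommRing B] (φ : R →+* B) {G : Set B}
    (hG : G.Finite)
    (h : ∀ W : AddSubgroup B, G ⊆ W → (∀ r, ∀ y ∈ W, φ r * y ∈ W) → ∀ y, y ∈ W) :
    ringKrullDim B ≤ ringKrullDim R := by
  algebraize [φ]
  have hfin : Module.Finite R B := by
    refine ⟨Submodule.fg_def.2 ⟨G, hG, ?_⟩⟩
    rw [eq_top_iff]
    rintro y -
    refine h (Submodule.span R G).toAddSubgroup Submodule.subset_span (fun r y hy => ?_) y
    have := Submodule.smul_mem (Submodule.span R G) r hy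
    rwa [Algebra.smul_def] at this
  refine Order.krullDim_le_of_strictMono (PrimeSpectrum.comap (algebraMap R B)) fun P Q hPQ => ?_
  obtain ⟨x, hxQ, hxP⟩ := SetLike.exists_of_lt (show P.asIdeal < Q.asIdeal from hPQ)
  exact Ideal.comap_lt_comap_of_integral_mem_sdiff (show P.asIdeal ≤ Q.asIdeal from hPQ.le)
    ⟨hxQ, hxP⟩ (Algebra.IsIntegral.isIntegral x)

variable {k : Type*} [Field k] {v : ℕ}

theorem ofList_eq_span_range_get (l : List (MvPolynomial (Fin v) k)) :
    Ideal.ofList l = Ideal.span (Set.range l.get) := by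
  rw [Ideal.ofList, Set.range_list_get]

/-- If the forms of large degree lie in `I + (l)`, then `S / I` is finite over the polynomial ring
that maps its variables to the entries of `l`. -/
theorem ringKrullDim_le_length {I : Ideal (MvPolynomial (Fin v) k)} (hI : IsGraded I)
    {l : List (MvPolynomial (Fin v) k)} (hl : ∀ θ ∈ l, θ ∈ forms k v 1) {N : ℕ}
    (hN : ∀ n : ℕ, N ≤ n → ∀ f ∈ forms k v n, f ∈ I ⊔ Ideal.ofList l) :
    ringKrullDim (MvPolynomial (Fin v) k ⧸ I) ≤ l.length := by
  let φ : MvPolynomial (Fin l.length) k →+* MvPolynomial (Fin v) k ⧸ I :=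
    eval₂Hom ((Ideal.Quotient.mk I).comp C) fun j => Ideal.Quotient.mk I (l.get j)
  have hφX : ∀ j, φ (X j) = Ideal.Quotient.mk I (l.get j) := fun j => eval₂Hom_X' _ _ j
  have hφC : ∀ a, φ (C a) = Ideal.Quotient.mk I (C a) := fun a => eval₂Hom_C _ _ a
  let G : Set (MvPolynomial (Fin v) k ⧸ I) :=
    (fun m : Fin v →₀ ℕ => Ideal.Quotient.mk I (monomial m 1)) '' {m | m.degree < N}
  have hdim := ringKrullDim_le_of_finite φ (G := G) ((Finsupp.finite_of_degree_lt N).image _) ?_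
  · rwa [MvPolynomial.ringKrullDim_of_isNoetherianRing, ringKrullDim_eq_zero_of_field, zero_add,
      Nat.card_fin] at hdim
  intro W hGW hW
  have key : ∀ n : ℕ, ∀ f ∈ forms k v n, Ideal.Quotient.mk I f ∈ W := by
    intro n
    induction n using Nat.strong_induction_on with
    | _ n ih =>
    intro f hf
    by_cases hn : n < N
    · rw [f.as_sum, map_sum]
      refine sum_mem fun m hm => ?_
      have h2 : (monomial m (coeff m f) : MvPolynomial (Fin v) k) =
          C (coeff m f) * monomial m 1 := by rw [C_mul_monomial, mul_one]
      rw [h2, map_mul, ← hφC]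
      refine hW _ _ (hGW ⟨m, ?_, rfl⟩)
      have := hf m (mem_support_iff.1 hm)
      change m.degree < N
      omega
    · obtain ⟨a, ha, b, hb, hab⟩ := Submodule.mem_sup.1 (hN n (by omega) f hf)
      rw [ofList_eq_span_range_get, Ideal.mem_span_range_iff_exists_fun] at hb
      obtain ⟨g, rfl⟩ := hb
      rw [← component_of_mem hf, ← hab, map_add, map_add,
        Ideal.Quotient.eq_zero_iff_mem.2 (hI a ha _), zero_add, map_sum, map_sum]
      refine sum_mem fun j _ => ?_
      rw [mul_comm, component_mul n (hl _ (l.get_mem j)), map_mul, ← hφX]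
      refine hW _ _ ?_
      rcases Nat.eq_zero_or_pos n with rfl | hpos
      · rw [eq_zero_of_mem_forms_neg (by norm_num) (component_mem _ (g j)), map_zero]
        exact zero_mem _
      · refine ih (n - 1) (by omega) _ ?_
        rw [Nat.cast_sub (by omega), Nat.cast_one]
        exact component_mem _ _
  intro y
  obtain ⟨f, rfl⟩ := Ideal.Quotient.mk_surjective y
  rw [exists_sum_component f, map_sum]
  exact sum_mem fun i _ => key i _ (component_mem _ _)

instance isPrime_idealOfVars : (idealOfVars (Fin v) k).IsPrime := by
  have : idealOfVars (Fin v) k = RingHom.ker (constantCoeff (R := k) (σ := Fin v)) := by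
    ext f
    rw [mem_idealOfVars_iff, RingHom.mem_ker, constantCoeff_eq]
  rw [this]
  exact RingHom.ker_isPrime _

theorem IsGraded.le_idealOfVars {I : Ideal (MvPolynomial (Fin v) k)} (hI : IsGraded I)
    (h : I ≠ ⊤) : I ≤ idealOfVars (Fin v) k := by
  intro f hf
  rw [mem_idealOfVars_iff]
  by_contra h0
  refine h (Ideal.eq_top_of_isUnit_mem I (hI f hf 0) ?_)
  have : component 0 f = C (coeff 0 f) := by
    ext m
    rw [coeff_component, coeff_C]
    by_cases hm : m = 0
    · simp [hm]
    · rw [if_neg, if_neg (Ne.symm hm)]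
      rwa [Nat.cast_eq_zero, Finsupp.degree_eq_zero_iff]
  rw [this]
  exact (Ne.isUnit h0).map C

/-- Below a prime that contains a regular sequence modulo `I` there is a chain of primes containing
`I` of the length of the sequence. -/
theorem IsLinearRegular.exists_ltSeries {I : Ideal (MvPolynomial (Fin v) k)}
    {l : List (MvPolynomial (Fin v) k)} (hl : IsLinearRegular I l)
    (P : PrimeSpectrum (MvPolynomial (Fin v) k)) (hP : I ⊔ Ideal.ofList l ≤ P.asIdeal) :
    ∃ c : LTSeries (PrimeSpectrum.zeroLocus (R := MvPolynomial (Fin v) k) I),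
      c.length = l.length ∧ c.last.1 = P := by
  induction l generalizing I with
  | nil =>
    rw [sup_ofList_nil] at hP
    exact ⟨RelSeries.singleton _ ⟨P, hP⟩, rfl, rfl⟩
  | cons θ l ih =>
    obtain ⟨-, h2, h3⟩ := hl
    rw [sup_ofList_cons] at hP
    obtain ⟨c, hc, hcP⟩ := ih h3 hP
    let ι : PrimeSpectrum.zeroLocus (R := MvPolynomial (Fin v) k) (I ⊔ Ideal.span {θ} : Ideal _) →
        PrimeSpectrum.zeroLocus (R := MvPolynomial (Fin v) k) I :=
      fun Q => ⟨Q.1, fun _ hx => Q.2 (Ideal.mem_sup_left hx)⟩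
    have hι : StrictMono ι := fun _ _ h => h
    obtain ⟨Q, hQ, hQc⟩ := Ideal.exists_minimalPrimes_le
      (show I ≤ c.head.1.asIdeal from fun _ hx => c.head.2 (Ideal.mem_sup_left hx))
    have hθ : θ ∉ Q := fun hθ => by
      obtain ⟨y, hy, hy'⟩ := Ideal.exists_mul_mem_of_mem_minimalPrimes hQ hθ
      exact hy (h2 y hy')
    have hlt : Q < c.head.1.asIdeal := by
      refine lt_of_le_of_ne hQc fun h => hθ ?_
      rw [h]
      exact c.head.2 (Ideal.mem_sup_right (Ideal.mem_span_singleton_self θ))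
    let Q' : PrimeSpectrum.zeroLocus (R := MvPolynomial (Fin v) k) I :=
      ⟨⟨Q, hQ.isPrime⟩, fun _ hx => hQ.le hx⟩
    have hrel : Q' < (c.map ι hι).head := hlt
    refine ⟨(c.map ι hι).cons Q' hrel, ?_, ?_⟩
    · rw [RelSeries.cons_length, LTSeries.map_length, hc, List.length_cons]
    · rw [RelSeries.last_cons]
      exact hcP

theorem height_irrelevant {I : Ideal (MvPolynomial (Fin v) k)} (h : I ≤ idealOfVars (Fin v) k) :
    (irrelevant I).height = Order.height (⟨⟨idealOfVars (Fin v) k, isPrime_idealOfVars⟩, h⟩ :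
      PrimeSpectrum.zeroLocus (R := MvPolynomial (Fin v) k) I) := by
  have hP : (irrelevant I).IsPrime := Ideal.isPrime_map_quotientMk_of_isPrime h
  rw [← Order.height_orderIso I.primeSpectrumQuotientOrderIsoZeroLocus.symm,
    ← PrimeSpectrum.height_eq_orderHeight]
  congr 1

attribute [local instance] MvPolynomial.gradedAlgebra in
/-- A maximal regular sequence of linear forms in a Cohen–Macaulay ring generates an ideal that is
primary to the homogeneous maximal ideal: a smaller homogeneous prime would lie on top of too long a
chain. -/
theorem IsLinearRegular.exists_forall_forms_le {I : Ideal (MvPolynomial (Fin v) k)}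
    (hI : IsGraded I) (hm : I ≤ idealOfVars (Fin v) k) {l : List (MvPolynomial (Fin v) k)}
    (hl : IsLinearRegular I l) (hh : (irrelevant I).height = l.length) :
    ∃ N : ℕ, ∀ n : ℕ, N ≤ n → ∀ f ∈ forms k v n, f ∈ I ⊔ Ideal.ofList l := by
  have hJ := isGraded_sup_ofList hI l hl.mem_forms
  have hrad : idealOfVars (Fin v) k ≤ (I ⊔ Ideal.ofList l).radical := by
    rw [hJ.isGradedIdeal.radical_eq]
    refine le_sInf ?_
    rintro P ⟨hPh, hJP, hP⟩
    have hPm : P ≤ idealOfVars (Fin v) k := (IsGradedIdeal.isGraded hPh).le_idealOfVars hP.ne_top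
    by_contra hlt
    obtain ⟨c, hc, hcP⟩ := hl.exists_ltSeries ⟨P, hP⟩ hJP
    let M : PrimeSpectrum.zeroLocus (R := MvPolynomial (Fin v) k) I :=
      ⟨⟨idealOfVars (Fin v) k, isPrime_idealOfVars⟩, hm⟩
    have hcM : c.last < M := by
      change c.last.1 < M.1
      rw [hcP]
      exact lt_of_le_not_ge hPm hlt
    have h1 := Order.length_le_height (p := c.snoc M hcM) (x := M) (by rw [RelSeries.last_snoc])
    rw [← height_irrelevant hm, hh, RelSeries.snoc_length, hc] at h1
    have : l.length + 1 ≤ l.length := by exact_mod_cast h1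
    omega
  obtain ⟨N, hN⟩ := Ideal.exists_pow_le_of_le_radical_of_fg hrad
    (IsNoetherian.noetherian (idealOfVars (Fin v) k))
  exact ⟨N, fun n hn f hf => hN (forms_le_pow_idealOfVars (by exact_mod_cast hn) hf)⟩

end Dimension

/-! ### Linear systems of parameters -/

section Parameters

variable {k : Type*} [Field k] {v : ℕ}

/-- The ideal generated by the linear forms with coefficients in `W`. -/
def linSpan (W : Submodule k (Fin v → k)) : Ideal (MvPolynomial (Fin v) k) :=
  Ideal.span (linForm '' (W : Set (Fin v → k)))

theorem linSpan_span (s : Set (Fin v → k)) :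
    linSpan (Submodule.span k s) = Ideal.span (linForm '' s) := by
  refine le_antisymm (Ideal.span_le.2 ?_) (Ideal.span_mono (Set.image_mono Submodule.subset_span))
  rintro _ ⟨w, hw, rfl⟩
  induction hw using Submodule.span_induction with
  | mem w hw => exact Ideal.subset_span ⟨w, hw, rfl⟩
  | zero => simp [linForm]
  | add a b _ _ ha hb => rw [linForm_add]; exact add_mem ha hb
  | smul r a _ ha => rw [linForm_smul]; exact Ideal.mul_mem_left _ _ ha

theorem linSpan_sup (W W' : Submodule k (Fin v → k)) :
    linSpan (W ⊔ W') = linSpan W ⊔ linSpan W' := by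
  have : W ⊔ W' = Submodule.span k ((W : Set (Fin v → k)) ∪ W') := by
    rw [Submodule.span_union, Submodule.span_eq, Submodule.span_eq]
  rw [this, linSpan_span, Set.image_union, Ideal.span_union]
  rfl

/-- If `S / I` has sufficient depth, then a system of parameters in a space `W` of linear forms can
be replaced by a regular sequence in `W` generating the same ideal. -/
theorem DepthGE.exists_isLinearRegular_eq_linSpan [Infinite k]
    {I : Ideal (MvPolynomial (Fin v) k)} (hI : I ≤ idealOfVars (Fin v) k) {n : ℕ}
    (h : DepthGE I n) (W : Submodule k (Fin v → k)) (hn : Module.finrank k W = n)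
    (hW : ∀ P : Ideal (MvPolynomial (Fin v) k), P.IsPrime → I ⊔ linSpan W ≤ P → ∀ i, X i ∈ P) :
    ∃ l, l.length = n ∧ IsLinearRegular I l ∧ I ⊔ Ideal.ofList l = I ⊔ linSpan W := by
  induction n generalizing I W with
  | zero =>
    rw [Submodule.finrank_eq_zero] at hn
    refine ⟨[], rfl, trivial, ?_⟩
    rw [hn, Ideal.ofList_nil]
    congr 1
    simp [linSpan, linForm]
  | succ n ih =>
    obtain ⟨w, hw, hreg⟩ := h.exists_isRegularMod W fun P hP hIP hWP =>
      hW P hP (sup_le hIP (Ideal.span_le.2 (by rintro _ ⟨w, hw, rfl⟩; exact hWP w hw)))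
    have hw0 : w ≠ 0 := by
      rintro rfl
      have h1 : (1 : MvPolynomial (Fin v) k) ∈ I := hreg 1 (by simp [linForm])
      simpa [mem_idealOfVars_iff] using hI h1
    obtain ⟨D, hD⟩ := exists_isCompl (Submodule.span k {w})
    have hwW : Submodule.span k {w} ≤ W := (Submodule.span_singleton_le_iff_mem w W).2 hw
    have hsup : Submodule.span k {w} ⊔ D ⊓ W = W := by
      rw [← sup_inf_assoc_of_le D hwW, hD.sup_eq_top, top_inf_eq]
    have hrank : Module.finrank k ↥(D ⊓ W) = n := by
      have h1 := Submodule.finrank_sup_add_finrank_inf_eq (Submodule.span k {w}) (D ⊓ W)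
      rw [hsup, ← inf_assoc, hD.inf_eq_bot, bot_inf_eq, finrank_bot, hn,
        finrank_span_singleton hw0] at h1
      omega
    have hspan : linSpan W = Ideal.span {linForm w} ⊔ linSpan (D ⊓ W) := by
      conv_lhs => rw [← hsup, linSpan_sup, linSpan_span, Set.image_singleton]
    obtain ⟨l, hl, hlr, hlW⟩ := ih
      (sup_le hI ((Ideal.span_singleton_le_iff_mem _).2 (by
        have := forms_le_pow_idealOfVars (n := 1) (by norm_num) (linForm_mem w)
        rwa [pow_one] at this)))
      (h.quotient (linForm_mem w) hreg) (D ⊓ W) hrank (by rwa [sup_assoc, ← hspan])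
    refine ⟨linForm w :: l, by rw [List.length_cons, hl], ⟨linForm_mem w, hreg, hlr⟩, ?_⟩
    rw [sup_ofList_cons, hlW, sup_assoc, ← hspan]

/-- In a Cohen–Macaulay ring an ideal generated by a linear system of parameters is generated by a
regular sequence of linear forms. -/
theorem IsLinearParameterIdeal.exists_isLinearRegular [Infinite k]
    {I : Ideal (MvPolynomial (Fin v) k)} (hI : IsGraded I) (hm : I ≤ idealOfVars (Fin v) k) {d : ℕ}
    (h : DepthGE I d) {Q : Ideal (MvPolynomial (Fin v) k ⧸ I)} (hQ : IsLinearParameterIdeal I d Q) :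
    ∃ l, l.length = d ∧ IsLinearRegular I l ∧ I ⊔ Ideal.ofList l = Q.comap (Ideal.Quotient.mk I) ∧
      ∃ N : ℕ, ∀ n : ℕ, N ≤ n → ∀ f ∈ forms k v n, f ∈ I ⊔ Ideal.ofList l := by
  obtain ⟨hdim, a, ha, rfl, hrad⟩ := hQ
  have h1 : ∀ i, ∃ w : Fin v → k, Ideal.Quotient.mk I (linForm w) = a i := fun i => by
    obtain ⟨f, hf, hfa⟩ := mem_piece.1 (ha i)
    obtain ⟨w, rfl⟩ := exists_linForm (by simpa using hf)
    exact ⟨w, hfa⟩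
  choose w hw using h1
  let W := Submodule.span k (Set.range w)
  have hQ : (Ideal.span (Set.range a)).comap (Ideal.Quotient.mk I) = I ⊔ linSpan W := by
    have h2 : Ideal.span (Set.range a) = (linSpan W).map (Ideal.Quotient.mk I) := by
      rw [linSpan_span, Ideal.map_span, ← Set.range_comp, ← Set.range_comp]
      congr 2
      ext i
      exact (hw i).symm
    rw [h2, Ideal.comap_map_of_surjective' _ Ideal.Quotient.mk_surjective, Ideal.mk_ker, sup_comm]
  have hm' : idealOfVars (Fin v) k ≤ (I ⊔ linSpan W).radical := by
    rw [← hQ, ← Ideal.comap_radical, hrad]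
    exact Ideal.le_comap_map
  have hrank : Module.finrank k W ≤ d := by
    have := finrank_range_le_card (R := k) w
    rwa [Fintype.card_fin] at this
  obtain ⟨l, hl, hlr, hlW⟩ := (h.mono hrank).exists_isLinearRegular_eq_linSpan hm W rfl
    fun P hP hWP i => (hP.radical_le_iff.2 hWP) (hm' (Ideal.subset_span ⟨i, rfl⟩))
  obtain ⟨N, hN⟩ := Ideal.exists_pow_le_of_le_radical_of_fg hm'
    (IsNoetherian.noetherian (idealOfVars (Fin v) k))
  have hN' : ∀ n : ℕ, N ≤ n → ∀ f ∈ forms k v n, f ∈ I ⊔ Ideal.ofList l := fun n hn f hf => by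
    rw [hlW]
    exact hN (forms_le_pow_idealOfVars (by exact_mod_cast hn) hf)
  have hd := ringKrullDim_le_length hI hlr.mem_forms hN'
  rw [hdim, hl] at hd
  refine ⟨l, ?_, hlr, by rw [hlW, hQ], N, hN'⟩
  have : d ≤ Module.finrank k W := by exact_mod_cast hd
  omega

end Parameters

/-! ### Artinian reductions with linear resolution -/

section Truncated

variable {k : Type*} [Field k] {v c : ℕ}

/-- The homomorphism of polynomial rings that is given on linear forms by the linear map `T`. -/
def linSubst (T : (Fin v → k) →ₗ[k] (Fin c → k)) :
    MvPolynomial (Fin v) k →ₐ[k] MvPolynomial (Fin c) k :=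
  aeval fun i => linForm (T (Pi.single i 1))

theorem linSubst_X (T : (Fin v → k) →ₗ[k] (Fin c → k)) (i : Fin v) :
    linSubst T (X i) = linForm (T (Pi.single i 1)) := aeval_X _ _

theorem linForm_sum {ι : Type*} (s : Finset ι) (a : ι → Fin v → k) :
    linForm (∑ i ∈ s, a i) = ∑ i ∈ s, linForm (a i) := by
  classical
  induction s using Finset.induction_on with
  | empty => simp [linForm]
  | insert i s hi ih => rw [Finset.sum_insert hi, Finset.sum_insert hi, linForm_add, ih]

theorem linSubst_linForm (T : (Fin v → k) →ₗ[k] (Fin c → k)) (w : Fin v → k) :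
    linSubst T (linForm w) = linForm (T w) := by
  have h : w = ∑ i, w i • Pi.single i (1 : k) := by
    conv_lhs => rw [← Finset.univ_sum_single w]
    refine Finset.sum_congr rfl fun i _ => ?_
    rw [← Pi.single_smul, smul_eq_mul, mul_one]
  conv_rhs => rw [h, map_sum, linForm_sum]
  rw [linForm, map_sum]
  refine Finset.sum_congr rfl fun i _ => ?_
  rw [map_mul, linSubst_X, map_smul, linForm_smul, ← algebraMap_eq, AlgHom.commutes, algebraMap_eq]

theorem linSubst_mem_forms (T : (Fin v → k) →ₗ[k] (Fin c → k)) {n : ℤ}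
    {f : MvPolynomial (Fin v) k} (hf : f ∈ forms k v n) : linSubst T f ∈ forms k c n := by
  rcases lt_or_ge n 0 with hn | hn
  · rw [eq_zero_of_mem_forms_neg hn hf, map_zero]
    exact zero_mem _
  · lift n to ℕ using hn
    have h : ∀ i, (linForm (T (Pi.single i 1))).IsHomogeneous 1 := fun i =>
      mem_forms_natCast.1 (by simpa using linForm_mem _)
    have := (mem_forms_natCast.1 hf).aeval _ h
    rw [one_mul] at this
    exact mem_forms_natCast.2 this

theorem linSubst_mem_pow (T : (Fin v → k) →ₗ[k] (Fin c → k)) {q : ℕ}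
    {f : MvPolynomial (Fin v) k} (hf : f ∈ idealOfVars (Fin v) k ^ q) :
    linSubst T f ∈ idealOfVars (Fin c) k ^ q := by
  have h : (idealOfVars (Fin v) k).map (linSubst T) ≤ idealOfVars (Fin c) k := by
    rw [idealOfVars, Ideal.map_span, Ideal.span_le]
    rintro _ ⟨_, ⟨i, rfl⟩, rfl⟩
    have := forms_le_pow_idealOfVars (n := 1) (by norm_num) (linForm_mem (T (Pi.single i 1)))
    rw [pow_one] at this
    rwa [linSubst_X]
  have h2 := Ideal.mem_map_of_mem (linSubst T) hf
  rw [Ideal.map_pow] at h2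
  exact Ideal.pow_right_mono h q h2

theorem linSubst_comp {b : ℕ} (T : (Fin v → k) →ₗ[k] (Fin c → k))
    (T' : (Fin c → k) →ₗ[k] (Fin b → k)) :
    (linSubst T').comp (linSubst T) = linSubst (T' ∘ₗ T) := by
  ext i : 1
  rw [AlgHom.comp_apply, linSubst_X, linSubst_linForm, linSubst_X]
  rfl

theorem linSubst_id : linSubst (LinearMap.id : (Fin v → k) →ₗ[k] (Fin v → k)) = AlgHom.id k _ := by
  ext i : 1
  rw [linSubst_X, LinearMap.id_apply, linForm_single]
  rfl

/-- The quotient of `S` by an ideal containing all forms of degree `q` whose forms of smaller degree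
are generated by linear forms is a truncated polynomial ring. -/
theorem isoTruncatedPolynomial {I : Ideal (MvPolynomial (Fin v) k)} (hI : IsGraded I)
    {Q : Ideal (MvPolynomial (Fin v) k ⧸ I)} {l : List (MvPolynomial (Fin v) k)}
    (hl : ∀ θ ∈ l, θ ∈ forms k v 1) (hQ : I ⊔ Ideal.ofList l = Q.comap (Ideal.Quotient.mk I))
    {q : ℕ} (hc : hilb (I ⊔ Ideal.ofList l) 1 = c)
    (hq : ∀ n < q, ∀ f ∈ forms k v (n : ℕ), f ∈ I → f = 0)
    (hJ : ∀ n : ℕ, q ≤ n → ∀ f ∈ forms k v n, f ∈ I ⊔ Ideal.ofList l) :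
    IsoTruncatedPolynomial I Q c q := by
  set J := I ⊔ Ideal.ofList l with hJdef
  let Λ : (Fin v → k) →ₗ[k] MvPolynomial (Fin v) k ⧸ J :=
    { toFun := fun w => Ideal.Quotient.mk J (linForm w)
      map_add' := fun a b => by rw [linForm_add, map_add]
      map_smul' := fun r a => by rw [linForm_smul, ← smul_eq_C_mul]; rfl }
  have hΛ : ∀ w, Λ w = 0 ↔ linForm w ∈ J := fun w => Ideal.Quotient.eq_zero_iff_mem
  have hrange : LinearMap.range Λ = piece J 1 := by
    ext y
    rw [mem_piece]
    constructor
    · rintro ⟨w, rfl⟩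
      exact ⟨linForm w, by simpa using linForm_mem w, rfl⟩
    · rintro ⟨f, hf, rfl⟩
      obtain ⟨w, rfl⟩ := exists_linForm (by simpa using hf)
      exact ⟨w, rfl⟩
  have e : LinearMap.range Λ ≃ₗ[k] (Fin c → k) :=
    LinearEquiv.ofFinrankEq _ _ (by
      rw [hrange, Module.finrank_fin_fun]
      exact hc)
  obtain ⟨T, hTs, hT⟩ : ∃ T : (Fin v → k) →ₗ[k] (Fin c → k), Function.Surjective T ∧
      ∀ w, T w = 0 ↔ linForm w ∈ J := by
    refine ⟨e.toLinearMap ∘ₗ Λ.rangeRestrict, e.surjective.comp Λ.surjective_rangeRestrict,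
      fun w => ?_⟩
    rw [← hΛ]
    change e (Λ.rangeRestrict w) = 0 ↔ _
    rw [LinearEquiv.map_eq_zero_iff, Subtype.ext_iff]
    rfl
  obtain ⟨T', hT'⟩ := LinearMap.exists_rightInverse_of_surjective T (LinearMap.range_eq_top.2 hTs)
  have hψI : ∀ f ∈ J, linSubst T f ∈ idealOfVars (Fin c) k ^ q := by
    have h1 : I ≤ (idealOfVars (Fin c) k ^ q).comap (linSubst T) := by
      intro f hf
      refine linSubst_mem_pow T ?_
      rw [exists_sum_component f]
      refine sum_mem fun i _ => ?_
      by_cases hi : i < q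
      · rw [hq i hi _ (component_mem _ _) (hI f hf _)]
        exact zero_mem _
      · exact forms_le_pow_idealOfVars (by exact_mod_cast not_lt.1 hi) (component_mem _ _)
    have h2 : Ideal.ofList l ≤ (idealOfVars (Fin c) k ^ q).comap (linSubst T) := by
      refine Ideal.span_le.2 fun θ hθ => ?_
      obtain ⟨w, rfl⟩ := exists_linForm (hl θ hθ)
      change linSubst T (linForm w) ∈ idealOfVars (Fin c) k ^ q
      rw [linSubst_linForm, (hT w).2 (Ideal.mem_sup_right (Ideal.subset_span hθ))]
      simp [linForm]
    exact sup_le h1 h2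
  have hσ : ∀ g ∈ idealOfVars (Fin c) k ^ q, linSubst T' g ∈ J := by
    intro g hg
    have hg := linSubst_mem_pow T' hg
    rw [exists_sum_component (linSubst T' g)]
    refine sum_mem fun i _ => ?_
    by_cases hi : i < q
    · have : component (i : ℤ) (linSubst T' g) = 0 :=
        component_eq_zero_of_mem_pow (Ideal.pow_le_pow_right (by omega) hg)
      rw [this]
      exact zero_mem _
    · exact hJ i (by omega) _ (component_mem _ _)
  have hψσ : (linSubst T).comp (linSubst T') = AlgHom.id k _ := by
    rw [linSubst_comp, hT', linSubst_id]
  have hQmk : ∀ f, Ideal.Quotient.mk I f ∈ Q ↔ f ∈ J := fun f => by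
    rw [hQ, Ideal.mem_comap]
  let π := (Ideal.Quotient.mkₐ k Q).comp (Ideal.Quotient.mkₐ k I)
  let ρ := Ideal.Quotient.mkₐ k (idealOfVars (Fin c) k ^ q)
  have hπ : ∀ f, π f = 0 ↔ f ∈ J := fun f => by
    rw [← hQmk]
    exact Ideal.Quotient.eq_zero_iff_mem
  let Φ₁ : (MvPolynomial (Fin v) k ⧸ I) →ₐ[k]
      (MvPolynomial (Fin c) k ⧸ idealOfVars (Fin c) k ^ q) :=
    Ideal.Quotient.liftₐ I (ρ.comp (linSubst T)) fun f hf =>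
      Ideal.Quotient.eq_zero_iff_mem.2 (hψI f (Ideal.mem_sup_left hf))
  let Φ : ((MvPolynomial (Fin v) k ⧸ I) ⧸ Q) →ₐ[k]
      (MvPolynomial (Fin c) k ⧸ idealOfVars (Fin c) k ^ q) :=
    Ideal.Quotient.liftₐ Q Φ₁ fun y hy => by
      obtain ⟨f, rfl⟩ := Ideal.Quotient.mk_surjective y
      exact Ideal.Quotient.eq_zero_iff_mem.2 (hψI f ((hQmk f).1 hy))
  let Ψ : (MvPolynomial (Fin c) k ⧸ idealOfVars (Fin c) k ^ q) →ₐ[k]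
      ((MvPolynomial (Fin v) k ⧸ I) ⧸ Q) :=
    Ideal.Quotient.liftₐ _ (π.comp (linSubst T')) fun g hg => (hπ _).2 (hσ g hg)
  have hΦ : ∀ f, Φ (π f) = ρ (linSubst T f) := fun f => rfl
  have hΨ : ∀ g, Ψ (ρ g) = π (linSubst T' g) := fun g => rfl
  have h1 : ∀ y, Φ (Ψ y) = y := by
    intro y
    obtain ⟨g, rfl⟩ := Ideal.Quotient.mk_surjective y
    change Φ (Ψ (ρ g)) = ρ g
    rw [hΨ, hΦ, ← AlgHom.comp_apply (linSubst T), hψσ, AlgHom.id_apply]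
  have h2 : ∀ z, Ψ (Φ z) = z := by
    have h3 : π.comp ((linSubst T').comp (linSubst T)) = π := by
      ext i : 1
      rw [linSubst_comp, AlgHom.comp_apply, linSubst_X, ← sub_eq_zero, ← map_sub, hπ]
      have h4 : X i = linForm (Pi.single i (1 : k)) := (linForm_single i).symm
      have h5 : ∀ a b : Fin v → k, linForm a - linForm b = linForm (a - b) := fun a b => by
        rw [sub_eq_iff_eq_add, ← linForm_add, sub_add_cancel]
      rw [h4, h5, ← hT, map_sub]
      have h6 : ∀ w, T (T' w) = w := fun w => LinearMap.congr_fun hT' w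
      rw [LinearMap.comp_apply, h6, sub_self]
    intro z
    obtain ⟨y, rfl⟩ := Ideal.Quotient.mk_surjective z
    obtain ⟨f, rfl⟩ := Ideal.Quotient.mk_surjective y
    change Ψ (Φ (π f)) = π f
    rw [hΦ, hΨ]
    exact DFunLike.congr_fun h3 f
  refine ⟨AlgEquiv.ofAlgHom Φ Ψ (AlgHom.ext h1) (AlgHom.ext h2), fun n => ?_⟩
  ext y
  rw [mem_piece]
  constructor
  · rintro ⟨_, ⟨_, hy, rfl⟩, rfl⟩
    obtain ⟨f, hf, rfl⟩ := mem_piece.1 hy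
    exact ⟨_, linSubst_mem_forms T hf, rfl⟩
  · rintro ⟨g, hg, rfl⟩
    refine ⟨_, ⟨_, mem_piece.2 ⟨_, linSubst_mem_forms T' hg, rfl⟩, rfl⟩, ?_⟩
    exact h1 (ρ g)

end Truncated

/-! ### Initial degree and top degree -/

section Degrees

variable {k : Type*} [Field k] {v : ℕ} {I : Ideal (MvPolynomial (Fin v) k)}

/-- The generators of least degree in a minimal resolution are the forms of least degree in `I`. -/
theorem isIndeg_of_isIndegIdeal (h : Nonempty (MinimalGradedFreeResolution I))
    {q : ℕ} (hq : IsIndegIdeal I q) : IsIndeg I q := by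
  classical
  let F := h.some
  have hlow : ∀ m, (q : ℤ) ≤ F.deg 1 m := by
    intro m
    have hcol : ∃ l, F.diff 0 l m ≠ 0 := by
      by_contra! hcol
      have hker : Pi.single m 1 ∈ LinearMap.ker (F.diff 0).mulVecLin := by
        rw [LinearMap.mem_ker, Matrix.mulVecLin_apply, Matrix.mulVec_single_one]
        ext l
        simp [hcol l]
      rw [F.exact] at hker
      obtain ⟨f, hf⟩ := hker
      have := F.mulVec_mem_idealOfVars 1 f m
      rw [hf, Pi.single_eq_same, mem_idealOfVars_iff] at this
      simp at this
    obtain ⟨l, hl⟩ := hcol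
    obtain ⟨n, hn, hdeg⟩ := (F.homogeneous 0 l m).resolve_left hl
    have hdeg : F.deg 1 m = F.deg 0 l + n := hdeg
    rw [F.deg_zero] at hdeg
    have hmem : F.diff 0 l m ∈ I := by
      have := (F.exact_zero ((F.diff 0).mulVecLin (Pi.single m 1))).1 ⟨_, rfl⟩ l
      rwa [Matrix.mulVecLin_apply, Matrix.mulVec_single_one] at this
    have := hq.2 ⟨_, hmem, hl, hn⟩
    omega
  constructor
  · rw [Set.mem_ofPred_eq, gradedBetti_ne_zero_iff_exists h]
    obtain ⟨f, hfI, hf0, hf⟩ := hq.1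
    obtain ⟨g, hg, hgf⟩ := F.surjective_on_pieces 0 (n := q) (y := fun _ => f)
      ((F.exact_zero _).2 fun _ => hfI)
      (fun l => by rw [F.deg_zero, sub_zero]; exact mem_forms_natCast.2 hf)
    have l₀ : Fin (F.rank 0) := ⟨0, by rw [F.rank_zero]; exact one_pos⟩
    have hne : ∑ m, F.diff 0 l₀ m * g m ≠ 0 := by
      have := congrFun hgf l₀
      rw [Matrix.mulVecLin_apply, Matrix.mulVec, dotProduct] at this
      rwa [this]
    obtain ⟨m, -, hm⟩ := Finset.exists_ne_zero_of_sum_ne_zero hne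
    refine ⟨m, le_antisymm ?_ (hlow m)⟩
    by_contra hlt
    refine right_ne_zero_of_mul hm (eq_zero_of_mem_forms_neg ?_ (hg m))
    change (q : ℤ) - F.deg 1 m < 0
    change ¬ F.deg 1 m ≤ q at hlt
    omega
  · intro j hj
    obtain ⟨m, rfl⟩ := (gradedBetti_ne_zero_iff_exists h 1 j).1 hj
    exact hlow m

/-- The top degree of `S / J`, if finite. -/
theorem exists_top_degree {J : Ideal (MvPolynomial (Fin v) k)} (hJ : J ≤ idealOfVars (Fin v) k)
    {N : ℕ} (hN : ∀ n : ℕ, N ≤ n → ∀ f ∈ forms k v n, f ∈ J) :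
    ∃ s : ℕ, (¬ ∀ f ∈ forms k v s, f ∈ J) ∧ ∀ n > (s : ℤ), ∀ f ∈ forms k v n, f ∈ J := by
  classical
  let p : ℕ → Prop := fun n => ¬ ∀ f ∈ forms k v n, f ∈ J
  have hp0 : p 0 := fun h0 => by
    have := hJ (h0 (C 1) (C_mem_forms 1))
    simp [mem_idealOfVars_iff] at this
  refine ⟨Nat.findGreatest p N, Nat.findGreatest_spec (Nat.zero_le N) hp0, fun n hn => ?_⟩
  lift n to ℕ using by omega
  have hn : Nat.findGreatest p N < n := by exact_mod_cast hn
  rcases le_or_gt n N with h | h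
  · exact not_not.1 (Nat.findGreatest_is_greatest hn h)
  · exact hN n h.le

theorem multichoose_pos {c : ℕ} (hc : 1 ≤ c) (n : ℕ) : 0 < Nat.multichoose c n := by
  rw [Nat.multichoose_eq]
  exact Nat.choose_pos (by omega)

theorem sum_multichoose {c q : ℕ} (hq : 1 ≤ q) :
    ∑ n ∈ Finset.range q, Nat.multichoose c n = (c + q - 1).choose (q - 1) := by
  obtain ⟨r, rfl⟩ := Nat.exists_eq_add_of_le' hq
  rw [Nat.sum_range_multichoose, Nat.add_sub_cancel, ← add_assoc, Nat.add_sub_cancel, add_comm c,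
    Nat.choose_symm_add]

/-- The top degree of an Artinian reduction is at least `q - 1`, with equality if and only if the
length is the least possible one. -/
theorem length_artinian_reduction {h : ℕ → ℕ} {c q s : ℕ} (hc : 1 ≤ c) (hq : 1 ≤ q)
    (hlow : ∀ n < q, h n = Nat.multichoose c n) (hs : h s ≠ 0) (hs' : ∀ n > s, h n = 0) :
    q ≤ s + 1 ∧ (c + q - 1).choose (q - 1) ≤ ∑ n ∈ Finset.range (s + 1), h n ∧
      (∑ n ∈ Finset.range (s + 1), h n = (c + q - 1).choose (q - 1) ↔ s + 1 = q) := by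
  have hqs : q ≤ s + 1 := by
    by_contra hlt
    have h1 := hlow (s + 1) (by omega)
    rw [hs' (s + 1) (by omega)] at h1
    exact (multichoose_pos hc (s + 1)).ne h1
  have hsum : ∑ n ∈ Finset.range q, h n = (c + q - 1).choose (q - 1) := by
    rw [← sum_multichoose hq]
    exact Finset.sum_congr rfl fun n hn => hlow n (Finset.mem_range.1 hn)
  refine ⟨hqs, ?_, ?_, ?_⟩
  · rw [← hsum]
    exact Finset.sum_le_sum_of_subset (Finset.range_mono hqs)
  · intro heq
    by_contra hne
    have h1 : ∑ n ∈ Finset.range q, h n ≤ ∑ n ∈ Finset.range s, h n :=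
      Finset.sum_le_sum_of_subset (Finset.range_mono (by omega))
    rw [Finset.sum_range_succ] at heq
    omega
  · rintro rfl
    exact hsum

/-- If `A` is Cohen–Macaulay, its homogeneous depth is at least the height of `𝔐`. -/
theorem IsCohenMacaulay.depthGE (hI : IsGraded I) (hCM : IsCohenMacaulay I) :
    I ≤ idealOfVars (Fin v) k ∧ ∃ m : ℕ, DepthGE I m ∧ (irrelevant I).height = m := by
  obtain ⟨hprime, -, rs, hmax, hreg, hdim⟩ := hCM
  refine ⟨hI.le_idealOfVars ?_, rs.length, ?_, ?_⟩
  · rintro rfl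
    refine hprime.ne_top ((Ideal.eq_top_iff_one _).2 ?_)
    have : (1 : MvPolynomial (Fin v) k ⧸ (⊤ : Ideal (MvPolynomial (Fin v) k))) = 0 :=
      Ideal.Quotient.eq_zero_iff_mem.2 Submodule.mem_top
    rw [this]
    exact zero_mem _
  · exact depthGE_of_isWeaklyRegular rs hmax hreg.toIsWeaklyRegular
  · have := IsLocalization.AtPrime.ringKrullDim_eq_height (irrelevant I)
      (Localization.AtPrime (irrelevant I))
    rw [hdim] at this
    exact_mod_cast this.symm

theorem IsLinearRegular.sup_ofList_le_idealOfVars (hm : I ≤ idealOfVars (Fin v) k)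
    {l : List (MvPolynomial (Fin v) k)} (hl : IsLinearRegular I l) :
    I ⊔ Ideal.ofList l ≤ idealOfVars (Fin v) k := by
  refine sup_le hm (Ideal.span_le.2 fun θ hθ => ?_)
  have := forms_le_pow_idealOfVars (n := 1) (by norm_num) (hl.mem_forms θ hθ)
  rwa [pow_one] at this

end Degrees

end HomogeneousAlgebra

end

open HomogeneousAlgebra

theorem mainTheorem10 {k : Type*} [Field k] [Infinite k] {v : ℕ}
    (I : Ideal (MvPolynomial (Fin v) k))
    (hI : HomogeneousAlgebra.IsGradedIdeal I)
    (d c q : ℕ) (hd : 1 ≤ d) (hc : 1 ≤ c) (hq : 2 ≤ q)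
    (hdim : ringKrullDim (MvPolynomial (Fin v) k ⧸ I) = d)
    (hcodim : HomogeneousAlgebra.IsCodim I c)
    (hindeg : HomogeneousAlgebra.IsIndegIdeal I q)
    (hCM : HomogeneousAlgebra.IsCohenMacaulay I) :
    ∃ (e : ℕ) (a r : ℤ),
      HomogeneousAlgebra.IsMultiplicity (HomogeneousAlgebra.irrelevant I) e ∧
      HomogeneousAlgebra.IsAInvariant I a ∧
      HomogeneousAlgebra.IsReg I r ∧
      (c + q - 1).choose (q - 1) ≤ e ∧
      a = r - d ∧ (q : ℤ) - d - 1 ≤ a ∧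
      [e = (c + q - 1).choose (q - 1),
        a = (q : ℤ) - d - 1,
        HomogeneousAlgebra.HasLinearResolution I q].TFAE ∧
      (HomogeneousAlgebra.HasLinearResolution I q →
        ∀ Q : Ideal (MvPolynomial (Fin v) k ⧸ I),
          HomogeneousAlgebra.IsLinearParameterIdeal I d Q →
            HomogeneousAlgebra.IsoTruncatedPolynomial I Q c q) := by
  have hG := hI.isGraded
  obtain ⟨hm, m, hdepth, hheight⟩ := IsCohenMacaulay.depthGE hG hCM
  obtain ⟨l, rfl, hl⟩ := hdepth.exists_isLinearRegular
  obtain ⟨N, hN⟩ := hl.exists_forall_forms_le hG hm hheight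
  have hld : l.length = d := by
    have h1 := ringKrullDim_le_length hG hl.mem_forms hN
    have hprime : (irrelevant I).IsPrime := Ideal.isPrime_map_quotientMk_of_isPrime hm
    have h2 := Ideal.height_le_ringKrullDim_of_isPrime (I := irrelevant I)
    rw [hheight, hdim] at h2
    rw [hdim] at h1
    have h1 : d ≤ l.length := by exact_mod_cast h1
    have h2 : l.length ≤ d := by exact_mod_cast h2
    omega
  subst hld
  -- `l` is a maximal regular sequence of linear forms, and `S / (I + (l))` is Artinian
  have hlow : ∀ n < q, ∀ f ∈ forms k v (n : ℕ), f ∈ I → f = 0 := by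
    intro n hn f hf hfI
    by_contra h0
    exact absurd (hindeg.2 ⟨f, hfI, h0, mem_forms_natCast.1 hf⟩) (by omega)
  have hv : v = c + l.length := by
    obtain ⟨d', hd', h1⟩ := hcodim
    have : l.length = d' := by exact_mod_cast hdim.symm.trans hd'
    have h2 : hilb I 1 = v := by
      rw [hilb_eq_hilb_bot (hlow 1 (by omega)), hilb_bot, Nat.multichoose_one_right]
    change hilb I 1 = _ at h1
    omega
  have hres := exists_minimalGradedFreeResolution hG hm
  obtain ⟨s, hs, hs'⟩ := exists_top_degree (hl.sup_ofList_le_idealOfVars hm) hN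
  have hs0 : ∀ n > s, hilb (I ⊔ Ideal.ofList l) n = 0 := fun n hn =>
    hilb_eq_zero_iff.2 (hs' n (by exact_mod_cast hn))
  obtain ⟨hqs, hle, hiff⟩ := length_artinian_reduction hc (by omega)
    (fun n hn => hl.hilb_sup_ofList hG hv hlow hn) (mt hilb_eq_zero_iff.1 hs) hs0
  have hreg : IsReg I s := isReg_of_isLinearRegular hres hG hl hs hs'
  have hlin : HasLinearResolution I q ↔ s + 1 = q := by
    refine ⟨fun h => ?_, fun h => ⟨isIndeg_of_isIndegIdeal hres hindeg, ?_⟩⟩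
    · have := hreg.unique h.2
      omega
    · have : (q : ℤ) - 1 = s := by omega
      rwa [this]
  refine ⟨_, _, _, hl.isMultiplicity hG hdim (s := s + 1) (fun n hn => hs0 n hn),
    hl.isAInvariant hG hd hdim hs hs', hreg, hle, rfl, by omega, ?_, ?_⟩
  · rw [hlin, hiff]
    have h2 : (s : ℤ) - l.length = (q : ℤ) - l.length - 1 ↔ s + 1 = q := by omega
    rw [h2]
    tfae_have 1 ↔ 2 := Iff.rfl
    tfae_have 2 ↔ 3 := Iff.rfl
    tfae_finish
  · intro h Q hQ
    obtain ⟨l', hl'l, hl', hQl', N', hN'⟩ := hQ.exists_isLinearRegular hG hm hdepth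
    obtain ⟨s', ht, ht'⟩ := exists_top_degree (hl'.sup_ofList_le_idealOfVars hm) hN'
    have hst : (s' : ℤ) = q - 1 := (isReg_of_isLinearRegular hres hG hl' ht ht').unique h.2
    refine isoTruncatedPolynomial hG hl'.mem_forms hQl' ?_ hlow fun n hn => ht' n (by omega)
    rw [hl'.hilb_sup_ofList (c := c) hG (hv.trans (by rw [hl'l])) hlow (by omega),
      Nat.multichoose_one_right]
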